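/- Let $k$ be an algebraically closed field of characteristic $0$. Let $m\ge 2$ and $d\ge 1$ be integers with $(1+m)d$ even, let $\xi\in k$ be a primitive $2m$-th root of unity, and put $\omega:=md$, $\gamma:=\xi^2$ and $\phi_i:=1-\gamma^{-i-1}x^d$. Let $D(m,d,\xi)$ be the Hopf algebra over $k$ which is generated as an algebra by $x^{\pm1},g,y,u_0,\dots,u_{m-1}$, with the relations $$xx^{-1}=x^{-1}x=1,\quad xg=gx,\quad xy=yx,\quad yg=\gamma gy,\quad y^m=1-x^{\omega}=1-g^m,$$ $$xu_i=u_ix^{-1},\qquad yu_i=\phi_iu_{i+1}=\xi x^du_iy,\qquad u_ig=\gamma^ix^{-2d}gu_i,$$ $$u_iu_j=(-1)^{-j}\xi^{-j}\gamma^{\frac{j(j+1)}2}\tfrac1m\,x^{-\frac{1+m}{2}d}\cdot\begin{cases}\phi_i\phi_{i+1}\cdots\phi_{m-2-j}\;y^{i+j}g,& i+j\le m-2,\\ y^{i+j}g,& i+j=m-1,\\ \phi_i\cdots\phi_{m-1}\phi_0\cdots\phi_{m-2-j}\;y^{i+j-m}g,& i+j\ge m,\end{cases}$$ for $0\le i,j\le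 m-1$, where the indices of the $u$'s are read modulo $m$ (also below), and whose comultiplication, counit and antipode are determined by $$\Delta(x)=x\otimes x,\quad \Delta(g)=g\otimes g,\quad \Delta(y)=y\otimes g+1\otimes y,\quad \Delta(u_i)=\sum_{j=0}^{m-1}\gamma^{j(i-j)}u_j\otimes x^{-jd}g^ju_{i-j},$$ $$\epsilon(x)=\epsilon(g)=\epsilon(u_0)=1,\qquad \epsilon(y)=\epsilon(u_s)=0\quad(1\le s\le m-1),$$ $$S(x)=x^{-1},\quad S(g)=g^{-1},\quad S(y)=-yg^{-1},\quad S(u_i)=(-1)^i\xi^{-i}\gamma^{-\frac{i(i+1)}2}x^{id+\frac32(1-m)d}g^{m-i-1}u_i .$$ Then $D(m,d,\xi)$ is not isomorphic, as a Hopf algebra over $k$, to any of the following Hopf algebras. (1) The polynomial algebra $k[x]$ with $x$ primitive. (2) The Laurent polynomial algebra $k[x^{\pm1}]$ with $x$ group-like. (3) The group algebra $k\mathbb D$ of the infinite dihedral group $\mathbb D=\langle g,x\mid g^2=1,\ gxg=x^{-1}\rangle$. (4) The infinite dimensional Taft algebras $H(n,t,\eta)$, where $n>1$ and $0\le t\le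 n-1$ are integers and $\eta\in k$ is a primitive $n$-th root of unity: generators $g,x$, relations $g^n=1$ and $xg=\eta gx$, with $\Delta(g)=g\otimes g$, $\Delta(x)=x\otimes g^t+1\otimes x$, $\epsilon(g)=1$, $\epsilon(x)=0$, $S(g)=g^{-1}$, $S(x)=-xg^{-t}$. (5) The generalized Liu algebras $B(n,w,\theta)$, where $n,w\ge1$ are integers and $\theta\in k$ is a primitive $n$-th root of unity: generators $x^{\pm1},g,y$, relations $xx^{-1}=x^{-1}x=1$, $xg=gx$, $xy=yx$, $yg=\theta gy$, $y^n=1-x^w=1-g^n$, with $\Delta(x)=x\otimes x$, $\Delta(g)=g\otimes g$, $\Delta(y)=y\otimes g+1\otimes y$, $\epsilon(x)=\epsilon(g)=1$, $\epsilon(y)=0$, $S(x)=x^{-1}$, $S(g)=g^{-1}$, $S(y)=-yg^{-1}$. -/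

import Mathlib

open scoped TensorProduct

/-! Algebras given by generators and relations, and Hopf algebra structures on them, given by the
values of the structure maps on the generators. -/

noncomputable section

namespace HopfPres

variable {k : Type*} [Field k] {G : Type*}

/-- The algebra `k⟨G⟩ / (rel)` presented by generators `G` and relations `rel`. -/
def Pres (rel : FreeAlgebra k G → FreeAlgebra k G → Prop) : Type _ := RingQuot rel

instance (rel : FreeAlgebra k G → FreeAlgebra k G → Prop) : Ring (Pres rel) :=
  inferInstanceAs (Ring (RingQuot rel))

instance (rel : FreeAlgebra k G → FreeAlgebra k G → Prop) : Algebra k (Pres rel) :=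
  inferInstanceAs (Algebra k (RingQuot rel))

/-- The projection `k⟨G⟩ → k⟨G⟩ / (rel)`. -/
def mk (rel : FreeAlgebra k G → FreeAlgebra k G → Prop) : FreeAlgebra k G →ₐ[k] Pres rel :=
  RingQuot.mkAlgHom k rel

/-- The image of a generator in the algebra `k⟨G⟩ / (rel)`. -/
def gen (rel : FreeAlgebra k G → FreeAlgebra k G → Prop) (a : G) : Pres rel :=
  mk rel (FreeAlgebra.ι k a)

variable {rel : FreeAlgebra k G → FreeAlgebra k G → Prop}
  {A : Type*} [Ring A] [Algebra k A]

/-- The algebra map out of `k⟨G⟩ / (rel)` given by images of the generators. -/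
def lift (f : G → A)
    (h : ∀ ⦃a b⦄, rel a b → FreeAlgebra.lift k f a = FreeAlgebra.lift k f b) :
    Pres rel →ₐ[k] A :=
  RingQuot.liftAlgHom k (A := FreeAlgebra k G) (s := rel) ⟨FreeAlgebra.lift k f, h⟩

theorem lift_gen (f : G → A)
    (h : ∀ ⦃a b⦄, rel a b → FreeAlgebra.lift k f a = FreeAlgebra.lift k f b) (a : G) :
    lift f h (gen rel a) = f a := by
  have := RingQuot.liftAlgHom_mkAlgHom_apply k (FreeAlgebra.lift k f) h (FreeAlgebra.ι k a)
  rw [FreeAlgebra.lift_ι_apply] at this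
  exact this

theorem hom_ext {f g : Pres rel →ₐ[k] A} (h : ∀ a, f (gen rel a) = g (gen rel a)) :
    f = g := by
  apply RingQuot.ringQuot_ext'
  ext a
  exact h a

theorem mk_eq_lift (z : FreeAlgebra k G) :
    mk rel z = FreeAlgebra.lift k (gen rel) z := by
  have : mk rel = FreeAlgebra.lift k (gen rel) := by
    ext a; simp; rfl
  rw [this]

theorem rel_eq {a b : FreeAlgebra k G} (h : rel a b) :
    FreeAlgebra.lift k (gen rel) a = FreeAlgebra.lift k (gen rel) b := by
  rw [← mk_eq_lift, ← mk_eq_lift]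
  exact RingQuot.mkAlgHom_rel k h

theorem induction {C : Pres rel → Prop} (hs : ∀ r : k, C (algebraMap k _ r))
    (hg : ∀ a, C (gen rel a)) (hm : ∀ a b, C a → C b → C (a * b))
    (ha : ∀ a b, C a → C b → C (a + b)) (z : Pres rel) : C z := by
  obtain ⟨w, rfl⟩ : ∃ w, mk rel w = z := RingQuot.mkAlgHom_surjective k rel z
  induction w using FreeAlgebra.induction with
  | grade0 r => rw [AlgHom.commutes]; exact hs r
  | grade1 a => exact hg a
  | mul a b h1 h2 => rw [map_mul]; exact hm _ _ h1 h2
  | add a b h1 h2 => rw [map_add]; exact ha _ _ h1 h2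

/-- A bialgebra structure on `k⟨G⟩ / (rel)` from the values of the comultiplication and the counit
on the generators. -/
abbrev bialgebra (Δ : G → Pres rel ⊗[k] Pres rel) (ε : G → k)
    (hΔ : ∀ ⦃a b⦄, rel a b → FreeAlgebra.lift k Δ a = FreeAlgebra.lift k Δ b)
    (hε : ∀ ⦃a b⦄, rel a b → FreeAlgebra.lift k ε a = FreeAlgebra.lift k ε b)
    (h1 : ∀ a, Algebra.TensorProduct.assoc k k k _ _ _
        (Algebra.TensorProduct.map (lift Δ hΔ) (.id k _) (Δ a)) =
      Algebra.TensorProduct.map (.id k _) (lift Δ hΔ) (Δ a))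
    (h2 : ∀ a, Algebra.TensorProduct.map (lift ε hε) (.id k _) (Δ a) = 1 ⊗ₜ gen rel a)
    (h3 : ∀ a, Algebra.TensorProduct.map (.id k _) (lift ε hε) (Δ a) = gen rel a ⊗ₜ 1) :
    Bialgebra k (Pres rel) :=
  Bialgebra.ofAlgHom (lift Δ hΔ) (lift ε hε)
    (hom_ext fun a => (congrArg _ (congrArg _ (lift_gen Δ hΔ a))).trans
      ((h1 a).trans (congrArg _ (lift_gen Δ hΔ a).symm)))
    (hom_ext fun a => (congrArg _ (lift_gen Δ hΔ a)).trans (h2 a))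
    (hom_ext fun a => (congrArg _ (lift_gen Δ hΔ a)).trans (h3 a))

section antipode

variable {H : Type*} [Ring H] [Algebra k H] (S : H →ₐ[k] Hᵐᵒᵖ)

/-- An anti-endomorphism as a linear map. -/
abbrev antiLin : H →ₗ[k] H := (MulOpposite.opLinearEquiv k).symm.toLinearMap ∘ₗ S.toLinearMap

theorem left_aux (z : H ⊗[k] H) (c d : H) :
    LinearMap.mul' k H ((antiLin S).rTensor H (z * (c ⊗ₜ d))) =
      antiLin S c * LinearMap.mul' k H ((antiLin S).rTensor H z) * d := by
  induction z with
  | zero => simp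
  | tmul a b => simp [mul_assoc]
  | add a b h1 h2 => simp only [add_mul, map_add, h1, h2, mul_add]

theorem right_aux (z : H ⊗[k] H) (c d : H) :
    LinearMap.mul' k H ((antiLin S).lTensor H ((c ⊗ₜ d) * z)) =
      c * LinearMap.mul' k H ((antiLin S).lTensor H z) * antiLin S d := by
  induction z with
  | zero => simp
  | tmul a b => simp [mul_assoc]
  | add a b h1 h2 => simp only [add_mul, map_add, h1, h2, mul_add]

theorem left_mul (z w : H ⊗[k] H) (r s : k)
    (hz : LinearMap.mul' k H ((antiLin S).rTensor H z) = algebraMap k H r)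
    (hw : LinearMap.mul' k H ((antiLin S).rTensor H w) = algebraMap k H s) :
    LinearMap.mul' k H ((antiLin S).rTensor H (z * w)) = algebraMap k H (r * s) := by
  have : ∀ w, LinearMap.mul' k H ((antiLin S).rTensor H (z * w)) =
      r • LinearMap.mul' k H ((antiLin S).rTensor H w) := by
    intro w
    induction w with
    | zero => simp
    | tmul a b => rw [left_aux, hz, ← Algebra.commutes, mul_assoc, ← Algebra.smul_def]; simp
    | add a b h1 h2 => simp only [mul_add, map_add, h1, h2, smul_add]
  rw [this, hw, Algebra.smul_def, map_mul]

theorem right_mul (z w : H ⊗[k] H) (r s : k)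
    (hz : LinearMap.mul' k H ((antiLin S).lTensor H z) = algebraMap k H r)
    (hw : LinearMap.mul' k H ((antiLin S).lTensor H w) = algebraMap k H s) :
    LinearMap.mul' k H ((antiLin S).lTensor H (z * w)) = algebraMap k H (r * s) := by
  have : ∀ z, LinearMap.mul' k H ((antiLin S).lTensor H (z * w)) =
      s • LinearMap.mul' k H ((antiLin S).lTensor H z) := by
    intro z
    induction z with
    | zero => simp
    | tmul a b => rw [right_aux, hw, ← Algebra.commutes, mul_assoc, ← Algebra.smul_def]; simp
    | add a b h1 h2 => simp only [add_mul, map_add, h1, h2, smul_add]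
  rw [this, hz, Algebra.smul_def, map_mul, Algebra.commutes]

end antipode

/-- A Hopf algebra structure on `k⟨G⟩ / (rel)` from the values of the comultiplication, the counit
and the antipode on the generators. -/
abbrev hopfAlgebra (Δ : G → Pres rel ⊗[k] Pres rel) (ε : G → k) (S : G → Pres rel)
    (hΔ : ∀ ⦃a b⦄, rel a b → FreeAlgebra.lift k Δ a = FreeAlgebra.lift k Δ b)
    (hε : ∀ ⦃a b⦄, rel a b → FreeAlgebra.lift k ε a = FreeAlgebra.lift k ε b)
    (hS : ∀ ⦃a b⦄, rel a b → FreeAlgebra.lift k (fun c => MulOpposite.op (S c)) a =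
      FreeAlgebra.lift k (fun c => MulOpposite.op (S c)) b)
    (h1 : ∀ a, Algebra.TensorProduct.assoc k k k _ _ _
        (Algebra.TensorProduct.map (lift Δ hΔ) (.id k _) (Δ a)) =
      Algebra.TensorProduct.map (.id k _) (lift Δ hΔ) (Δ a))
    (h2 : ∀ a, Algebra.TensorProduct.map (lift ε hε) (.id k _) (Δ a) = 1 ⊗ₜ gen rel a)
    (h3 : ∀ a, Algebra.TensorProduct.map (.id k _) (lift ε hε) (Δ a) = gen rel a ⊗ₜ 1)
    (h4 : ∀ a, LinearMap.mul' k _ ((antiLin (lift _ hS)).rTensor _ (Δ a)) =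
      algebraMap k (Pres rel) (ε a))
    (h5 : ∀ a, LinearMap.mul' k _ ((antiLin (lift _ hS)).lTensor _ (Δ a)) =
      algebraMap k (Pres rel) (ε a)) :
    HopfAlgebra k (Pres rel) :=
  letI := bialgebra Δ ε hΔ hε h1 h2 h3
  { antipode := antiLin (lift _ hS)
    mul_antipode_rTensor_comul := by
      refine LinearMap.ext fun z => ?_
      change LinearMap.mul' k _ ((antiLin (lift _ hS)).rTensor _ (lift Δ hΔ z)) =
        algebraMap k (Pres rel) (lift ε hε z)
      induction z using induction with
      | hs r =>
        rw [AlgHom.commutes, AlgHom.commutes, Algebra.TensorProduct.algebraMap_apply]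
        simp
      | hg a => rw [lift_gen, lift_gen, h4]
      | hm a b ha hb => rw [map_mul (lift Δ hΔ), map_mul (lift ε hε)]; exact left_mul _ _ _ _ _ ha hb
      | ha a b ha hb => simp only [map_add, ha, hb]
    mul_antipode_lTensor_comul := by
      refine LinearMap.ext fun z => ?_
      change LinearMap.mul' k _ ((antiLin (lift _ hS)).lTensor _ (lift Δ hΔ z)) =
        algebraMap k (Pres rel) (lift ε hε z)
      induction z using induction with
      | hs r =>
        rw [AlgHom.commutes, AlgHom.commutes, Algebra.TensorProduct.algebraMap_apply]
        simp
      | hg a => rw [lift_gen, lift_gen, h5]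
      | hm a b ha hb => rw [map_mul (lift Δ hΔ), map_mul (lift ε hε)]; exact right_mul _ _ _ _ _ ha hb
      | ha a b ha hb => simp only [map_add, ha, hb] }

end HopfPres

end

/-! Auxiliary facts on `q`-binomial coefficients, used to check the Hopf algebra axioms. -/

noncomputable section

namespace QComb

open Finset Polynomial

/-- Gaussian binomial coefficients. -/
def qb {R : Type*} [CommRing R] (q : R) : ℕ → ℕ → R
  | _, 0 => 1
  | 0, _ + 1 => 0
  | n + 1, j + 1 => qb q n j + q ^ (j + 1) * qb q n (j + 1)

/-- `(1 - q)(1 - q²)⋯(1 - qⁿ)`. -/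
def qf {R : Type*} [CommRing R] (q : R) (n : ℕ) : R := ∏ i ∈ range n, (1 - q ^ (i + 1))

/-- `(-1)ⁿ q^(n(n-1)/2)`. -/
def qc {R : Type*} [CommRing R] (q : R) (n : ℕ) : R := ∏ i ∈ range n, (-q ^ i)

section ring
variable {R : Type*} [CommRing R] (q : R)

theorem qb_zero_right (n : ℕ) : qb q n 0 = 1 := by cases n <;> rfl

theorem qb_succ (n j : ℕ) :
    qb q (n + 1) (j + 1) = qb q n j + q ^ (j + 1) * qb q n (j + 1) := rfl

theorem qb_lt {n j : ℕ} (h : n < j) : qb q n j = 0 := by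
  induction n generalizing j with
  | zero => obtain ⟨j, rfl⟩ : ∃ i, j = i + 1 := ⟨j - 1, by omega⟩; rfl
  | succ n ih =>
    obtain ⟨j, rfl⟩ : ∃ i, j = i + 1 := ⟨j - 1, by omega⟩
    rw [qb_succ, ih (by omega), ih (by omega)]; simp

theorem qf_succ (n : ℕ) : qf q (n + 1) = qf q n * (1 - q ^ (n + 1)) := prod_range_succ _ _

theorem qc_succ (n : ℕ) : qc q (n + 1) = qc q n * (-q ^ n) := prod_range_succ _ _

theorem qb_self (n : ℕ) : qb q n n = 1 := by
  induction n with
  | zero => rfl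
  | succ n ih => rw [qb_succ, ih, qb_lt q (Nat.lt_succ_self n)]; simp

theorem qb_qf (n j : ℕ) : qb q (n + j) j * qf q j * qf q n = qf q (n + j) := by
  induction n generalizing j with
  | zero => simp [qb_self, qf]
  | succ n ihn =>
    induction j with
    | zero => simp [qb_zero_right, qf]
    | succ j ihj =>
      have h1 := ihj
      have h2 := ihn (j + 1)
      rw [show n + 1 + (j + 1) = (n + 1 + j) + 1 by ring, qb_succ, qf_succ q (n + 1 + j),
        qf_succ q j]
      rw [show n + (j + 1) = n + 1 + j by ring, qf_succ q j] at h2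
      rw [qf_succ q n] at h1 ⊢
      linear_combination (1 - q ^ (j + 1)) * h1 + q ^ (j + 1) * (1 - q ^ (n + 1)) * h2

theorem add_pow {A : Type*} [Ring A] [Algebra R A] (a b : A) (h : b * a = q • (a * b)) (n : ℕ) :
    (a + b) ^ n = ∑ e ∈ range (n + 1), qb q n e • (a ^ e * b ^ (n - e)) := by
  have hb : ∀ e, b * a ^ e = q ^ e • (a ^ e * b) := by
    intro e
    induction e with
    | zero => simp
    | succ e ih =>
      rw [pow_succ, ← mul_assoc, ih, smul_mul_assoc, mul_assoc, h, mul_smul_comm, smul_smul,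
        mul_assoc, ← pow_succ]
  induction n with
  | zero => simp [qb_zero_right]
  | succ n ih =>
    have e1 : a * (∑ e ∈ range (n + 1), qb q n e • (a ^ e * b ^ (n - e))) =
        ∑ e ∈ range (n + 1), qb q n e • (a ^ (e + 1) * b ^ (n - e)) := by
      rw [mul_sum]; refine sum_congr rfl fun e _ => ?_
      rw [mul_smul_comm, ← mul_assoc, ← pow_succ']
    have e2 : b * (∑ e ∈ range (n + 1), qb q n e • (a ^ e * b ^ (n - e))) =
        ∑ e ∈ range (n + 1), (q ^ e * qb q n e) • (a ^ e * b ^ (n + 1 - e)) := by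
      rw [mul_sum]; refine sum_congr rfl fun e he => ?_
      rw [mem_range] at he
      rw [mul_smul_comm, ← mul_assoc, hb, smul_mul_assoc, smul_smul, mul_assoc, ← pow_succ',
        mul_comm, show n - e + 1 = n + 1 - e by omega]
    have e3 : ∑ e ∈ range (n + 1), (q ^ e * qb q n e) • (a ^ e * b ^ (n + 1 - e)) =
        ∑ e ∈ range (n + 1), (q ^ (e + 1) * qb q n (e + 1)) • (a ^ (e + 1) * b ^ (n - e)) +
          b ^ (n + 1) := by
      have := sum_range_succ' (fun e => (q ^ e * qb q n e) • (a ^ e * b ^ (n + 1 - e))) (n + 1)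
      rw [sum_range_succ, qb_lt q (Nat.lt_succ_self n)] at this
      simpa [qb_zero_right] using this
    rw [pow_succ', ih, add_mul, e1, e2, e3, sum_range_succ' _ (n + 1)]
    simp only [qb_succ, add_smul, sum_add_distrib, qb_zero_right, Nat.add_sub_add_right, one_smul,
      pow_zero, one_mul, Nat.sub_zero, add_assoc]

theorem prod_expand {A : Type*} [Ring A] [Algebra R A] (r : R) (T : A) (N : ℕ) :
    aeval T (∏ l ∈ range N, (1 - C (q ^ l * r) * X)) =
      ∑ l ∈ range (N + 1), (qc q l * qb q N l * r ^ l) • T ^ l := by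
  induction N generalizing r with
  | zero => simp [qb_zero_right, qc]
  | succ N ih =>
    rw [prod_range_succ']
    have e0 : ∏ l ∈ range N, (1 - C (q ^ (l + 1) * r) * X) =
        ∏ l ∈ range N, (1 - C (q ^ l * (q * r)) * (X : R[X])) := by
      refine prod_congr rfl fun l _ => ?_
      rw [pow_succ, mul_assoc]
    rw [e0, map_mul, ih]
    have e1 : aeval T (1 - C (q ^ 0 * r) * X) = 1 - r • T := by
      simp [Algebra.smul_def]
    rw [e1, mul_sub, mul_one, sum_mul]
    conv_rhs => rw [sum_range_succ' _ (N + 1)]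
    have e2 : ∑ l ∈ range (N + 1), (qc q l * qb q N l * (q * r) ^ l) • T ^ l =
        ∑ l ∈ range (N + 1), (qc q (l + 1) * qb q N (l + 1) * (q * r) ^ (l + 1)) • T ^ (l + 1)
          + 1 := by
      have := sum_range_succ' (fun l => (qc q l * qb q N l * (q * r) ^ l) • T ^ l) (N + 1)
      rw [sum_range_succ, qb_lt q (Nat.lt_succ_self N)] at this
      simpa [qb_zero_right, qc] using this
    rw [e2, add_sub_right_comm, ← sum_sub_distrib]
    congr 1
    · refine sum_congr rfl fun l _ => ?_
      rw [smul_mul_smul_comm, ← pow_succ, ← sub_smul]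
      congr 1
      rw [qb_succ, qc_succ]
      ring
    · simp [qb_zero_right, qc]

end ring

section root
variable {k : Type*} [Field k] {m : ℕ} {γ : k}

theorem qf_ne (h : IsPrimitiveRoot γ m) {n : ℕ} (hn : n < m) : qf γ n ≠ 0 := by
  rw [qf, prod_ne_zero_iff]
  intro i hi h0
  rw [mem_range] at hi
  exact h.pow_ne_one_of_pos_of_lt (by omega) (by omega : i + 1 < m) (sub_eq_zero.mp h0).symm

theorem qb_root (h : IsPrimitiveRoot γ m) {j : ℕ} (h0 : 0 < j) (hj : j < m) : qb γ m j = 0 := by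
  have e := qb_qf γ (m - j) j
  rw [show m - j + j = m by omega] at e
  have : qf γ m = 0 := by
    rw [qf, prod_eq_zero_iff]
    exact ⟨m - 1, by rw [mem_range]; omega, by rw [show m - 1 + 1 = m by omega, h.pow_eq_one, sub_self]⟩
  rw [this] at e
  have h1 := qf_ne h hj
  have h2 := qf_ne h (show m - j < m by omega)
  simpa [h1, h2] using e

theorem add_pow_root (h : IsPrimitiveRoot γ m) (hm : 0 < m) {A : Type*} [Ring A] [Algebra k A]
    (a b : A) (hab : b * a = γ • (a * b)) : (a + b) ^ m = a ^ m + b ^ m := by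
  rw [add_pow γ a b hab, sum_range_succ]
  obtain ⟨n, rfl⟩ : ∃ n, m = n + 1 := ⟨m - 1, by omega⟩
  rw [sum_range_succ', sum_eq_zero]
  · simp [qb_zero_right, qb_self, add_comm]
  · intro e he
    rw [mem_range] at he
    rw [qb_root h (by omega) (by omega), zero_smul]

theorem inv_qf (h : IsPrimitiveRoot γ m) {a : ℕ} (ha : a + 1 ≤ m) :
    qf γ⁻¹ (m - 1 - a) * qf γ a = qf γ⁻¹ (m - 1) := by
  induction a with
  | zero => simp [qf]
  | succ a ih =>
    rw [← ih (by omega), show m - 1 - a = (m - 1 - (a + 1)) + 1 by omega, qf_succ, qf_succ]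
    have : (γ⁻¹) ^ (m - 1 - (a + 1) + 1) = γ ^ (a + 1) := by
      rw [inv_pow]
      refine inv_eq_of_mul_eq_one_right ?_
      rw [← pow_add, show m - 1 - (a + 1) + 1 + (a + 1) = m by omega, h.pow_eq_one]
    rw [this]; ring

theorem qf_inv (hγ : γ ≠ 0) (a : ℕ) : qc γ⁻¹ a * γ⁻¹ ^ a * qf γ a = qf γ⁻¹ a := by
  induction a with
  | zero => simp [qc, qf]
  | succ a ih =>
    rw [qc_succ, qf_succ, qf_succ, ← ih]
    have : γ⁻¹ ^ (a + 1) * γ ^ (a + 1) = 1 := by rw [← mul_pow, inv_mul_cancel₀ hγ, one_pow]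
    have h2 : γ⁻¹ ^ a * γ⁻¹ = γ⁻¹ ^ (a + 1) := (pow_succ _ _).symm
    rw [← h2] at this ⊢
    linear_combination (qc γ⁻¹ a * γ⁻¹ ^ a * qf γ a) * this

theorem qb_key (h : IsPrimitiveRoot γ m) {n e l : ℕ} (hn : n < m) (he : e ≤ n)
    (hl : l ≤ m - 1 - n) :
    qb γ⁻¹ (m - 1 - e) l * (qc γ⁻¹ (l + e) * γ⁻¹ ^ (l + e) * qb γ⁻¹ (m - 1 - (n - e)) (l + e)) =
      qb γ n e * qb γ⁻¹ (m - 1 - n) l := by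
  have hγ : γ ≠ 0 := h.ne_zero (by omega)
  have hi : IsPrimitiveRoot γ⁻¹ m := h.inv
  have a1 := qb_qf γ⁻¹ (m - 1 - e - l) l
  rw [show m - 1 - e - l + l = m - 1 - e by omega] at a1
  have a2 := qb_qf γ⁻¹ (m - 1 - n - l) (l + e)
  rw [show m - 1 - n - l + (l + e) = m - 1 - (n - e) by omega] at a2
  have a3 := qb_qf γ⁻¹ (m - 1 - n - l) l
  rw [show m - 1 - n - l + l = m - 1 - n by omega] at a3
  have a4 := qb_qf γ (n - e) e
  rw [show n - e + e = n by omega] at a4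
  have b1 := inv_qf h (show e + 1 ≤ m by omega)
  have b2 := inv_qf h (show (n - e) + 1 ≤ m by omega)
  have b3 := inv_qf h (show (l + e) + 1 ≤ m by omega)
  rw [show m - 1 - (l + e) = m - 1 - e - l by omega] at b3
  have b4 := inv_qf h (show n + 1 ≤ m by omega)
  have b5 := qf_inv hγ (l + e)
  have n1 := qf_ne h (show e < m by omega)
  have n2 := qf_ne h (show n - e < m by omega)
  have n3 := qf_ne h (show l + e < m by omega)
  have n4 := qf_ne h (show n < m by omega)
  have n5 := qf_ne hi (show l < m by omega)
  have n6 := qf_ne hi (show l + e < m by omega)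
  have n7 := qf_ne hi (show m - 1 - n - l < m by omega)
  have n8 := qf_ne hi (show m - 1 - e - l < m by omega)
  have n9 := qf_ne hi (show m - 1 < m by omega)
  generalize qb γ⁻¹ (m - 1 - e) l = x1 at *
  generalize qb γ⁻¹ (m - 1 - (n - e)) (l + e) = x2 at *
  generalize qb γ⁻¹ (m - 1 - n) l = x3 at *
  generalize qb γ n e = x4 at *
  generalize qc γ⁻¹ (l + e) * γ⁻¹ ^ (l + e) = t at *
  generalize qf γ⁻¹ (m - 1) = F1 at *
  generalize qf γ⁻¹ (m - 1 - e) = f1 at *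
  generalize qf γ⁻¹ (m - 1 - (n - e)) = f2 at *
  generalize qf γ⁻¹ (m - 1 - n) = f3 at *
  generalize qf γ⁻¹ (m - 1 - e - l) = f4 at *
  generalize qf γ⁻¹ (m - 1 - n - l) = f5 at *
  generalize qf γ⁻¹ l = f6 at *
  generalize qf γ⁻¹ (l + e) = f7 at *
  generalize qf γ e = g1 at *
  generalize qf γ (n - e) = g2 at *
  generalize qf γ (l + e) = g3 at *
  generalize qf γ n = g4 at *
  have c1 : x1 = f1 / (f6 * f4) := by field_simp; linear_combination a1
  have c2 : x2 = f2 / (f7 * f5) := by field_simp; linear_combination a2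
  have c3 : x3 = f3 / (f6 * f5) := by field_simp; linear_combination a3
  have c4 : x4 = g4 / (g1 * g2) := by field_simp; linear_combination a4
  have d1 : f1 = F1 / g1 := by field_simp; linear_combination b1
  have d2 : f2 = F1 / g2 := by field_simp; linear_combination b2
  have d3 : f4 = F1 / g3 := by field_simp; linear_combination b3
  have d4 : f3 = F1 / g4 := by field_simp; linear_combination b4
  have d5 : t = f7 / g3 := by field_simp; linear_combination b5
  rw [c1, c2, c3, c4, d1, d2, d3, d4, d5]
  field_simp

/-- `a ↦ γᵃ` on `ZMod m`. -/
abbrev chr [NeZero m] (h : IsPrimitiveRoot γ m) : AddChar (ZMod m) k :=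
  AddChar.zmodChar m h.pow_eq_one

variable [NeZero m] (h : IsPrimitiveRoot γ m)

theorem chr_nat (n : ℕ) : chr h (n : ZMod m) = γ ^ n := AddChar.zmodChar_apply' _ _

theorem chr_neg_nat (n : ℕ) : chr h (-(n : ZMod m)) = γ⁻¹ ^ n := by
  rw [AddChar.map_neg_eq_inv, chr_nat, inv_pow]

theorem chr_nsmul (a : ZMod m) (n : ℕ) : chr h a ^ n = chr h (a * n) := by
  rw [← AddChar.map_nsmul_eq_pow, nsmul_eq_mul, mul_comm]

theorem chr_sum (a : ZMod m) : ∑ s, chr h (s * a) = if a = 0 then (m : k) else 0 := by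
  have := AddChar.sum_mulShift a (AddChar.zmodChar_primitive_of_primitive_root m h)
  rw [this]; simp [ZMod.card]

/-- `φ_i φ_{i+1} ⋯ φ_{i+N-1}` as a polynomial in `x ^ d`. -/
def pol (i : ZMod m) (N : ℕ) : k[X] := ∏ l ∈ range N, (1 - C (chr h (-i - 1 - l)) * X)

theorem pol_expand {A : Type*} [Ring A] [Algebra k A] (T : A) (i : ZMod m) (N : ℕ) :
    aeval T (pol h i N) =
      ∑ l ∈ range (N + 1), (qc γ⁻¹ l * qb γ⁻¹ N l * chr h ((-i - 1) * l)) • T ^ l := by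
  have : pol h i N = ∏ l ∈ range N, (1 - C (γ⁻¹ ^ l * chr h (-i - 1)) * X) := by
    refine prod_congr rfl fun l _ => ?_
    rw [← chr_neg_nat h, ← AddChar.map_add_eq_mul, show -(l : ZMod m) + (-i - 1) = -i - 1 - l by ring]
  rw [this, prod_expand]
  simp only [chr_nsmul]

theorem key {A : Type*} [Ring A] [Algebra k A] (X Z : A) (hXZ : Commute X Z) (i n e : ZMod m) :
    ∑ s, chr h ((i - s) * e) • (aeval X (pol h s (m - 1 - e.val)) *
        aeval Z (pol h (i - s) (m - 1 - (n - e).val))) =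
      if e.val ≤ n.val then (m * qb γ n.val e.val : k) •
        (Z ^ e.val * aeval (X * Z) (pol h i (m - 1 - n.val))) else 0 := by
  have hev := e.val_lt
  have hnv := n.val_lt
  have hm : 0 < m := by omega
  set N := m - 1 - e.val with hN
  set M := m - 1 - (n - e).val with hM
  have e1 : ∀ s, chr h ((i - s) * e) • (aeval X (pol h s N) * aeval Z (pol h (i - s) M)) =
      ∑ l ∈ range (N + 1), ∑ r ∈ range (M + 1), chr h (s * (r - (e + l))) •
        ((chr h (i * e - l - (i + 1) * r) *
          (qc γ⁻¹ l * qb γ⁻¹ N l * (qc γ⁻¹ r * qb γ⁻¹ M r))) • (X ^ l * Z ^ r)) := by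
    intro s
    rw [pol_expand, pol_expand, sum_mul_sum, smul_sum]
    refine sum_congr rfl fun l _ => ?_
    rw [smul_sum]
    refine sum_congr rfl fun r _ => ?_
    rw [smul_mul_smul_comm, smul_smul, smul_smul]
    congr 1
    have : chr h ((i - s) * e) * (chr h ((-s - 1) * l) * chr h ((-(i - s) - 1) * r)) =
        chr h (s * (r - (e + l))) * chr h (i * e - l - (i + 1) * r) := by
      rw [← AddChar.map_add_eq_mul, ← AddChar.map_add_eq_mul, ← AddChar.map_add_eq_mul]
      congr 1; ring
    linear_combination (qc γ⁻¹ l * qb γ⁻¹ N l * (qc γ⁻¹ r * qb γ⁻¹ M r)) * this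
  rw [sum_congr rfl fun s _ => e1 s, sum_comm]
  rw [sum_congr rfl fun l _ => sum_comm]
  simp only [← sum_smul, chr_sum, sub_eq_zero]
  have hiff : ∀ l r : ℕ, l ≤ N → r ≤ M → ((r : ZMod m) = e + l ↔ r = l + e.val) := by
    intro l r hl hr
    have : (e + l : ZMod m) = ((l + e.val : ℕ) : ZMod m) := by
      push_cast; rw [ZMod.natCast_zmod_val, add_comm]
    rw [this, ZMod.natCast_eq_natCast_iff']
    rw [Nat.mod_eq_of_lt (by omega), Nat.mod_eq_of_lt (by omega)]
  have e2 : ∀ l ∈ range (N + 1), ∑ r ∈ range (M + 1), (if (r : ZMod m) = e + l then (m : k) else 0) •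
        ((chr h (i * e - l - (i + 1) * r) *
          (qc γ⁻¹ l * qb γ⁻¹ N l * (qc γ⁻¹ r * qb γ⁻¹ M r))) • (X ^ l * Z ^ r)) =
      if l + e.val ≤ M then (m : k) • ((chr h (i * e - l - (i + 1) * (l + e)) *
          (qc γ⁻¹ l * qb γ⁻¹ N l * (qc γ⁻¹ (l + e.val) * qb γ⁻¹ M (l + e.val)))) •
            (X ^ l * Z ^ (l + e.val))) else 0 := by
    intro l hl
    rw [mem_range] at hl
    split_ifs with hle
    · rw [sum_eq_single (l + e.val)]
      · rw [if_pos ((hiff _ _ (by omega) hle).2 rfl)]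
        push_cast; rw [ZMod.natCast_zmod_val]
      · intro r hr hne
        rw [mem_range] at hr
        rw [if_neg (fun hc => hne ((hiff _ _ (by omega) (by omega)).1 hc)), zero_smul]
      · intro hc; rw [mem_range] at hc; omega
    · refine sum_eq_zero fun r hr => ?_
      rw [mem_range] at hr
      rw [if_neg, zero_smul]
      intro hc
      have := (hiff _ _ (by omega) (by omega)).1 hc
      omega
  rw [sum_congr rfl e2]
  split_ifs with hle
  · have hsub : (n - e).val = n.val - e.val := ZMod.val_sub hle
    rw [pol_expand, mul_sum, smul_sum]
    have hr : range (m - 1 - n.val + 1) ⊆ range (N + 1) := range_mono (by omega)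
    rw [← sum_subset hr]
    · refine sum_congr rfl fun l hl => ?_
      rw [mem_range] at hl
      rw [if_pos (by omega), smul_smul, mul_smul_comm, smul_smul, hXZ.mul_pow,
        ← mul_assoc (Z ^ e.val), (hXZ.symm.pow_pow e.val l).eq, mul_assoc (X ^ l), ← pow_add,
        add_comm e.val l]
      congr 1
      have hk := qb_key h hnv hle (show l ≤ m - 1 - n.val by omega)
      rw [← hsub, ← hM, ← hN] at hk
      have hc : chr h (i * e - l - (i + 1) * (l + e)) =
          γ⁻¹ ^ (l + e.val) * chr h ((-i - 1) * l) := by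
        rw [← chr_neg_nat h, ← AddChar.map_add_eq_mul]
        push_cast; rw [ZMod.natCast_zmod_val]; congr 1; ring
      rw [hc]
      linear_combination (m * qc γ⁻¹ l * chr h ((-i - 1) * l)) * hk
    · intro l hl hl'
      rw [mem_range] at hl hl'
      rw [if_neg (by omega)]
  · refine sum_eq_zero fun l hl => ?_
    rw [if_neg]
    have : (n - e).val = n.val + m - e.val := by
      have h2 : ((n.val + m - e.val : ℕ) : ZMod m) = n - e := by
        rw [Nat.cast_sub (by omega)]; push_cast; simp
      rw [← h2, ZMod.val_natCast, Nat.mod_eq_of_lt (by omega)]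
    omega

end root
end QComb
end

noncomputable section

namespace QComb
open Finset Polynomial

section root
variable {k : Type*} [Field k] {m : ℕ} {γ : k}

theorem qc_root (h : IsPrimitiveRoot γ m) (hm : 0 < m) : qc γ m = -1 := by
  have e := prod_expand γ (1 : k) (1 : k) m
  rw [map_prod, prod_eq_zero (i := 0) (by simpa using hm) (by simp), sum_range_succ] at e
  obtain ⟨n, rfl⟩ : ∃ n, m = n + 1 := ⟨m - 1, by omega⟩
  rw [sum_range_succ', sum_eq_zero] at e
  · simp only [qc, prod_range_zero, qb_zero_right, qb_self] at e ⊢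
    simp at e
    linear_combination -e
  · intro l hl
    rw [mem_range] at hl
    rw [qb_root h (by omega) (by omega)]; simp

theorem qc_inv_pred (h : IsPrimitiveRoot γ m) (hm : 0 < m) : qc γ⁻¹ (m - 1) = γ⁻¹ := by
  have h1 := qc_root h.inv hm
  obtain ⟨n, rfl⟩ : ∃ n, m = n + 1 := ⟨m - 1, by omega⟩
  rw [qc_succ] at h1
  have h2 : γ⁻¹ ^ n * γ⁻¹ = 1 := by rw [← pow_succ, h.inv.pow_eq_one]
  have h3 : γ ≠ 0 := h.ne_zero (by omega)
  rw [Nat.add_sub_cancel]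
  linear_combination (-γ⁻¹) * h1 - qc γ⁻¹ n * h2

theorem qc_mul (h : IsPrimitiveRoot γ m) {n : ℕ} (hn : n < m) :
    qc γ n * qc γ⁻¹ (m - 1 - n) = γ⁻¹ ^ (1 + 2 * n) := by
  have h3 : γ ≠ 0 := h.ne_zero (by omega)
  induction n with
  | zero => simp [qc_inv_pred h (by omega : 0 < m)]; simp [qc]
  | succ n ih =>
    have i1 := ih (by omega)
    rw [show m - 1 - n = (m - 1 - (n + 1)) + 1 by omega, qc_succ] at i1
    have i2 : γ⁻¹ ^ (m - 1 - (n + 1)) * γ⁻¹ ^ (n + 2) = 1 := by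
      rw [← pow_add, show m - 1 - (n + 1) + (n + 2) = m by omega, h.inv.pow_eq_one]
    have i3 : γ ^ n * γ⁻¹ ^ n = 1 := by rw [← mul_pow, mul_inv_cancel₀ h3, one_pow]
    rw [qc_succ]
    rw [show 1 + 2 * (n + 1) = (1 + 2 * n) + 2 by ring, pow_add, ← i1]
    linear_combination (qc γ n * qc γ⁻¹ (m - 1 - (n + 1)) * γ ^ n) * i2 -
      (qc γ n * qc γ⁻¹ (m - 1 - (n + 1)) * γ⁻¹ ^ (m - 1 - (n + 1)) * γ⁻¹ ^ 2) * i3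

variable [NeZero m] (h : IsPrimitiveRoot γ m)

theorem chr_one : chr h 1 = γ := by simpa using chr_nat h 1

theorem chr_pow_val (a : ZMod m) : γ ^ a.val = chr h a := by
  rw [← chr_nat h, ZMod.natCast_zmod_val]

theorem key0 {A : Type*} [Ring A] [Algebra k A] (X : A) (e : ZMod m) :
    ∑ s, chr h (-s) • aeval X (pol h s (m - 1 - e.val)) =
      if e = 0 then (m : k) • X ^ (m - 1) else 0 := by
  have hm : 0 < m := Nat.pos_of_ne_zero (NeZero.ne m)
  have hev := e.val_lt
  have e1 : ∀ s, chr h (-s) • aeval X (pol h s (m - 1 - e.val)) =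
      ∑ l ∈ range (m - 1 - e.val + 1), chr h (s * (-(1 + l))) •
        ((qc γ⁻¹ l * qb γ⁻¹ (m - 1 - e.val) l * chr h (-l)) • X ^ l) := by
    intro s
    rw [pol_expand, smul_sum]
    refine sum_congr rfl fun l _ => ?_
    rw [smul_smul, smul_smul]
    congr 1
    have : chr h (-s) * chr h ((-s - 1) * l) = chr h (s * (-(1 + l))) * chr h (-l) := by
      rw [← AddChar.map_add_eq_mul, ← AddChar.map_add_eq_mul]
      congr 1; ring
    linear_combination (qc γ⁻¹ l * qb γ⁻¹ (m - 1 - e.val) l) * this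
  rw [sum_congr rfl fun s _ => e1 s, sum_comm]
  simp only [← sum_smul, chr_sum]
  have hz : ∀ l : ℕ, l < m → ((-(1 + l : ZMod m)) = 0 ↔ l = m - 1) := by
    intro l hl
    rw [neg_eq_zero, show (1 + l : ZMod m) = ((l + 1 : ℕ) : ZMod m) by push_cast; ring,
      ZMod.natCast_eq_zero_iff]
    constructor
    · intro hd; have := Nat.le_of_dvd (by omega) hd; omega
    · rintro rfl; rw [show m - 1 + 1 = m by omega]
  split_ifs with he
  · subst he
    rw [ZMod.val_zero, Nat.sub_zero, sum_range_succ, sum_eq_zero, zero_add,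
      if_pos ((hz _ (by omega)).2 rfl), qb_self, qc_inv_pred h hm]
    · have : chr h (-((m - 1 : ℕ) : ZMod m)) = γ := by
        rw [Nat.cast_sub (by omega)]; simp [chr_one]
      rw [this, mul_one, inv_mul_cancel₀ (h.ne_zero (by omega)), one_smul]
    · intro l hl
      rw [mem_range] at hl
      rw [if_neg, zero_smul]
      rw [hz _ (by omega)]; omega
  · refine sum_eq_zero fun l hl => ?_
    rw [mem_range] at hl
    have : e.val ≠ 0 := by rwa [Ne, ZMod.val_eq_zero]
    rw [if_neg, zero_smul]
    rw [hz _ (by omega)]; omega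

theorem key_zero {A : Type*} [Ring A] [Algebra k A] (X : A) (e : ZMod m) :
    ∑ s, chr h (-(s * e)) • aeval X (pol h s (m - 1 - e.val)) =
      if e = 0 then algebraMap k A m else 0 := by
  have hp : ∀ i N, aeval (0 : A) (pol h i N) = 1 := by
    intro i N
    rw [← map_zero (algebraMap k A), aeval_algebraMap_apply, pol, map_prod]
    simp
  have := key h X 0 (Commute.zero_right _) 0 e e
  simp only [hp, mul_one, mul_zero, le_refl, if_true, zero_sub, neg_mul, qb_self] at this
  rw [this]
  split_ifs with he
  · subst he; simp [Algebra.smul_def]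
  · rw [zero_pow, smul_zero]
    rwa [Ne, ZMod.val_eq_zero]

theorem pol_inv {A : Type*} [Ring A] [Algebra k A] (X : Aˣ) (i n : ZMod m) :
    aeval (↑X⁻¹ : A) (pol h i (m - 1 - n.val)) =
      (chr h ((i + 1) * (1 + n)) * qc γ⁻¹ (m - 1 - n.val)) •
        ((↑(X⁻¹ ^ (m - 1 - n.val)) : A) * aeval (X : A) (pol h (n - i) (m - 1 - n.val))) := by
  have hnv := n.val_lt
  set N := m - 1 - n.val with hN
  have hNn : (N : ZMod m) = -1 - n := by
    have : ((N + 1 + n.val : ℕ) : ZMod m) = 0 := by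
      rw [show N + 1 + n.val = m by omega]; simp
    push_cast at this
    rw [ZMod.natCast_zmod_val] at this
    linear_combination this
  have hc : chr h ((i + 1) * (1 + n)) * qc γ⁻¹ N = ∏ l ∈ range N, (-chr h (-i - 1 - l)) := by
    have : chr h ((i + 1) * (1 + n)) = chr h (-i - 1) ^ N := by
      rw [chr_nsmul, hNn]; congr 1; ring
    rw [this, qc, ← card_range N, ← prod_const, card_range, ← prod_mul_distrib]
    refine prod_congr rfl fun l _ => ?_
    rw [← chr_neg_nat h, sub_eq_add_neg (-i - 1), AddChar.map_add_eq_mul]; ring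
  rw [hc]
  have hrev : pol h (n - i) N = ∏ l ∈ range N, (1 - C (chr h (i + 1 + l)) * Polynomial.X) := by
    rw [pol, ← prod_range_reflect]
    refine prod_congr rfl fun l hl => ?_
    rw [mem_range] at hl
    rw [Nat.cast_sub (by omega), Nat.cast_sub (by omega), hNn]
    congr 4; push_cast; ring
  rw [hrev, pol]
  clear hrev hc hNn
  clear_value N
  clear hN hnv
  induction N with
  | zero => simp
  | succ N ih =>
    rw [prod_range_succ, prod_range_succ, prod_range_succ, map_mul, ih, map_mul]
    have e1 : aeval (↑X⁻¹ : A) (1 - C (chr h (-i - 1 - N)) * Polynomial.X) =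
        (-chr h (-i - 1 - N)) • ((↑X⁻¹ : A) *
          aeval (X : A) (1 - C (chr h (i + 1 + N)) * Polynomial.X)) := by
      simp only [map_sub, map_one, map_mul, aeval_C, aeval_X, ← Algebra.smul_def, mul_sub, mul_one,
        mul_smul_comm, smul_sub, smul_smul, Units.inv_mul]
      rw [neg_mul, ← AddChar.map_add_eq_mul]
      simp [show -i - 1 - (N : ZMod m) + (i + 1 + N) = 0 by ring]
      abel
    rw [e1, smul_mul_smul_comm]
    congr 1
    have hcomm : Commute (↑X⁻¹ : A) (aeval (X : A) (∏ l ∈ range N, (1 - C (chr h (i + 1 + l)) *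
        Polynomial.X))) := by
      have : Commute (X : A) (aeval (X : A) (∏ l ∈ range N, (1 - C (chr h (i + 1 + l)) *
        Polynomial.X))) := by
        have h0 := Commute.map (Commute.all (Polynomial.X : k[X])
          (∏ l ∈ range N, (1 - C (chr h (i + 1 + l)) * Polynomial.X))) (aeval (X : A))
        rwa [aeval_X] at h0
      exact this.units_inv_left
    rw [pow_succ, Units.val_mul, mul_assoc, ← mul_assoc (aeval _ _), ← hcomm.eq, mul_assoc,
      mul_assoc]

theorem eval_pol_one (i j : ZMod m) :
    aeval (1 : k) (pol h i (m - 1 - (i + j).val)) * 0 ^ (i + j).val =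
      if i = 0 ∧ j = 0 then (m : k) else 0 := by
  have hm : 0 < m := Nat.pos_of_ne_zero (NeZero.ne m)
  by_cases hn : i + j = 0
  · have hj : j = -i := by linear_combination hn
    subst hj
    rw [hn, ZMod.val_zero, pow_zero, mul_one, Nat.sub_zero, pol, map_prod]
    by_cases hi : i = 0
    · subst hi
      simp only [neg_zero, and_self, if_true]
      obtain ⟨n, rfl⟩ : ∃ n, m = n + 1 := ⟨m - 1, by omega⟩
      have := h.inv.prod_one_sub_pow_eq_order
      rw [Nat.add_sub_cancel]
      push_cast
      rw [← this]
      refine prod_congr rfl fun l _ => ?_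
      simp only [map_sub, map_one, map_mul, aeval_C, aeval_X, mul_one]
      rw [← chr_neg_nat h]
      simp only [Algebra.algebraMap_self, RingHom.id_apply]
      congr 2; push_cast; ring
    · rw [if_neg (by tauto)]
      have hl : (-i - 1).val < m - 1 := by
        have := (-i - 1).val_lt
        by_contra hc
        have h2 : (-i - 1).val = m - 1 := by omega
        apply hi
        have h3 : (((-i - 1).val + 1 : ℕ) : ZMod m) = 0 := by
          rw [h2, show m - 1 + 1 = m by omega]; simp
        push_cast at h3
        rw [ZMod.natCast_zmod_val] at h3
        linear_combination -h3
      refine prod_eq_zero (mem_range.2 hl) ?_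
      rw [ZMod.natCast_zmod_val]
      simp
  · rw [zero_pow, mul_zero, if_neg]
    · rintro ⟨rfl, rfl⟩; simp at hn
    · rwa [Ne, ZMod.val_eq_zero]

theorem sum_val {M : Type*} [AddCommMonoid M] (f : ℕ → M) :
    ∑ e : ZMod m, f e.val = ∑ e ∈ range m, f e := by
  refine sum_bij (fun e _ => e.val) (fun e _ => mem_range.2 e.val_lt)
    (fun a _ b _ hab => ZMod.val_injective m hab)
    (fun b hb => ⟨(b : ZMod m), mem_univ _, ZMod.val_cast_of_lt (mem_range.1 hb)⟩)
    (fun _ _ => rfl)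

end root

section psi
variable {k : Type*} [Field k] {m : ℕ} {ξ : k}

theorem sq_prim (h : IsPrimitiveRoot ξ (2 * m)) (hm : 0 < m) : IsPrimitiveRoot (ξ ^ 2) m :=
  h.pow (by omega) rfl

theorem pow_m (h : IsPrimitiveRoot ξ (2 * m)) (hm : 0 < m) : ξ ^ m = -1 := by
  have h1 : IsPrimitiveRoot (ξ ^ m) 2 := h.pow (by omega) (by ring)
  exact h1.eq_neg_one_of_two_right

/-- `(-1)ⁿ ξ^(n²)`. -/
def psiN (ξ : k) (n : ℕ) : k := (-1) ^ n * ξ ^ (n ^ 2)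

theorem psiN_add_m (h : IsPrimitiveRoot ξ (2 * m)) (hm : 0 < m) (n : ℕ) :
    psiN ξ (n + m) = psiN ξ n := by
  have h1 : ξ ^ ((n + m) ^ 2) = ξ ^ (n ^ 2) * (-1) ^ m := by
    rw [show (n + m) ^ 2 = n ^ 2 + (2 * m) * n + m * m by ring, pow_add, pow_add, pow_mul,
      h.pow_eq_one, pow_mul, pow_m h hm]; simp
  rw [psiN, psiN, h1, pow_add]
  have : ((-1 : k) ^ m) * (-1) ^ m = 1 := by rw [← mul_pow]; simp
  linear_combination ((-1) ^ n * ξ ^ n ^ 2) * this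

/-- The quadratic character `j ↦ (-1)ʲ ξ^(j²)` on `ZMod m`. -/
def psi (ξ : k) (j : ZMod m) : k := psiN ξ j.val

theorem psi_nat (h : IsPrimitiveRoot ξ (2 * m)) (hm : 0 < m) (n : ℕ) :
    psi ξ (n : ZMod m) = psiN ξ n := by
  have : ∀ q r, psiN ξ (r + m * q) = psiN ξ r := by
    intro q r
    induction q with
    | zero => simp
    | succ q ih => rw [mul_add, mul_one, ← add_assoc, psiN_add_m h hm, ih]
  rw [psi, ZMod.val_natCast]
  conv_rhs => rw [← Nat.mod_add_div n m, this]

variable [NeZero m]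

theorem psi_add (h : IsPrimitiveRoot ξ (2 * m)) (hγ : IsPrimitiveRoot (ξ ^ 2) m) (i j : ZMod m) :
    psi ξ (i + j) = psi ξ i * psi ξ j * chr hγ (i * j) := by
  have hm : 0 < m := Nat.pos_of_ne_zero (NeZero.ne m)
  obtain ⟨a, rfl⟩ : ∃ a : ℕ, (a : ZMod m) = i := ⟨i.val, ZMod.natCast_zmod_val i⟩
  obtain ⟨b, rfl⟩ : ∃ a : ℕ, (a : ZMod m) = j := ⟨j.val, ZMod.natCast_zmod_val j⟩
  rw [← Nat.cast_add, ← Nat.cast_mul, psi_nat h hm, psi_nat h hm, psi_nat h hm, chr_nat]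
  simp only [psiN]
  ring

theorem psi_zero : psi ξ (0 : ZMod m) = 1 := by simp [psi, psiN]

theorem psi_one (h : IsPrimitiveRoot ξ (2 * m)) : psi ξ (1 : ZMod m) = -ξ := by
  have := psi_nat h (Nat.pos_of_ne_zero (NeZero.ne m)) 1
  simpa [psiN] using this

theorem psi_ne (h : IsPrimitiveRoot ξ (2 * m)) (j : ZMod m) : psi ξ j ≠ 0 := by
  have hm : 0 < m := Nat.pos_of_ne_zero (NeZero.ne m)
  have : ξ ≠ 0 := h.ne_zero (by omega)
  simp [psi, psiN, this]

theorem psi_sq (hγ : IsPrimitiveRoot (ξ ^ 2) m) (j : ZMod m) :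
    psi ξ j * psi ξ j = chr hγ (j * j) := by
  obtain ⟨a, ha⟩ : ∃ a : ℕ, a = j.val := ⟨_, rfl⟩
  have : chr hγ (j * j) = (ξ ^ 2) ^ (a * a) := by
    rw [← chr_nat hγ]; congr 1; push_cast; rw [ha, ZMod.natCast_zmod_val]
  rw [this, psi, ← ha, psiN]
  have : ((-1 : k) ^ a) * (-1) ^ a = 1 := by rw [← mul_pow]; simp
  linear_combination (ξ ^ (a ^ 2) * ξ ^ (a ^ 2)) * this

theorem psi_neg (h : IsPrimitiveRoot ξ (2 * m)) (hγ : IsPrimitiveRoot (ξ ^ 2) m) (j : ZMod m) :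
    psi ξ (-j) = psi ξ j := by
  have h1 := psi_add h hγ j (-j)
  rw [add_neg_cancel, psi_zero] at h1
  have h2 := psi_sq hγ j
  have h3 : chr hγ (j * j) * chr hγ (j * -j) = 1 := by
    rw [← AddChar.map_add_eq_mul]; simp
  linear_combination -psi ξ j * h1 - psi ξ (-j) * (h3 + chr hγ (j * -j) * h2)

end psi
end QComb
end

/-! The parameters of `D(m, d, ξ)`, and the computations that are needed to check that the structure
maps of `D(m, d, ξ)` respect the defining relations. The definition of `D(m, d, ξ)` itself is `DAlg`, below. -/

noncomputable section

/-- The parameters `(m, d, ξ)` of `D(m, d, ξ)`: positive integers `m`, `d` such that `(1 + m) d` is even,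
and a primitive `2m`-th root of unity `ξ`. -/
structure DDatum (k : Type*) [Field k] where
  m : ℕ
  d : ℕ
  ξ : k
  m_pos : 0 < m
  d_pos : 0 < d
  even : Even ((1 + m) * d)
  prim : IsPrimitiveRoot ξ (2 * m)

namespace DDatum

open Finset Polynomial QComb

variable {k : Type*} [Field k] (p : DDatum k)

/-- `γ = ξ²` -/
def γ : k := p.ξ ^ 2

instance : NeZero p.m := ⟨p.m_pos.ne'⟩

theorem hγ : IsPrimitiveRoot p.γ p.m := sq_prim p.prim p.m_pos

/-- `(1+m)d/2`. -/
def c : ℕ := (1 + p.m) * p.d / 2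

theorem two_c : 2 * p.c = (1 + p.m) * p.d := Nat.mul_div_cancel' p.even.two_dvd

abbrev χ : AddChar (ZMod p.m) k := chr p.hγ

abbrev ψ : ZMod p.m → k := psi p.ξ

theorem m_ne : (p.m : k) ≠ 0 := by
  have : NeZero ((p.m : ℕ) : k) := p.hγ.neZero'
  exact NeZero.ne _

variable {A : Type*} [Ring A] [Algebra k A]

/-- Elements `x, g, y, u_i` of an algebra which satisfy the relations of `D(m, d, ξ)`, written in a
form suited to computation. (Only used in proofs; the definition of `D(m, d, ξ)` is `DAlg`, with the
relations `DDatum.Rel`.) -/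
structure Nice (x g : Aˣ) (y : A) (u : ZMod p.m → A) : Prop where
  xg : Commute x g
  xy : (x : A) * y = y * x
  yg : y * g = p.γ • ((g : A) * y)
  ypow : y ^ p.m = 1 - (↑(x ^ (p.m * p.d)) : A)
  gpow : g ^ p.m = x ^ (p.m * p.d)
  xu : ∀ i, (x : A) * u i = u i * (↑x⁻¹ : A)
  yu : ∀ i, y * u i = (1 - p.χ (-i - 1) • (↑(x ^ p.d) : A)) * u (i + 1)
  uy : ∀ i, y * u i = p.ξ • ((↑(x ^ p.d) : A) * u i * y)
  ug : ∀ i, u i * g = p.χ i • ((↑(x ^ (-(2 * p.d) : ℤ)) : A) * g * u i)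
  uu : ∀ i j, u i * u j = (p.ψ j / p.m) • ((↑(x ^ (-p.c : ℤ)) : A) *
    aeval (↑(x ^ p.d) : A) (pol p.hγ i (p.m - 1 - (i + j).val)) * y ^ (i + j).val * g)

theorem commute_aeval {a b : A} (h : Commute a b) (P : k[X]) : Commute (aeval a P) b := by
  induction P using Polynomial.induction_on with
  | C r => rw [aeval_C]; exact Algebra.commutes r b
  | add P Q h1 h2 => rw [map_add]; exact h1.add_left h2
  | monomial n r _ =>
    rw [map_mul, map_pow, aeval_C, aeval_X]
    exact Commute.mul_left (Algebra.commutes r b) (h.pow_left _)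

theorem mul_unit_pow {a : A} {b : Aˣ} {r : k} (e : a * b = r • ((b : A) * a)) (n : ℕ) :
    a * (↑(b ^ n) : A) = r ^ n • ((↑(b ^ n) : A) * a) := by
  induction n with
  | zero => simp
  | succ n ih =>
    rw [pow_succ b, Units.val_mul, ← mul_assoc, ih, smul_mul_assoc, mul_assoc, e, mul_smul_comm,
      smul_smul, mul_assoc, pow_succ]

namespace Nice

variable {p} {x g : Aˣ} {y : A} {u : ZMod p.m → A}

/-- `h = x^{-d} g`. -/
def h (_ : Nice p x g y u) : Aˣ := (x ^ p.d)⁻¹ * g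

/-- `h^j` for `j` an integer modulo `m`. -/
def H (N : Nice p x g y u) (j : ZMod p.m) : Aˣ := N.h ^ j.val


theorem h_pow (N : Nice p x g y u) : N.h ^ p.m = 1 := by
  have : Commute (x ^ p.d)⁻¹ g := (N.xg.pow_left _).inv_left
  rw [h, this.mul_pow, N.gpow, inv_pow, ← pow_mul, mul_comm p.d, inv_mul_cancel]

theorem H_nat (N : Nice p x g y u) (n : ℕ) : N.H (n : ZMod p.m) = N.h ^ n := by
  rw [H, ZMod.val_natCast]
  conv_rhs => rw [← Nat.mod_add_div n p.m, pow_add, pow_mul, N.h_pow, one_pow, mul_one]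

theorem H_add (N : Nice p x g y u) (a b : ZMod p.m) : N.H (a + b) = N.H a * N.H b := by
  have : a + b = ((a.val + b.val : ℕ) : ZMod p.m) := by push_cast; simp
  rw [this, H_nat, pow_add, H, H]

theorem H_zero (N : Nice p x g y u) : N.H 0 = 1 := by simp [H]

theorem H_one (N : Nice p x g y u) : N.H 1 = N.h := by simpa using N.H_nat 1

theorem H_neg (N : Nice p x g y u) (a : ZMod p.m) : N.H (-a) = (N.H a)⁻¹ := by
  rw [eq_inv_iff_mul_eq_one, ← H_add]; simp [H_zero]

theorem xh (N : Nice p x g y u) : Commute x N.h := ((Commute.self_pow x p.d).inv_right).mul_right N.xg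

theorem g_eq (N : Nice p x g y u) : g = x ^ p.d * N.h := by rw [h, mul_inv_cancel_left]

theorem xH (N : Nice p x g y u) (n : ℤ) (a : ZMod p.m) : Commute (x ^ n) (N.H a) := (N.xh.zpow_left n).pow_right _

theorem g_pow_val (N : Nice p x g y u) (a : ZMod p.m) : g ^ a.val = (x ^ p.d) ^ a.val * N.H a := by
  conv_lhs => rw [N.g_eq, (N.xh.pow_left p.d).mul_pow]
  rfl

theorem xH' (N : Nice p x g y u) (n : ℤ) (a : ZMod p.m) : Commute (↑(x ^ n) : A) (N.H a) := by
  have := N.xH n a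
  exact congrArg Units.val this

theorem gH (N : Nice p x g y u) (j : ZMod p.m) : Commute (g : A) (N.H j) := by
  have : Commute g N.h := (N.xg.symm.pow_right p.d).inv_right.mul_right (Commute.refl g)
  exact congrArg Units.val (this.pow_right j.val)

theorem XH (N : Nice p x g y u) (j : ZMod p.m) : Commute (↑(x ^ p.d) : A) (N.H j) := by
  have := N.xH' p.d j; rwa [zpow_natCast] at this

theorem g_mul_H (N : Nice p x g y u) (j : ZMod p.m) : (g : A) * N.H j = (↑(x ^ p.d) : A) * N.H (j + 1) := by
  rw [← Units.val_mul, ← Units.val_mul, N.H_add, N.H_one, (N.gH j |> fun e => Units.ext e.eq : g * N.H j = N.H j * g)]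
  have e : N.H j * x ^ p.d = x ^ p.d * N.H j := Units.ext (N.XH j).eq.symm
  rw [← mul_assoc, ← e, mul_assoc, ← N.g_eq]

theorem xgz (N : Nice p x g y u) (n : ℤ) : Commute (↑(x ^ n) : A) g := congrArg Units.val (N.xg.zpow_left n)

theorem xyz (N : Nice p x g y u) (n : ℤ) : Commute (↑(x ^ n) : A) y := by
  have h1 : Commute (x : A) y := N.xy
  induction n with
  | zero => simp
  | succ n ih => rw [zpow_add_one, Units.val_mul]; exact ih.mul_left h1
  | pred n ih => rw [zpow_sub_one, Units.val_mul]; exact ih.mul_left h1.units_inv_left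

theorem ux (N : Nice p x g y u) (i : ZMod p.m) (n : ℤ) : u i * (↑(x ^ n) : A) = (↑(x ^ (-n)) : A) * u i := by
  have h1 := N.xu i
  have h2 : u i * (x : A) = (↑x⁻¹ : A) * u i := by
    rw [Units.eq_inv_mul_iff_mul_eq, ← mul_assoc, h1, mul_assoc, Units.inv_mul, mul_one]
  induction n with
  | zero => simp
  | succ n ih =>
    rw [zpow_add_one, Units.val_mul, ← mul_assoc, ih, mul_assoc, h2, ← mul_assoc, neg_add,
      ← sub_eq_add_neg, zpow_sub_one, Units.val_mul]
  | pred n ih =>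
    rw [zpow_sub_one, Units.val_mul, ← mul_assoc, ih, mul_assoc, ← h1, ← mul_assoc,
      show -(-(n : ℤ) - 1) = - -(n : ℤ) + 1 by ring, zpow_add_one, Units.val_mul]

theorem yh (N : Nice p x g y u) : y * N.h = p.γ • ((N.h : A) * y) := by
  have e := N.xyz (-(p.d : ℤ))
  rw [h, Units.val_mul, ← zpow_natCast, ← zpow_neg, ← mul_assoc, ← e.eq, mul_assoc, N.yg,
    mul_smul_comm, mul_assoc]

theorem uh (N : Nice p x g y u) (i : ZMod p.m) : u i * N.h = p.χ i • ((N.h : A) * u i) := by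
  rw [h, Units.val_mul, ← zpow_natCast, ← zpow_neg, ← mul_assoc, N.ux, mul_assoc, N.ug,
    mul_smul_comm, ← mul_assoc, ← mul_assoc, ← Units.val_mul, ← zpow_add]
  congr 5; ring

theorem yH (N : Nice p x g y u) (t : ZMod p.m) : y * N.H t = p.χ t • ((N.H t : A) * y) := by
  rw [H, mul_unit_pow N.yh, chr_pow_val p.hγ]

theorem uH (N : Nice p x g y u) (i t : ZMod p.m) : u i * N.H t = p.χ (i * t) • ((N.H t : A) * u i) := by
  rw [H, mul_unit_pow (N.uh i), chr_nsmul, ZMod.natCast_zmod_val]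

end Nice

/-- `a ⊗ b` as a unit. -/
def tu : Aˣ × Aˣ →* (A ⊗[k] A)ˣ where
  toFun ab := ⟨(ab.1 : A) ⊗ₜ (ab.2 : A), (↑ab.1⁻¹ : A) ⊗ₜ (↑ab.2⁻¹ : A), by
    simp [Algebra.TensorProduct.tmul_mul_tmul, Algebra.TensorProduct.one_def], by
    simp [Algebra.TensorProduct.tmul_mul_tmul, Algebra.TensorProduct.one_def]⟩
  map_one' := by ext; simp [Algebra.TensorProduct.one_def]
  map_mul' a b := by ext; simp [Algebra.TensorProduct.tmul_mul_tmul]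

theorem tu_val (a b : Aˣ) : ((tu (k := k) (a, b) : (A ⊗[k] A)ˣ) : A ⊗[k] A) = (a : A) ⊗ₜ (b : A) := rfl

theorem tu_inv (a b : Aˣ) : (tu (k := k) (a, b))⁻¹ = tu (a⁻¹, b⁻¹) := rfl

theorem tu_zpow (a b : Aˣ) (n : ℤ) : tu (k := k) (a, b) ^ n = tu (a ^ n, b ^ n) := by
  rw [← map_zpow]; rfl

theorem tu_pow (a b : Aˣ) (n : ℕ) : tu (k := k) (a, b) ^ n = tu (a ^ n, b ^ n) := by
  rw [← map_pow]; rfl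

namespace Nice
variable {p} {x g : Aˣ} {y : A} {u : ZMod p.m → A}

open Algebra.TensorProduct (tmul_mul_tmul)

/-- `Δ(u_i)`. -/
def Δu (N : Nice p x g y u) (i : ZMod p.m) : A ⊗[k] A := ∑ j, p.χ (j * (i - j)) • (u j ⊗ₜ[k] ((N.H j : A) * u (i - j)))

theorem tensor_xu (N : Nice p x g y u) (i : ZMod p.m) : (tu (k := k) (x, x) : A ⊗[k] A) * N.Δu i =
    N.Δu i * (↑(tu (k := k) (x, x))⁻¹ : A ⊗[k] A) := by
  rw [tu_inv, tu_val, tu_val, Δu, mul_sum, sum_mul]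
  refine sum_congr rfl fun j _ => ?_
  have e := N.xH' 1 j
  rw [zpow_one] at e
  rw [mul_smul_comm, smul_mul_assoc, tmul_mul_tmul, tmul_mul_tmul, N.xu, ← mul_assoc, e.eq,
    mul_assoc, N.xu, mul_assoc]

theorem tensor_ug (N : Nice p x g y u) (i : ZMod p.m) : N.Δu i * (tu (k := k) (g, g) : A ⊗[k] A) =
    p.χ i • ((↑(tu (k := k) (x, x) ^ (-(2 * p.d) : ℤ)) : A ⊗[k] A) * (tu (k := k) (g, g) : A ⊗[k] A)
      * N.Δu i) := by
  rw [tu_zpow, tu_val, tu_val, Δu, mul_sum, sum_mul, smul_sum]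
  refine sum_congr rfl fun j _ => ?_
  have e := N.xH' (-(2 * p.d)) j
  have e2 := N.gH j
  rw [mul_smul_comm, smul_mul_assoc, tmul_mul_tmul, tmul_mul_tmul, tmul_mul_tmul, N.ug, mul_assoc (N.H j : A),
    N.ug, mul_smul_comm, TensorProduct.smul_tmul_smul, smul_smul, smul_smul,
    ← AddChar.map_add_eq_mul, ← mul_assoc (N.H j : A), ← mul_assoc (N.H j : A), ← e.eq,
    mul_assoc _ (N.H j : A), ← e2.eq, ← mul_assoc, ← mul_assoc, mul_comm (p.χ i)]
  congr 3; ring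

theorem tensor_yu (N : Nice p x g y u) (i : ZMod p.m) : (y ⊗ₜ[k] (g : A) + 1 ⊗ₜ y) * N.Δu i =
    (1 - p.χ (-i - 1) • (↑(tu (k := k) (x, x) ^ p.d) : A ⊗[k] A)) * N.Δu (i + 1) := by
  rw [tu_pow, tu_val]
  set X : A := ↑(x ^ p.d) with hX
  have hXH := N.XH
  have e1 : (y ⊗ₜ[k] (g : A)) * N.Δu i = ∑ j, p.χ ((j - 1) * (i + 1 - j)) •
      (u j ⊗ₜ[k] (X * N.H j * u (i + 1 - j)) -
        p.χ (-j) • ((X * u j) ⊗ₜ[k] (X * N.H j * u (i + 1 - j)))) := by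
    rw [Δu, mul_sum]
    conv_rhs => rw [← Equiv.sum_comp (Equiv.addRight (1 : ZMod p.m))]
    refine sum_congr rfl fun j _ => ?_
    simp only [Equiv.coe_addRight, add_sub_cancel_right, add_sub_add_right_eq_sub]
    rw [mul_smul_comm, tmul_mul_tmul, N.yu]
    congr 1
    have : (g : A) * ((N.H j : A) * u (i - j)) = X * N.H (j + 1) * u (i - j) := by
      rw [← mul_assoc, N.g_mul_H]
    rw [this, sub_mul, one_mul, smul_mul_assoc, TensorProduct.sub_tmul, TensorProduct.smul_tmul']
    congr 4; ring
  have e2 : (1 ⊗ₜ[k] y) * N.Δu i = ∑ j, p.χ (j * (i + 1 - j)) •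
      (u j ⊗ₜ[k] (N.H j * u (i + 1 - j)) -
        p.χ (j - i - 1) • (u j ⊗ₜ[k] (X * N.H j * u (i + 1 - j)))) := by
    rw [Δu, mul_sum]
    refine sum_congr rfl fun j _ => ?_
    rw [mul_smul_comm, tmul_mul_tmul, one_mul, ← mul_assoc, N.yH, smul_mul_assoc, mul_assoc, N.yu,
      TensorProduct.tmul_smul, smul_smul, ← AddChar.map_add_eq_mul,
      show j * (i - j) + j = j * (i + 1 - j) by ring]
    rw [sub_mul, one_mul, mul_sub (N.H j : A), TensorProduct.tmul_sub, smul_mul_assoc, mul_smul_comm,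
      TensorProduct.tmul_smul, ← hX, ← mul_assoc, ← (hXH j).eq,
      show i - j + 1 = i + 1 - j by ring,
      show -(i - j) - 1 = j - i - 1 by ring]
  have e3 : (1 - p.χ (-i - 1) • (X ⊗ₜ[k] X)) * N.Δu (i + 1) = ∑ j, p.χ (j * (i + 1 - j)) •
      (u j ⊗ₜ[k] (N.H j * u (i + 1 - j)) -
        p.χ (-i - 1) • ((X * u j) ⊗ₜ[k] (X * N.H j * u (i + 1 - j)))) := by
    rw [Δu, mul_sum]
    refine sum_congr rfl fun j _ => ?_
    rw [mul_smul_comm, sub_mul, one_mul, smul_mul_assoc, tmul_mul_tmul, mul_assoc X]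
  rw [add_mul, e1, e2, e3, ← sum_add_distrib]
  refine sum_congr rfl fun j _ => ?_
  simp only [smul_sub, smul_smul, ← AddChar.map_add_eq_mul]
  rw [show (j - 1) * (i + 1 - j) + -j = j * (i + 1 - j) + (-i - 1) by ring,
    show (j - 1) * (i + 1 - j) = j * (i + 1 - j) + (j - i - 1) by ring]
  abel

theorem tensor_uy (N : Nice p x g y u) (i : ZMod p.m) : (y ⊗ₜ[k] (g : A) + 1 ⊗ₜ y) * N.Δu i =
    p.ξ • ((↑(tu (k := k) (x, x) ^ p.d) : A ⊗[k] A) * N.Δu i * (y ⊗ₜ[k] (g : A) + 1 ⊗ₜ y)) := by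
  rw [N.tensor_yu, mul_add, smul_add, tu_pow, tu_val]
  set X : A := ↑(x ^ p.d) with hX
  have e3 : (1 - p.χ (-i - 1) • (X ⊗ₜ[k] X)) * N.Δu (i + 1) = ∑ j, p.χ (j * (i + 1 - j)) •
      (u j ⊗ₜ[k] (N.H j * u (i + 1 - j)) -
        p.χ (-i - 1) • ((X * u j) ⊗ₜ[k] (X * N.H j * u (i + 1 - j)))) := by
    rw [Δu, mul_sum]
    refine sum_congr rfl fun j _ => ?_
    rw [mul_smul_comm, sub_mul, one_mul, smul_mul_assoc, tmul_mul_tmul, mul_assoc X]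
  have e1 : p.ξ • ((X ⊗ₜ[k] X) * N.Δu i * (y ⊗ₜ[k] (g : A))) = ∑ j, p.χ (j * (i + 1 - j)) •
      (u j ⊗ₜ[k] (N.H j * u (i + 1 - j)) -
        p.χ (-j) • ((X * u j) ⊗ₜ[k] (N.H j * u (i + 1 - j)))) := by
    rw [Δu, mul_sum, sum_mul, smul_sum]
    conv_rhs => rw [← Equiv.sum_comp (Equiv.addRight (1 : ZMod p.m))]
    refine sum_congr rfl fun j _ => ?_
    simp only [Equiv.coe_addRight]
    have t1 : X * (N.H j * u (i - j)) * g = p.χ (i - j) • (N.H (j + 1) * u (i - j)) := by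
      have t2 : X * (↑(x ^ (-(2 * p.d) : ℤ)) * X) = (1 : A) := by
        rw [hX, ← zpow_natCast, ← Units.val_mul, ← Units.val_mul, ← zpow_add, ← zpow_add]
        rw [show (p.d : ℤ) + (-(2 * p.d) + p.d) = 0 by ring]; simp
      rw [mul_assoc, mul_assoc, N.ug, mul_smul_comm, mul_smul_comm, ← mul_assoc (N.H j : A),
        ← mul_assoc (N.H j : A), ← (N.xH' _ j).eq, mul_assoc _ (N.H j : A), ← (N.gH j).eq,
        N.g_mul_H, ← hX]
      congr 1
      rw [← mul_assoc (↑(x ^ (-(2 * p.d) : ℤ)) : A), ← mul_assoc X, ← mul_assoc X, t2, one_mul]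
    rw [mul_smul_comm, smul_mul_assoc, tmul_mul_tmul, tmul_mul_tmul, t1, smul_comm,
      TensorProduct.smul_tmul', ← N.uy, N.yu, TensorProduct.tmul_smul, smul_smul,
      ← AddChar.map_add_eq_mul, ← hX, sub_mul, one_mul, smul_mul_assoc, TensorProduct.sub_tmul,
      TensorProduct.smul_tmul', add_sub_add_right_eq_sub]
    congr 2
    · ring_nf
    · congr 2; ring
  have e2 : p.ξ • ((X ⊗ₜ[k] X) * N.Δu i * (1 ⊗ₜ[k] y)) = ∑ j, p.χ (j * (i - j)) •
      ((X * u j) ⊗ₜ[k] (N.H j * u (i + 1 - j)) -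
        p.χ (j - i - 1) • ((X * u j) ⊗ₜ[k] (X * N.H j * u (i + 1 - j)))) := by
    rw [Δu, mul_sum, sum_mul, smul_sum]
    refine sum_congr rfl fun j _ => ?_
    rw [mul_smul_comm, smul_mul_assoc, tmul_mul_tmul, tmul_mul_tmul, mul_one, smul_comm,
      ← TensorProduct.tmul_smul, ← mul_assoc X, (N.XH j).eq, mul_assoc (N.H j : A),
      mul_assoc (N.H j : A), ← mul_smul_comm, ← N.uy, N.yu, ← hX, sub_mul, one_mul, mul_sub (N.H j : A),
      TensorProduct.tmul_sub, smul_mul_assoc, mul_smul_comm, TensorProduct.tmul_smul,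
      ← mul_assoc (N.H j : A),
      show i - j + 1 = i + 1 - j by ring, show -(i - j) - 1 = j - i - 1 by ring]
  rw [e1, e2, e3, ← sum_add_distrib]
  refine sum_congr rfl fun j _ => ?_
  simp only [smul_sub, smul_smul, ← AddChar.map_add_eq_mul]
  rw [show j * (i + 1 - j) + -j = j * (i - j) by ring,
    show j * (i + 1 - j) + (-i - 1) = j * (i - j) + (j - i - 1) by ring, (N.XH j).eq]
  abel

theorem tensor_ypow (N : Nice p x g y u) : (y ⊗ₜ[k] (g : A) + 1 ⊗ₜ y) ^ p.m =
    1 - (↑(tu (k := k) (x, x) ^ (p.m * p.d)) : A ⊗[k] A) := by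
  rw [add_pow_root p.hγ p.m_pos, Algebra.TensorProduct.tmul_pow, Algebra.TensorProduct.tmul_pow,
    N.ypow, one_pow, tu_pow, tu_val, ← Units.val_pow_eq_pow_val, N.gpow,
    TensorProduct.sub_tmul, TensorProduct.tmul_sub, Algebra.TensorProduct.one_def]
  · abel
  · rw [tmul_mul_tmul, tmul_mul_tmul, N.yg, one_mul, mul_one, TensorProduct.tmul_smul]

end Nice
end DDatum
end

noncomputable section
namespace DDatum
open Finset Polynomial QComb
variable {k : Type*} [Field k] (p : DDatum k)
variable {A : Type*} [Ring A] [Algebra k A]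

theorem ψ_add (i j : ZMod p.m) : p.ψ (i + j) = p.ψ i * p.ψ j * p.χ (i * j) :=
  psi_add p.prim p.hγ i j

theorem ψ_neg (j : ZMod p.m) : p.ψ (-j) = p.ψ j := psi_neg p.prim p.hγ j

theorem ψ_sq (j : ZMod p.m) : p.ψ j * p.ψ j = p.χ (j * j) := psi_sq p.hγ j

theorem ψ_ne (j : ZMod p.m) : p.ψ j ≠ 0 := psi_ne p.prim j

namespace Nice
variable {p} {x g : Aˣ} {y : A} {u : ZMod p.m → A}

open Algebra.TensorProduct (tmul_mul_tmul)

/-- `φ_i φ_{i+1} ⋯` with `m - 1 - n` factors. -/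
def P (_ : Nice p x g y u) (i n : ZMod p.m) : A :=
  aeval (↑(x ^ p.d) : A) (pol p.hγ i (p.m - 1 - n.val))

theorem uu' (N : Nice p x g y u) (i j : ZMod p.m) : u i * u j = (p.ψ j / p.m) • ((↑(x ^ (-p.c : ℤ)) : A) *
    N.P i (i + j) * y ^ (i + j).val * g) := N.uu i j

theorem P_H (N : Nice p x g y u) (i n j : ZMod p.m) : Commute (N.P i n) (N.H j : A) := commute_aeval (N.XH j) _

theorem P_x (N : Nice p x g y u) (i n : ZMod p.m) (a : ℤ) : Commute (N.P i n) (↑(x ^ a) : A) :=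
  commute_aeval (by
    have : Commute (x ^ p.d) (x ^ a) := (Commute.refl x).pow_left _ |>.zpow_right _
    exact congrArg Units.val this) _

theorem P_y (N : Nice p x g y u) (i n : ZMod p.m) : Commute (N.P i n) y :=
  commute_aeval (by have := N.xyz p.d; rwa [zpow_natCast] at this) _

theorem P_g (N : Nice p x g y u) (i n : ZMod p.m) : Commute (N.P i n) (g : A) :=
  commute_aeval (by have := N.xgz p.d; rwa [zpow_natCast] at this) _

theorem tensor_uu (N : Nice p x g y u) (i j : ZMod p.m) : N.Δu i * N.Δu j =
    (p.ψ j / p.m) • ((↑(tu (k := k) (x, x) ^ (-p.c : ℤ)) : A ⊗[k] A) *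
    aeval (↑(tu (k := k) (x, x) ^ p.d) : A ⊗[k] A) (pol p.hγ i (p.m - 1 - (i + j).val)) *
      (y ⊗ₜ[k] (g : A) + 1 ⊗ₜ y) ^ (i + j).val * (tu (k := k) (g, g) : A ⊗[k] A)) := by
  rw [tu_zpow, tu_pow, tu_val, tu_val, tu_val]
  set X : A := ↑(x ^ p.d) with hX
  set w : A := ↑(x ^ (-p.c : ℤ)) with hw
  set n := i + j with hn
  -- the product of two summands
  have e1 : ∀ s e, (p.χ (s * (i - s)) • (u s ⊗ₜ[k] ((N.H s : A) * u (i - s)))) *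
      (p.χ ((e - s) * (j - (e - s))) •
        (u (e - s) ⊗ₜ[k] ((N.H (e - s) : A) * u (j - (e - s))))) =
      (p.ψ j / p.m / p.m * p.χ ((i - s) * e)) • ((w ⊗ₜ[k] w) *
        ((N.P s e ⊗ₜ[k] N.P (i - s) (n - e)) *
          ((y ^ e.val * g) ⊗ₜ[k] (N.H e * (y ^ (n - e).val * g))))) := by
    intro s e
    have a1 : u s * u (e - s) = (p.ψ (e - s) / p.m) • (w * (N.P s e * (y ^ e.val * g))) := by
      rw [N.uu', add_sub_cancel, mul_assoc, mul_assoc]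
    have a2 : u (i - s) * u (j - (e - s)) = (p.ψ (j - (e - s)) / p.m) •
        (w * (N.P (i - s) (n - e) * (y ^ (n - e).val * g))) := by
      rw [N.uu', show i - s + (j - (e - s)) = n - e by rw [hn]; ring, mul_assoc, mul_assoc]
    have a3 : (N.H s : A) * u (i - s) * ((N.H (e - s) : A) * u (j - (e - s))) =
        (p.χ ((i - s) * (e - s)) * (p.ψ (j - (e - s)) / p.m)) •
          (w * (N.P (i - s) (n - e) * (N.H e * (y ^ (n - e).val * g)))) := by
      rw [mul_assoc, ← mul_assoc (u (i - s)), N.uH, smul_mul_assoc, mul_assoc, a2, mul_smul_comm,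
        mul_smul_comm, mul_smul_comm, smul_smul, ← mul_assoc (N.H s : A), ← Units.val_mul,
        ← N.H_add, add_sub_cancel, ← mul_assoc (N.H e : A), ← (N.xH' _ e).eq, mul_assoc w,
        ← mul_assoc (N.H e : A), ← (N.P_H _ _ e).eq, mul_assoc (N.P _ _)]
    rw [smul_mul_smul_comm, tmul_mul_tmul, a1, a3, TensorProduct.smul_tmul_smul, smul_smul,
      tmul_mul_tmul, tmul_mul_tmul]
    congr 1
    have b1 : p.ψ j = p.ψ (e - s) * p.ψ (j - (e - s)) * p.χ ((e - s) * (j - (e - s))) := by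
      rw [← p.ψ_add, add_sub_cancel]
    rw [b1]
    have b2 : p.χ (s * (i - s)) * p.χ ((i - s) * (e - s)) = p.χ ((i - s) * e) := by
      rw [← AddChar.map_add_eq_mul]; congr 1; ring
    rw [← b2]
    have := p.m_ne
    field_simp
  have e2 : N.Δu i * N.Δu j = ∑ e, ∑ s, (p.ψ j / p.m / p.m * p.χ ((i - s) * e)) •
      ((w ⊗ₜ[k] w) * ((N.P s e ⊗ₜ[k] N.P (i - s) (n - e)) *
          ((y ^ e.val * g) ⊗ₜ[k] (N.H e * (y ^ (n - e).val * g))))) := by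
    rw [Δu, Δu, sum_mul_sum]
    conv_rhs => rw [sum_comm]
    refine sum_congr rfl fun s _ => ?_
    rw [← Equiv.sum_comp (Equiv.subRight s)]
    refine sum_congr rfl fun e _ => ?_
    exact e1 s e
  have hXX : Commute (X ⊗ₜ[k] (1 : A)) ((1 : A) ⊗ₜ[k] X) := by
    rw [commute_iff_eq, tmul_mul_tmul, tmul_mul_tmul, mul_one, one_mul]
  have hP : ∀ i n i' n', N.P i n ⊗ₜ[k] N.P i' n' =
      aeval (X ⊗ₜ[k] (1 : A)) (pol p.hγ i (p.m - 1 - n.val)) *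
        aeval ((1 : A) ⊗ₜ[k] X) (pol p.hγ i' (p.m - 1 - n'.val)) := by
    intro i n i' n'
    have c1 : aeval (X ⊗ₜ[k] (1 : A)) (pol p.hγ i (p.m - 1 - n.val)) = N.P i n ⊗ₜ[k] (1 : A) :=
      aeval_algHom_apply (Algebra.TensorProduct.includeLeft : A →ₐ[k] A ⊗[k] A) X _
    have c2 : aeval ((1 : A) ⊗ₜ[k] X) (pol p.hγ i' (p.m - 1 - n'.val)) = (1 : A) ⊗ₜ[k] N.P i' n' :=
      aeval_algHom_apply (Algebra.TensorProduct.includeRight : A →ₐ[k] A ⊗[k] A) X _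
    rw [c1, c2, tmul_mul_tmul, mul_one, one_mul]
  set Q := aeval (X ⊗ₜ[k] X) (pol p.hγ i (p.m - 1 - n.val)) with hQ
  have e3 : ∀ e, ∑ s, (p.ψ j / p.m / p.m * p.χ ((i - s) * e)) •
      ((w ⊗ₜ[k] w) * ((N.P s e ⊗ₜ[k] N.P (i - s) (n - e)) *
          ((y ^ e.val * g) ⊗ₜ[k] (N.H e * (y ^ (n - e).val * g))))) =
      if e.val ≤ n.val then (p.ψ j / p.m) • ((w ⊗ₜ[k] w) * (Q * (qb p.γ n.val e.val •
          ((y ⊗ₜ[k] (g : A)) ^ e.val * (1 ⊗ₜ[k] y) ^ (n.val - e.val)) * (g : A) ⊗ₜ[k] (g : A))))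
        else 0 := by
    intro e
    have d1 := key p.hγ (X ⊗ₜ[k] (1 : A)) ((1 : A) ⊗ₜ[k] X) hXX i n e
    simp only [← hP, tmul_mul_tmul, mul_one, one_mul] at d1
    have d2 : ∑ s, (p.ψ j / p.m / p.m * p.χ ((i - s) * e)) •
      ((w ⊗ₜ[k] w) * ((N.P s e ⊗ₜ[k] N.P (i - s) (n - e)) *
          ((y ^ e.val * g) ⊗ₜ[k] (N.H e * (y ^ (n - e).val * g))))) =
        (p.ψ j / p.m / p.m) • ((w ⊗ₜ[k] w) * ((∑ s, p.χ ((i - s) * e) •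
          (N.P s e ⊗ₜ[k] N.P (i - s) (n - e))) *
          ((y ^ e.val * g) ⊗ₜ[k] (N.H e * (y ^ (n - e).val * g))))) := by
      rw [sum_mul, mul_sum, smul_sum]
      refine sum_congr rfl fun s _ => ?_
      rw [smul_mul_assoc, mul_smul_comm, smul_smul]
    rw [d2, d1]
    split_ifs with hle
    · have hsub : (n - e).val = n.val - e.val := ZMod.val_sub hle
      rw [← hQ, hsub, smul_mul_assoc, mul_smul_comm, smul_smul, smul_mul_assoc, mul_smul_comm,
        mul_smul_comm, smul_smul]
      have hc : Commute ((1 : A) ⊗ₜ[k] X) Q :=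
        (commute_aeval (by rw [commute_iff_eq, tmul_mul_tmul, tmul_mul_tmul, mul_one, one_mul]) _ :
          Commute Q ((1 : A) ⊗ₜ[k] X)).symm
      have f1 : ((1 : A) ⊗ₜ[k] X) ^ e.val * Q *
          ((y ^ e.val * g) ⊗ₜ[k] (N.H e * (y ^ (n.val - e.val) * g))) =
          Q * ((y ⊗ₜ[k] (g : A)) ^ e.val * (1 ⊗ₜ[k] y) ^ (n.val - e.val) *
            (g : A) ⊗ₜ[k] (g : A)) := by
        rw [(hc.pow_left _).eq, mul_assoc]
        congr 1
        rw [Algebra.TensorProduct.tmul_pow, Algebra.TensorProduct.tmul_pow,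
          Algebra.TensorProduct.tmul_pow, tmul_mul_tmul, tmul_mul_tmul, tmul_mul_tmul, one_pow,
          one_pow, one_mul, mul_one, ← Units.val_pow_eq_pow_val g, N.g_pow_val, Units.val_mul,
          Units.val_pow_eq_pow_val, ← hX, mul_assoc, mul_assoc]
      rw [f1]
      congr 1
      have := p.m_ne
      have hγ' : (p.ψ j / p.m / p.m * (p.m * qb p.γ n.val e.val) : k) =
        p.ψ j / p.m * qb p.γ n.val e.val := by field_simp
      exact hγ'
    · simp
  rw [e2, sum_congr rfl fun e _ => e3 e,
    sum_val (m := p.m) (fun e => if e ≤ n.val then (p.ψ j / p.m) • ((w ⊗ₜ[k] w) * (Q *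
      (qb p.γ n.val e • ((y ⊗ₜ[k] (g : A)) ^ e * (1 ⊗ₜ[k] y) ^ (n.val - e)) *
        (g : A) ⊗ₜ[k] (g : A)))) else 0)]
  have hyg : ((1 : A) ⊗ₜ[k] y) * (y ⊗ₜ[k] (g : A)) = p.γ • ((y ⊗ₜ[k] (g : A)) * (1 ⊗ₜ[k] y)) := by
    rw [tmul_mul_tmul, tmul_mul_tmul, N.yg, one_mul, mul_one, TensorProduct.tmul_smul]
  rw [QComb.add_pow p.γ _ _ hyg, mul_assoc, sum_mul, mul_assoc, mul_sum, mul_sum, smul_sum]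
  have hr : range (n.val + 1) ⊆ range p.m := range_mono n.val_lt
  rw [← sum_subset hr]
  · refine sum_congr rfl fun e he => ?_
    rw [mem_range] at he
    rw [if_pos (by omega)]
  · intro e _ he
    rw [mem_range] at he
    rw [if_neg (by omega)]

theorem tensor (N : Nice p x g y u) : Nice p (tu (k := k) (x, x)) (tu (k := k) (g, g)) (y ⊗ₜ[k] (g : A) + 1 ⊗ₜ y)
    N.Δu where
  xg := by
    rw [commute_iff_eq, ← map_mul, ← map_mul, Prod.mk_mul_mk, Prod.mk_mul_mk, N.xg.eq]
  xy := by
    have h1 := N.xyz 1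
    have h2 := N.xgz 1
    rw [zpow_one] at h1 h2
    rw [tu_val, mul_add, add_mul, tmul_mul_tmul, tmul_mul_tmul, tmul_mul_tmul, tmul_mul_tmul,
      h1.eq, h2.eq, mul_one, one_mul]
  yg := by
    rw [tu_val, mul_add, add_mul, tmul_mul_tmul, tmul_mul_tmul, tmul_mul_tmul, tmul_mul_tmul,
      N.yg, mul_one, one_mul, ← TensorProduct.smul_tmul', TensorProduct.tmul_smul, smul_add]
  ypow := N.tensor_ypow
  gpow := by rw [tu_pow, tu_pow, N.gpow]
  xu := N.tensor_xu
  yu := N.tensor_yu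
  uy := N.tensor_uy
  ug := N.tensor_ug
  uu := N.tensor_uu

end Nice

theorem nice_counit : Nice p (1 : kˣ) 1 (0 : k) (fun i => if i = 0 then 1 else 0) where
  xg := Commute.refl _
  xy := by simp
  yg := by simp
  ypow := by rw [zero_pow p.m_pos.ne']; simp
  gpow := by simp
  xu := by simp
  yu i := by
    by_cases hi : i + 1 = 0
    · have : -i - 1 = 0 := by linear_combination -hi
      simp [this]
    · simp [hi]
  uy := by simp
  ug i := by by_cases hi : i = 0 <;> simp [hi]
  uu i j := by
    have := eval_pol_one p.hγ i j
    simp only [one_zpow, Units.val_one, one_mul, one_pow, mul_one, this]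
    have hm := p.m_ne
    by_cases hi : i = 0 <;> by_cases hj : j = 0 <;> simp [hi, hj, psi_zero, hm]

end DDatum
end

noncomputable section
namespace QComb
open Finset
variable {k : Type*} [Field k] {m : ℕ} {γ : k}

theorem qc_sq (q : k) (n : ℕ) : qc q n * qc q n * q ^ n = q ^ (n * n) := by
  induction n with
  | zero => simp [qc]
  | succ n ih =>
    rw [qc_succ, show (n + 1) * (n + 1) = n * n + (n + n + 1) by ring, pow_add q (n * n), ← ih]
    ring

theorem qc_inv_mul (hγ : γ ≠ 0) (n : ℕ) : qc γ⁻¹ n * qc γ n = 1 := by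
  induction n with
  | zero => simp [qc]
  | succ n ih =>
    rw [qc_succ, qc_succ]
    have : γ⁻¹ ^ n * γ ^ n = 1 := by rw [← mul_pow, inv_mul_cancel₀ hγ, one_pow]
    linear_combination (γ⁻¹ ^ n * γ ^ n) * ih + this

theorem qc_prod [NeZero m] (h : IsPrimitiveRoot γ m) (n : ZMod m) :
    qc γ⁻¹ n.val * qc γ⁻¹ (m - 1 - n.val) = chr h (-1 - n - n * n) := by
  have hm := Nat.pos_of_ne_zero (NeZero.ne m)
  have hγ : γ ≠ 0 := h.ne_zero (by omega)
  have h1 := qc_mul h n.val_lt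
  have h2 := qc_inv_mul hγ n.val
  have h3 := qc_sq γ⁻¹ n.val
  have e1 : γ⁻¹ ^ (1 + 2 * n.val) = chr h (-1 - 2 * n) := by
    rw [← chr_neg_nat h]; push_cast; rw [ZMod.natCast_zmod_val]; congr 1; ring
  have e2 : γ⁻¹ ^ (n.val * n.val) = chr h (-(n * n)) := by
    rw [← chr_neg_nat h]; push_cast; rw [ZMod.natCast_zmod_val]
  have e3 : γ⁻¹ ^ n.val = chr h (-n) := by
    rw [← chr_neg_nat h, ZMod.natCast_zmod_val]
  rw [e1] at h1
  rw [e2, e3] at h3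
  have e4 : chr h (-1 - n - n * n) = chr h (-(n * n)) * chr h n * chr h (-1 - 2 * n) := by
    rw [← AddChar.map_add_eq_mul, ← AddChar.map_add_eq_mul]; congr 1; ring
  have e5 : chr h (-n) * chr h n = 1 := by rw [← AddChar.map_add_eq_mul]; simp
  rw [e4, ← h1, ← h3]
  linear_combination (-(qc γ⁻¹ n.val * qc γ⁻¹ (m - 1 - n.val))) * h2 -
    (qc γ⁻¹ n.val * qc γ⁻¹ n.val * qc γ n.val * qc γ⁻¹ (m - 1 - n.val)) * e5

end QComb

namespace DDatum
open Finset Polynomial QComb MulOpposite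
variable {k : Type*} [Field k] (p : DDatum k)
variable {A : Type*} [Ring A] [Algebra k A]

/-- A unit in the opposite algebra. -/
def ou (a : Aˣ) : (Aᵐᵒᵖ)ˣ := Units.opEquiv.symm (op a)

theorem ou_val (a : Aˣ) : (ou a : Aᵐᵒᵖ) = op (a : A) := rfl

theorem ou_zpow (a : Aˣ) (n : ℤ) : ou a ^ n = ou (a ^ n) := by
  rw [ou, ← map_zpow, ← op_zpow]; rfl

theorem ou_pow (a : Aˣ) (n : ℕ) : ou a ^ n = ou (a ^ n) := by
  rw [ou, ← map_pow, ← op_pow]; rfl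

theorem ou_inv (a : Aˣ) : (ou a)⁻¹ = ou a⁻¹ := rfl

theorem aeval_op (a : A) (P : k[X]) : aeval (op a) P = op (aeval a P) := by
  induction P using Polynomial.induction_on with
  | C r => simp
  | add P Q h1 h2 => rw [map_add, map_add, h1, h2, op_add]
  | monomial n r _ =>
    rw [map_mul, map_mul, map_pow, map_pow, aeval_C, aeval_C, aeval_X, aeval_X, op_mul, op_pow,
      ← MulOpposite.algebraMap_apply]
    exact Algebra.commutes _ _

theorem γ_ne : p.γ ≠ 0 := p.hγ.ne_zero p.m_pos.ne'

theorem ξ_ne : p.ξ ≠ 0 := p.prim.ne_zero (by have := p.m_pos; omega)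

theorem χ_neg_one : p.χ (-1) = p.γ⁻¹ := by rw [AddChar.map_neg_eq_inv, chr_one]

namespace Nice
variable {p} {x g : Aˣ} {y : A} {u : ZMod p.m → A}

/-- `S(u_i)`. -/
def Su (N : Nice p x g y u) (i : ZMod p.m) : A :=
  ((p.ψ i)⁻¹ * p.χ (-i)) • ((↑(x ^ (p.d - p.c : ℤ)) : A) * N.H (-1 - i) * u i)

theorem xx (N : Nice p x g y u) (a b : ℤ) : (↑(x ^ a) : A) * ↑(x ^ b) = ↑(x ^ (a + b)) := by
  rw [zpow_add, Units.val_mul]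

theorem HH (N : Nice p x g y u) (a b : ZMod p.m) : (N.H a : A) * N.H b = N.H (a + b) := by
  rw [H_add, Units.val_mul]

theorem g_eq' (N : Nice p x g y u) : (g : A) = ↑(x ^ (p.d : ℤ)) * N.H 1 := by
  rw [zpow_natCast, N.H_one, ← Units.val_mul, ← N.g_eq]

theorem ginv_eq (N : Nice p x g y u) : (↑g⁻¹ : A) = ↑(x ^ (-p.d : ℤ)) * N.H (-1) := by
  have e : g⁻¹ = x ^ (-p.d : ℤ) * N.H (-1) := by
    have h1 : Commute (x ^ p.d) N.h := N.xh.pow_left _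
    rw [N.H_neg, N.H_one, zpow_neg, zpow_natCast, ← mul_inv_rev, ← h1.eq, ← N.g_eq]
  rw [e, Units.val_mul]

theorem xx' (N : Nice p x g y u) (a b : ℤ) (c : A) : (↑(x ^ a) : A) * (↑(x ^ b) * c) = ↑(x ^ (a + b)) * c := by
  rw [← mul_assoc, N.xx]

theorem HH' (N : Nice p x g y u) (a b : ZMod p.m) (c : A) : (N.H a : A) * (N.H b * c) = N.H (a + b) * c := by
  rw [← mul_assoc, N.HH]

theorem Hx' (N : Nice p x g y u) (a : ZMod p.m) (b : ℤ) (c : A) :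
    (N.H a : A) * ((↑(x ^ b) : A) * c) = (↑(x ^ b) : A) * (N.H a * c) := by
  rw [← mul_assoc, ← (N.xH' _ _).eq, mul_assoc]

theorem Px' (N : Nice p x g y u) (i n : ZMod p.m) (b : ℤ) (c : A) :
    N.P i n * ((↑(x ^ b) : A) * c) = (↑(x ^ b) : A) * (N.P i n * c) := by
  rw [← mul_assoc, (N.P_x _ _ _).eq, mul_assoc]

theorem PH' (N : Nice p x g y u) (i n a : ZMod p.m) (c : A) :
    N.P i n * (N.H a * c) = N.H a * (N.P i n * c) := by
  rw [← mul_assoc, (N.P_H _ _ _).eq, mul_assoc]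

theorem yx' (N : Nice p x g y u) (n : ℕ) (b : ℤ) (c : A) :
    y ^ n * ((↑(x ^ b) : A) * c) = (↑(x ^ b) : A) * (y ^ n * c) := by
  rw [← mul_assoc, ← ((N.xyz b).pow_right n).eq, mul_assoc]

theorem yP' (N : Nice p x g y u) (n : ℕ) (i j : ZMod p.m) (c : A) :
    y ^ n * (N.P i j * c) = N.P i j * (y ^ n * c) := by
  rw [← mul_assoc, ← ((N.P_y _ _).pow_right n).eq, mul_assoc]

theorem ginv_pow (N : Nice p x g y u) (n : ℕ) : (↑(g⁻¹ ^ n) : A) = ↑(x ^ (-(p.d * n) : ℤ)) * N.H (-n) := by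
  induction n with
  | zero => simp [H_zero]
  | succ n ih =>
    rw [pow_succ, Units.val_mul, ih, N.ginv_eq, mul_assoc, N.Hx', N.xx', N.HH]
    push_cast
    congr 4 <;> ring
theorem xginv (N : Nice p x g y u) (n : ℤ) : Commute (↑(x ^ n) : A) (↑g⁻¹ : A) := (N.xgz n).units_inv_right

theorem yginv (N : Nice p x g y u) : y * (↑g⁻¹ : A) = p.γ⁻¹ • ((↑g⁻¹ : A) * y) := by
  rw [N.ginv_eq, ← mul_assoc, ← (N.xyz _).eq, mul_assoc, N.yH, mul_smul_comm, ← mul_assoc,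
    p.χ_neg_one]

theorem uginv (N : Nice p x g y u) (i : ZMod p.m) : u i * (↑g⁻¹ : A) = p.χ (-i) • ((↑(x ^ (2 * p.d : ℤ)) : A) * ↑g⁻¹ * u i) := by
  rw [N.ginv_eq, ← mul_assoc, N.ux, mul_assoc, N.uH, mul_smul_comm, ← mul_assoc, ← mul_assoc,
    N.xx]
  congr 2
  · ring_nf
  · congr 4; ring

theorem uyx (N : Nice p x g y u) (i : ZMod p.m) : u i * y = p.ξ⁻¹ • ((↑(x ^ (-p.d : ℤ)) : A) * (y * u i)) := by
  rw [N.uy, mul_smul_comm, smul_smul, inv_mul_cancel₀ p.ξ_ne, one_smul, ← mul_assoc, ← mul_assoc,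
    ← zpow_natCast, N.xx, neg_add_cancel]
  simp

theorem uz (N : Nice p x g y u) (i : ZMod p.m) : u i * -(y * (↑g⁻¹ : A)) =
    (-(p.ξ⁻¹ * p.χ (-i - 1))) • (N.H (-1) * (y * u i)) := by
  rw [mul_neg, ← mul_assoc, N.uyx, smul_mul_assoc, mul_assoc, mul_assoc, N.uginv, mul_smul_comm,
    mul_smul_comm, smul_smul, N.ginv_eq, ← mul_assoc _ _ (N.H (-1) : A), N.xx, mul_assoc,
    ← mul_assoc y, ← (N.xyz _).eq, mul_assoc, ← mul_assoc, N.xx, ← mul_assoc y, N.yH,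
    smul_mul_assoc, mul_smul_comm, smul_smul, neg_smul, mul_assoc p.ξ⁻¹,
    ← AddChar.map_add_eq_mul, mul_assoc, ← sub_eq_add_neg,
    show (-p.d + (2 * p.d + -p.d) : ℤ) = 0 by ring, zpow_zero, Units.val_one, one_mul]

theorem Suz (N : Nice p x g y u) (i : ZMod p.m) : N.Su i * -(y * (↑g⁻¹ : A)) =
    (-(p.ξ⁻¹ * (p.ψ i)⁻¹ * p.χ (-2 * i - 1))) •
      (↑(x ^ (p.d - p.c : ℤ)) * N.H (-2 - i) * (y * u i)) := by
  rw [Su, smul_mul_assoc, mul_assoc, N.uz, mul_smul_comm, smul_smul, mul_assoc _ (N.H _ : A), N.HH', ← mul_assoc _ (N.H _ : A)]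
  congr 1
  · have : p.χ (-2 * i - 1) = p.χ (-i) * p.χ (-i - 1) := by
      rw [← AddChar.map_add_eq_mul]; congr 1; ring
    rw [this]; ring
  · congr 4; ring

theorem zSu (N : Nice p x g y u) (i : ZMod p.m) : -(y * (↑g⁻¹ : A)) * N.Su i =
    (-((p.ψ i)⁻¹ * p.χ (-2 * i - 2))) •
      ((↑(x ^ (-p.d : ℤ)) : A) * (↑(x ^ (p.d - p.c : ℤ)) * N.H (-2 - i) * (y * u i))) := by
  have e1 : y * (↑g⁻¹ : A) * (↑(x ^ (p.d - p.c : ℤ)) * N.H (-1 - i) * u i) =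
      p.χ (-2 - i) •
        ((↑(x ^ (-p.d : ℤ)) : A) * (↑(x ^ (p.d - p.c : ℤ)) * N.H (-2 - i) * (y * u i))) := by
    have t : (↑g⁻¹ : A) * (↑(x ^ (p.d - p.c : ℤ)) * N.H (-1 - i)) =
        (↑(x ^ (-p.d : ℤ)) : A) * (↑(x ^ (p.d - p.c : ℤ)) * N.H (-2 - i)) := by
      rw [N.ginv_eq, mul_assoc, ← mul_assoc (N.H (-1) : A), ← (N.xH' _ _).eq, mul_assoc, N.HH,
        show (-1 + (-1 - i)) = -2 - i by ring]
    rw [mul_assoc, ← mul_assoc (↑g⁻¹ : A), t, ← mul_assoc, ← mul_assoc y, ← (N.xyz _).eq,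
      mul_assoc _ y, ← mul_assoc y, ← (N.xyz _).eq, mul_assoc _ y, N.yH]
    simp only [mul_smul_comm, smul_mul_assoc, mul_assoc]
  rw [Su, mul_smul_comm, neg_mul, e1, smul_neg, smul_smul, ← neg_smul]
  congr 1
  have : p.χ (-2 * i - 2) = p.χ (-i) * p.χ (-2 - i) := by
      rw [← AddChar.map_add_eq_mul]; congr 1; ring
  rw [this]; ring

theorem Sux (N : Nice p x g y u) (i : ZMod p.m) (n : ℤ) : N.Su i * (↑(x ^ n) : A) = (↑(x ^ (-n)) : A) * N.Su i := by
  rw [Su, smul_mul_assoc, mul_assoc, N.ux, mul_smul_comm, mul_assoc, ← mul_assoc (N.H _ : A),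
    ← (N.xH' _ _).eq, mul_assoc, ← mul_assoc, N.xx, add_comm, ← N.xx]
  simp only [mul_assoc]

theorem S_yu (N : Nice p x g y u) (i : ZMod p.m) : N.Su i * -(y * (↑g⁻¹ : A)) =
    N.Su (i + 1) * (1 - p.χ (-i - 1) • (↑(x ^ (-p.d : ℤ)) : A)) := by
  rw [N.Suz, N.yu, mul_sub, mul_one, mul_smul_comm, N.Sux, sub_mul, one_mul, neg_neg, Su,
    show -1 - (i + 1) = -2 - i by ring, smul_mul_assoc, ← zpow_natCast]
  have e : ∀ b : A, (↑(x ^ (p.d - p.c : ℤ)) * N.H (-2 - i) : A) * (↑(x ^ (p.d : ℤ)) * b) =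
      (↑(x ^ (p.d : ℤ)) : A) * (↑(x ^ (p.d - p.c : ℤ)) * N.H (-2 - i) * b) := by
    intro b
    rw [mul_assoc, ← mul_assoc (N.H _ : A), ← (N.xH' _ _).eq, mul_assoc, ← mul_assoc, N.xx,
      add_comm, ← N.xx]
    simp only [mul_assoc]
  rw [mul_sub, mul_smul_comm, e, mul_smul_comm, smul_sub]
  have hc : -(p.ξ⁻¹ * (p.ψ i)⁻¹ * p.χ (-2 * i - 1)) = (p.ψ (i + 1))⁻¹ * p.χ (-(i + 1)) := by
    have h1 : p.ψ 1 = -p.ξ := psi_one p.prim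
    rw [p.ψ_add, h1, mul_one, show (-2 * i - 1) = -i + -(i + 1) by ring, AddChar.map_add_eq_mul,
      AddChar.map_neg_eq_inv _ i, mul_inv, mul_inv, inv_neg]
    ring
  rw [hc, smul_comm (p.χ (-i - 1))]

theorem S_uy (N : Nice p x g y u) (i : ZMod p.m) : N.Su i * -(y * (↑g⁻¹ : A)) =
    p.ξ • (-(y * (↑g⁻¹ : A)) * (N.Su i * (↑(x ^ (-p.d : ℤ)) : A))) := by
  rw [N.Sux, neg_neg, ← mul_assoc]
  have e : -(y * (↑g⁻¹ : A)) * (↑(x ^ (p.d : ℤ)) : A) = ↑(x ^ (p.d : ℤ)) * -(y * (↑g⁻¹ : A)) := by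
    rw [neg_mul, mul_neg, mul_assoc, ← (N.xginv _).eq, ← mul_assoc, ← (N.xyz _).eq, mul_assoc]
  rw [e, mul_assoc, N.zSu, N.Suz, mul_smul_comm, ← mul_assoc (↑(x ^ (p.d : ℤ)) : A), N.xx,
    add_neg_cancel, zpow_zero, Units.val_one, one_mul, smul_smul]
  congr 1
  have : p.χ (-2 * i - 2) = p.χ (-2 * i - 1) * p.γ⁻¹ := by
    rw [← p.χ_neg_one, ← AddChar.map_add_eq_mul]; congr 1; ring
  have h2 := p.ξ_ne
  rw [this, show p.γ = p.ξ ^ 2 from rfl]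
  field_simp

theorem S_ug (N : Nice p x g y u) (i : ZMod p.m) : (↑g⁻¹ : A) * N.Su i =
    p.χ i • (N.Su i * ((↑g⁻¹ : A) * (↑(x ^ (2 * p.d : ℤ)) : A))) := by
  have e : u i * ((↑g⁻¹ : A) * (↑(x ^ (2 * p.d : ℤ)) : A)) = p.χ (-i) • ((↑g⁻¹ : A) * u i) := by
    rw [← (N.xginv _).eq, ← mul_assoc, N.ux, mul_assoc, N.uginv, mul_smul_comm, ← mul_assoc,
      ← mul_assoc, N.xx, neg_add_cancel, zpow_zero, Units.val_one, one_mul]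
  have e2 : Commute (↑g⁻¹ : A) (↑(x ^ (p.d - p.c : ℤ)) * N.H (-1 - i)) :=
    (N.xginv _).symm.mul_right (N.gH _).units_inv_left
  rw [Su, smul_mul_assoc, mul_assoc _ (u i), e, mul_smul_comm, mul_smul_comm, smul_smul,
    smul_smul, ← mul_assoc, e2.eq, mul_assoc _ _ (u i)]
  congr 1
  have : p.χ i * p.χ (-i) = 1 := by rw [← AddChar.map_add_eq_mul]; simp
  linear_combination (-(p.ψ i)⁻¹ * p.χ (-i)) * this

theorem z_pow (N : Nice p x g y u) (n : ℕ) : (-(y * (↑g⁻¹ : A))) ^ n =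
    (p.γ⁻¹ ^ n * qc p.γ⁻¹ n) • ((↑(g⁻¹ ^ n) : A) * y ^ n) := by
  induction n with
  | zero => simp [qc]
  | succ n ih =>
    have h1 : ∀ n : ℕ, y ^ n * (↑g⁻¹ : A) = p.γ⁻¹ ^ n • ((↑g⁻¹ : A) * y ^ n) := by
      intro n
      induction n with
      | zero => simp
      | succ n ih =>
        rw [pow_succ, mul_assoc, N.yginv, mul_smul_comm, ← mul_assoc, ih, smul_mul_assoc,
          smul_smul, mul_assoc, ← pow_succ, ← pow_succ']
    have h2 : (↑(g⁻¹ ^ n) : A) * y ^ n * -((↑g⁻¹ : A) * y) =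
        (-p.γ⁻¹ ^ n) • ((↑(g⁻¹ ^ (n + 1)) : A) * y ^ (n + 1)) := by
      rw [mul_neg, mul_assoc, ← mul_assoc (y ^ n), h1, smul_mul_assoc, mul_smul_comm, mul_assoc,
        ← pow_succ, ← mul_assoc, pow_succ g⁻¹, Units.val_mul, neg_smul]
    rw [pow_succ, ih, N.yginv, qc_succ, ← smul_neg, smul_mul_smul_comm, h2, smul_smul]
    congr 1; ring

theorem S_ypow (N : Nice p x g y u) : (-(y * (↑g⁻¹ : A))) ^ p.m = 1 - (↑(x⁻¹ ^ (p.m * p.d)) : A) := by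
  have h1 : (p.γ⁻¹) ^ p.m = 1 := p.hγ.inv.pow_eq_one
  rw [N.z_pow, qc_root p.hγ.inv p.m_pos, h1, N.ypow, mul_sub, mul_one, inv_pow, N.gpow,
    Units.inv_mul, inv_pow]
  simp

theorem S_uu (N : Nice p x g y u) (i j : ZMod p.m) : N.Su j * N.Su i = (p.ψ j / p.m) • ((↑g⁻¹ : A) *
    ((-(y * (↑g⁻¹ : A))) ^ (i + j).val *
    (aeval (↑(x⁻¹ ^ p.d) : A) (pol p.hγ i (p.m - 1 - (i + j).val)) *
      (↑(x ^ (p.c : ℤ)) : A)))) := by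
  set n := i + j with hn
  have hm := p.m_ne
  set B : A := ↑(x ^ (p.d - p.c : ℤ)) * N.H (-1 - n) * N.P j n * y ^ n.val with hB
  have hyn : y ^ n.val * (g : A) = p.χ n • ((g : A) * y ^ n.val) := by
    have : ∀ a : ℕ, y ^ a * (g : A) = p.γ ^ a • ((g : A) * y ^ a) := by
      intro a
      induction a with
      | zero => simp
      | succ a ih =>
        rw [pow_succ, mul_assoc, N.yg, mul_smul_comm, ← mul_assoc, ih, smul_mul_assoc, smul_smul,
          mul_assoc, ← pow_succ, ← pow_succ']
    rw [this, chr_pow_val p.hγ]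
  have l1 : N.Su j * N.Su i = ((p.m : k)⁻¹ * (p.ψ j)⁻¹ * p.χ (-i - 2 * j - i * j + n)) • B := by
    have a1 : (↑(x ^ (p.d - p.c : ℤ)) * N.H (-1 - j) * u j : A) *
        (↑(x ^ (p.d - p.c : ℤ)) * N.H (-1 - i) * u i) =
        (p.χ (j * (-1 - i)) * (p.ψ i / p.m) * p.χ n) • B := by
      have b1 : (u j : A) * (↑(x ^ (p.d - p.c : ℤ)) * N.H (-1 - i) * u i) =
          (p.χ (j * (-1 - i)) * (p.ψ i / p.m)) • ((↑(x ^ (-(p.d - p.c) : ℤ)) : A) *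
            (N.H (-1 - i) * (↑(x ^ (-p.c : ℤ)) * (N.P j n * (y ^ n.val * g))))) := by
        rw [← mul_assoc, ← mul_assoc, N.ux, mul_assoc _ (u j), N.uH, mul_smul_comm, smul_mul_assoc,
          mul_assoc, mul_assoc, N.uu', show j + i = n by rw [hn, add_comm], mul_smul_comm,
          mul_smul_comm, smul_smul]
        simp only [mul_assoc]
      have b2 : (↑(x ^ (p.d - p.c : ℤ)) * N.H (-1 - j) : A) * ((↑(x ^ (-(p.d - p.c) : ℤ)) : A) *
            (N.H (-1 - i) * (↑(x ^ (-p.c : ℤ)) * (N.P j n * ((g : A) * y ^ n.val))))) = B := by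
        rw [N.g_eq', hB]
        simp only [mul_assoc, N.Hx', N.xx', N.HH', N.Px', N.PH']
        congr 2
        · congr 1; ring
        · congr 3; rw [hn]; ring
      rw [mul_assoc _ (u j), b1, hyn]
      simp only [mul_smul_comm, smul_smul]
      rw [b2]
    rw [Su, Su, smul_mul_smul_comm, a1, smul_smul]
    congr 1
    have c1 : p.χ (-i - 2 * j - i * j + n) = p.χ (-j) * p.χ (-i) * p.χ (j * (-1 - i)) * p.χ n := by
      rw [← AddChar.map_add_eq_mul, ← AddChar.map_add_eq_mul, ← AddChar.map_add_eq_mul]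
      congr 1; ring
    rw [c1]
    have := p.ψ_ne i
    field_simp
  have r1 : (↑g⁻¹ : A) * ((-(y * (↑g⁻¹ : A))) ^ n.val *
    (aeval (↑(x⁻¹ ^ p.d) : A) (pol p.hγ i (p.m - 1 - n.val)) * (↑(x ^ (p.c : ℤ)) : A))) =
      (p.χ (-n) * p.χ ((i + 1) * (1 + n)) * p.χ (-1 - n - n * n)) • B := by
    have a1 := pol_inv p.hγ (x ^ p.d) i n
    rw [← inv_pow, show n - i = j by rw [hn]; ring] at a1
    change _ = _ • (_ * N.P j n) at a1
    have a2 : (↑g⁻¹ : A) * ((↑(g⁻¹ ^ n.val) : A) * y ^ n.val *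
        ((↑((x⁻¹ ^ p.d) ^ (p.m - 1 - n.val)) : A) * N.P j n * (↑(x ^ (p.c : ℤ)) : A))) = B := by
      have t1 : (x⁻¹ ^ p.d) ^ (p.m - 1 - n.val) = x ^ (-(p.d * (p.m - 1 - n.val)) : ℤ) := by
        have := n.val_lt
        rw [← pow_mul, inv_pow, ← zpow_natCast, ← zpow_neg]
        congr 1
        rw [Nat.cast_mul, Nat.cast_sub (by omega), Nat.cast_sub (by omega)]; simp
      have t2 : N.P j n * (↑(x ^ (p.c : ℤ)) : A) = ↑(x ^ (p.c : ℤ)) * N.P j n := (N.P_x _ _ _).eq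
      have t3 : y ^ n.val * N.P j n = N.P j n * y ^ n.val := ((N.P_y _ _).pow_right _).eq.symm
      rw [t1, N.ginv_pow, N.ginv_eq, hB]
      simp only [mul_assoc, t2, N.Hx', N.xx', N.HH', N.yx', t3]
      have h2 : (2 * p.c : ℤ) = (1 + p.m) * p.d := by exact_mod_cast p.two_c
      congr 2
      · congr 1; linear_combination h2
      · rw [ZMod.natCast_zmod_val]; congr 3; ring
    rw [a1, N.z_pow, smul_mul_assoc _ (_ * N.P j n), smul_mul_smul_comm, mul_smul_comm, a2, ← qc_prod p.hγ]
    congr 1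
    have a3 : p.γ⁻¹ ^ n.val = p.χ (-n) := by
      rw [← chr_neg_nat p.hγ, ZMod.natCast_zmod_val]
    rw [a3]; ring
  rw [l1, r1, smul_smul]
  congr 1
  have c1 : p.χ (-i - 2 * j - i * j + n) =
      p.χ (j * j) * (p.χ (-n) * p.χ ((i + 1) * (1 + n)) * p.χ (-1 - n - n * n)) := by
    rw [← AddChar.map_add_eq_mul, ← AddChar.map_add_eq_mul, ← AddChar.map_add_eq_mul, hn]
    congr 1; ring
  rw [c1, ← p.ψ_sq]
  have := p.ψ_ne j
  field_simp

end Nice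
end DDatum
end

/-! The algebra `D(m, d, ξ)`: generators `DDatum.Gen`, relations `DDatum.Rel`, the algebra `DAlg`, and the
structure maps `DAlg.comulGen`, `DAlg.counitGen`, `DAlg.antipodeGen` on the generators. -/

noncomputable section
namespace DDatum
open Finset Polynomial QComb MulOpposite
variable {k : Type*} [Field k] {p : DDatum k}
variable {A : Type*} [Ring A] [Algebra k A]

namespace Nice
variable {x g : Aˣ} {y : A} {u : ZMod p.m → A}

theorem opposite (N : Nice p x g y u) : Nice p (ou x⁻¹) (ou g⁻¹) (op (-(y * (↑g⁻¹ : A)))) (fun i => op (N.Su i)) where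
  xg := by
    have h : Commute x⁻¹ g⁻¹ := N.xg.inv_inv
    refine Units.ext ?_
    rw [Units.val_mul, Units.val_mul, ou_val, ou_val, ← op_mul, ← op_mul, ← Units.val_mul,
      ← Units.val_mul, h.eq]
  xy := by
    have h1 := N.xyz (-1)
    have h2 := N.xginv (-1)
    rw [zpow_neg_one] at h1 h2
    rw [ou_val, ← op_mul, ← op_mul, neg_mul, mul_neg, mul_assoc, ← h2.eq, ← mul_assoc, ← mul_assoc,
      h1.eq]
  yg := by
    rw [ou_val, ← op_mul, ← op_mul, ← op_smul, N.yginv]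
    congr 1
    rw [mul_neg, mul_smul_comm, neg_mul, smul_mul_assoc, smul_neg, smul_smul,
      mul_inv_cancel₀ p.γ_ne, one_smul, mul_assoc, N.yginv, mul_smul_comm]
  ypow := by
    rw [← op_pow, N.S_ypow, ou_pow, ou_val, op_sub, op_one]
  gpow := by rw [ou_pow, ou_pow, inv_pow, inv_pow, N.gpow]
  xu i := by
    have := N.Sux i (-1)
    rw [zpow_neg_one, neg_neg, zpow_one] at this
    rw [ou_inv, ou_val, ou_val, ← op_mul, ← op_mul, inv_inv, this]
  yu i := by
    have := N.S_yu i
    rw [ou_pow, ou_val, ← op_mul, ← op_smul, ← op_one, ← op_sub, ← op_mul, this]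
    rw [zpow_neg, zpow_natCast, inv_pow]
  uy i := by
    have := N.S_uy i
    rw [ou_pow, ou_val, ← op_mul, ← op_mul, ← op_mul, ← op_smul, this]
    rw [zpow_neg, zpow_natCast, inv_pow]
  ug i := by
    have := N.S_ug i
    rw [ou_zpow, ou_val, ou_val, ← op_mul, ← op_mul, ← op_mul, ← op_smul, this]
    rw [inv_zpow', neg_neg]
  uu i j := by
    have := N.S_uu i j
    rw [ou_zpow, ou_pow, ou_val, ou_val, ou_val, aeval_op, ← op_mul, ← op_mul, ← op_pow, ← op_mul,
      ← op_mul, ← op_smul, this]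
    rw [inv_zpow', neg_neg]

theorem sum_left (N : Nice p x g y u) (i : ZMod p.m) : ∑ j, p.χ (j * (i - j)) • (N.Su j * ((N.H j : A) * u (i - j))) =
    if i = 0 then 1 else 0 := by
  have e : ∀ j, p.χ (j * (i - j)) • (N.Su j * ((N.H j : A) * u (i - j))) =
      (p.ψ i / p.m) • ((↑(x ^ (p.d - p.c : ℤ)) * N.H (-1) * ↑(x ^ (-p.c : ℤ)) : A) *
        (p.χ (-j) • N.P j i) * (y ^ i.val * g)) := by
    intro j
    rw [Su, smul_mul_assoc, smul_smul, mul_assoc _ (u j), ← mul_assoc (u j), N.uH, smul_mul_assoc,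
      mul_assoc _ (u j), N.uu', add_sub_cancel]
    simp only [mul_smul_comm, smul_mul_assoc, smul_smul]
    rw [mul_assoc _ (N.H _ : A), N.HH', show -1 - j + j = -1 by ring]
    simp only [mul_assoc]
    congr 1
    have c1 : p.χ (-j) = p.χ (j * (i - j)) * p.χ (-j) * p.χ (j * j) * p.χ (i * -j) := by
      rw [← AddChar.map_add_eq_mul, ← AddChar.map_add_eq_mul, ← AddChar.map_add_eq_mul]
      congr 1; ring
    rw [sub_eq_add_neg i j, p.ψ_add, p.ψ_neg, ← sub_eq_add_neg]
    have := p.ψ_ne j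
    have h2 : p.ψ i / p.m * p.χ (-j) = p.ψ i / p.m *
      (p.χ (j * (i - j)) * p.χ (-j) * p.χ (j * j) * p.χ (i * -j)) := by rw [← c1]
    rw [h2]
    field_simp
  rw [sum_congr rfl fun j _ => e j, ← smul_sum, ← sum_mul, ← mul_sum]
  have h0 : ∑ j, p.χ (-j) • N.P j i = _ := key0 p.hγ (↑(x ^ p.d) : A) i
  rw [h0]
  split_ifs with hi
  · subst hi
    have t1 : (↑(x ^ p.d) : A) ^ (p.m - 1) = ↑(x ^ (p.d * (p.m - 1) : ℤ)) := by
      have := p.m_pos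
      rw [← Units.val_pow_eq_pow_val, ← pow_mul, ← zpow_natCast, Nat.cast_mul,
        Nat.cast_sub (by omega), Nat.cast_one]
    have h2 : (2 * p.c : ℤ) = (1 + p.m) * p.d := by exact_mod_cast p.two_c
    rw [t1, show p.ψ 0 = 1 from psi_zero, ZMod.val_zero, pow_zero, one_mul, N.g_eq', mul_smul_comm, smul_mul_assoc,
      smul_smul, one_div, inv_mul_cancel₀ p.m_ne, one_smul]
    simp only [mul_assoc, N.Hx', N.xx', N.HH]
    rw [neg_add_cancel, H_zero, Units.val_one, mul_one,
      show (p.d - p.c + -p.c + (p.d * (p.m - 1) + p.d) : ℤ) = 0 by linear_combination -h2]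
    simp
  · simp

theorem sum_right (N : Nice p x g y u) (i : ZMod p.m) :
    ∑ j, p.χ (j * (i - j)) • (u j * (N.Su (i - j) * (↑(N.H j)⁻¹ : A))) =
    if i = 0 then 1 else 0 := by
  have e : ∀ j, p.χ (j * (i - j)) • (u j * (N.Su (i - j) * (↑(N.H j)⁻¹ : A))) =
      ((p.m : k)⁻¹ * p.χ (-i)) • ((↑(x ^ (-(p.d - p.c) : ℤ)) * N.H (-1 - i) * ↑(x ^ (-p.c : ℤ)) : A) *
        (p.χ (-(j * i)) • N.P j i) * (y ^ i.val * g)) := by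
    intro j
    rw [← N.H_neg, Su, smul_mul_assoc, mul_assoc _ (u (i - j)), N.uH]
    simp only [mul_smul_comm, smul_smul]
    rw [mul_assoc _ (N.H _ : A), N.HH', mul_assoc _ (N.H _ : A), ← mul_assoc (u j), N.ux,
      mul_assoc _ (u j), ← mul_assoc (u j), N.uH, smul_mul_assoc, mul_assoc _ (u j), N.uu',
      add_sub_cancel]
    simp only [mul_smul_comm, smul_mul_assoc, smul_smul]
    rw [show -1 - (i - j) + -j = -1 - i by ring]
    simp only [mul_assoc]
    congr 1
    have c1 : p.χ (-i) * p.χ (-(j * i)) = p.χ (j * (i - j)) * p.χ (-(i - j)) *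
        p.χ ((i - j) * -j) * p.χ (j * (-1 - i)) := by
      simp only [← AddChar.map_add_eq_mul]
      congr 1; ring
    have := p.ψ_ne (i - j)
    have h2 : (p.m : k)⁻¹ * (p.χ (-i) * p.χ (-(j * i))) = (p.m : k)⁻¹ *
      (p.χ (j * (i - j)) * p.χ (-(i - j)) *
        p.χ ((i - j) * -j) * p.χ (j * (-1 - i))) := by rw [← c1]
    rw [h2]
    field_simp
  rw [sum_congr rfl fun j _ => e j, ← smul_sum, ← sum_mul, ← mul_sum]
  have h0 : ∑ j, p.χ (-(j * i)) • N.P j i = _ := key_zero p.hγ (↑(x ^ p.d) : A) i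
  rw [h0]
  split_ifs with hi
  · subst hi
    rw [ZMod.val_zero, pow_zero, one_mul, N.g_eq', neg_zero, AddChar.map_zero_eq_one, mul_one,
      ← Algebra.commutes, ← Algebra.smul_def, smul_mul_assoc, smul_smul, inv_mul_cancel₀ p.m_ne,
      one_smul]
    simp only [mul_assoc, N.Hx', N.xx', N.HH]
    rw [show (-1 - 0 + 1 : ZMod p.m) = 0 by ring, H_zero, Units.val_one, mul_one,
      show (-(p.d - p.c) + (-p.c + p.d) : ℤ) = 0 by ring]
    simp
  · simp

end Nice

/-- The generators `x, x⁻¹, g, y, u_0, …, u_{m-1}`; the index of `u` is taken modulo `m`. -/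
inductive Gen (m : ℕ) : Type
  | x : Gen m
  | xInv : Gen m
  | g : Gen m
  | y : Gen m
  | u (i : ZMod m) : Gen m

open FreeAlgebra (ι)

variable (p)

/-- `φ_i = 1 - γ^{-i-1} x^d`. -/
def phi (i : ℤ) : k[X] := 1 - C (p.γ ^ (-i - 1)) * X ^ p.d

/-- The defining relations of `D(m, d, ξ)`. In the last one, the product over `l` is
`φ_i φ_{i+1} ⋯ φ_{m-2-j}` if `i + j ≤ m - 2`, empty if `i + j = m - 1`, and
`φ_i ⋯ φ_{m-1} φ_0 ⋯ φ_{m-2-j}` otherwise (recall that `φ_{l+m} = φ_l`), and the power of `y` is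
`y^{i+j}` in the first two cases and `y^{i+j-m}` in the third. -/
inductive Rel : FreeAlgebra k (Gen p.m) → FreeAlgebra k (Gen p.m) → Prop
  | x_xInv : Rel (ι k .x * ι k .xInv) 1
  | xInv_x : Rel (ι k .xInv * ι k .x) 1
  | x_g : Rel (ι k .x * ι k .g) (ι k .g * ι k .x)
  | x_y : Rel (ι k .x * ι k .y) (ι k .y * ι k .x)
  | y_g : Rel (ι k .y * ι k .g) (p.γ • (ι k .g * ι k .y))
  | y_pow : Rel (ι k .y ^ p.m) (1 - ι k .x ^ (p.m * p.d))
  | g_pow : Rel (1 - ι k .x ^ (p.m * p.d)) (1 - ι k .g ^ p.m)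
  | x_u (i : ZMod p.m) : Rel (ι k .x * ι k (.u i)) (ι k (.u i) * ι k .xInv)
  | y_u (i : ZMod p.m) : Rel (ι k .y * ι k (.u i)) (aeval (ι k .x) (p.phi i.val) * ι k (.u (i + 1)))
  | u_y (i : ZMod p.m) : Rel (ι k .y * ι k (.u i)) (p.ξ • (ι k .x ^ p.d * ι k (.u i) * ι k .y))
  | u_g (i : ZMod p.m) : Rel (ι k (.u i) * ι k .g)
      (p.γ ^ i.val • (ι k .xInv ^ (2 * p.d) * ι k .g * ι k (.u i)))
  | u_u (i j : ZMod p.m) : Rel (ι k (.u i) * ι k (.u j))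
      (((-1) ^ (-j.val : ℤ) * p.ξ ^ (-j.val : ℤ) * p.γ ^ (j.val * (j.val + 1) / 2) * (1 / p.m)) •
        (ι k .xInv ^ ((1 + p.m) * p.d / 2) *
          aeval (ι k .x) (∏ l ∈ range (p.m - 1 - (i + j).val), p.phi (i.val + l)) *
          ι k .y ^ (i + j).val * ι k .g))

theorem chr_int (z : ℤ) : p.χ (z : ZMod p.m) = p.γ ^ z := by
  have : (z : ZMod p.m) = z • (1 : ZMod p.m) := by simp
  rw [this, AddChar.map_zsmul_eq_zpow, chr_one]

theorem val_int (i : ZMod p.m) : ((i.val : ℤ) : ZMod p.m) = i := by simp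

theorem aeval_phi (x : A) (i : ℤ) : aeval x (p.phi i) = 1 - p.χ (-(i : ZMod p.m) - 1) • x ^ p.d := by
  rw [phi, ← p.chr_int]
  push_cast
  simp [Algebra.smul_def]

theorem aeval_prod_phi (x : A) (i : ZMod p.m) (n : ℕ) :
    aeval x (∏ l ∈ range n, p.phi (i.val + l)) = aeval (x ^ p.d) (pol p.hγ i n) := by
  have : ∏ l ∈ range n, p.phi (i.val + l) = (pol p.hγ i n).comp (X ^ p.d) := by
    rw [pol, Polynomial.prod_comp]
    refine prod_congr rfl fun l _ => ?_
    rw [phi, ← p.chr_int]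
    push_cast
    rw [ZMod.natCast_zmod_val, show -(i + (l : ZMod p.m)) - 1 = -i - 1 - l by ring]
    simp
  rw [this, aeval_comp]
  simp

theorem coef_eq (j : ℕ) : ((-1) ^ (-j : ℤ) * p.ξ ^ (-j : ℤ) * p.γ ^ (j * (j + 1) / 2) * (1 / p.m) : k) =
    psiN p.ξ j / p.m := by
  have h1 : p.γ ^ (j * (j + 1) / 2) = p.ξ ^ (j * (j + 1)) := by
    rw [show p.γ = p.ξ ^ 2 from rfl, ← pow_mul, Nat.mul_div_cancel' (Nat.even_mul_succ_self j).two_dvd]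
  have h2 : ((-1 : k)) ^ (-j : ℤ) = (-1) ^ j := by
    rw [zpow_neg, zpow_natCast, ← inv_pow]; simp
  have h3 := p.ξ_ne
  rw [h1, h2, psiN, zpow_neg, zpow_natCast, mul_one_div, show j * (j + 1) = j + j ^ 2 by ring, pow_add]
  field_simp

variable {p} in
/-- The images of the generators. -/
def toFun (x g : Aˣ) (y : A) (u : ZMod p.m → A) : Gen p.m → A
  | .x => x
  | .xInv => (↑x⁻¹ : A)
  | .g => g
  | .y => y
  | .u i => u i

theorem inv_pow_val (x : Aˣ) (n : ℕ) : (↑x⁻¹ : A) ^ n = (↑(x ^ (-n : ℤ)) : A) := by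
  rw [zpow_neg, zpow_natCast, ← inv_pow, Units.val_pow_eq_pow_val]

theorem Nice.lift_rel {p : DDatum k} {x g : Aˣ} {y : A} {u : ZMod p.m → A} (N : Nice p x g y u)
    ⦃a b : FreeAlgebra k (Gen p.m)⦄ (h : p.Rel a b) :
    FreeAlgebra.lift k (toFun x g y u) a = FreeAlgebra.lift k (toFun x g y u) b := by
  have e1 := N.xg
  have e2 : (x : A) * g = g * x := congrArg Units.val e1
  cases h
  case u_u i j =>
    have := N.uu i j
    simp only [map_mul, map_smul, map_pow, FreeAlgebra.lift_ι_apply, ← aeval_algHom_apply, toFun,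
      aeval_prod_phi, coef_eq, inv_pow_val]
    rw [← Units.val_pow_eq_pow_val]
    exact this
  case y_u i =>
    have := N.yu i
    simp only [map_mul, FreeAlgebra.lift_ι_apply, ← aeval_algHom_apply, toFun]
    rw [aeval_phi, val_int, ← Units.val_pow_eq_pow_val]
    exact this
  case u_g i =>
    have := N.ug i
    simp only [map_mul, map_smul, map_pow, FreeAlgebra.lift_ι_apply, toFun, inv_pow_val,
      chr_pow_val p.hγ]
    push_cast
    exact this
  case g_pow =>
    have := congrArg Units.val N.gpow
    push_cast at this
    simp [toFun, this]
  all_goals simp [toFun, N.xy, N.yg, N.ypow, N.xu]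
  case x_g => exact e2
  case u_y i => simpa using N.uy i

end DDatum

/-- The algebra `D(m, d, ξ)`. -/
abbrev DAlg {k : Type*} [Field k] (p : DDatum k) := HopfPres.Pres p.Rel

namespace DAlg
open DDatum HopfPres Finset QComb
variable {k : Type*} [Field k] (p : DDatum k)

/-- `x` as a unit of `D(m, d, ξ)`. -/
def x : (DAlg p)ˣ where
  val := gen p.Rel .x
  inv := gen p.Rel .xInv
  val_inv := by simpa using rel_eq (Rel.x_xInv (p := p))
  inv_val := by simpa using rel_eq (Rel.xInv_x (p := p))

def y : DAlg p := gen p.Rel .y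

def u (i : ZMod p.m) : DAlg p := gen p.Rel (.u i)

theorem g_pow' : (gen p.Rel .g) ^ p.m = (↑(x p ^ (p.m * p.d)) : DAlg p) := by
  have := rel_eq (Rel.g_pow (p := p))
  simp only [map_sub, map_one, map_pow, FreeAlgebra.lift_ι_apply, sub_right_inj] at this
  rw [← this, Units.val_pow_eq_pow_val]
  rfl

theorem x_g' : (x p : DAlg p) * gen p.Rel .g = gen p.Rel .g * x p := by
  have := rel_eq (Rel.x_g (p := p))
  simp only [map_mul, FreeAlgebra.lift_ι_apply] at this
  exact this

/-- `g` as a unit of `D(m, d, ξ)`, with inverse `x^{-md} g^{m-1}`. -/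
def g : (DAlg p)ˣ where
  val := gen p.Rel .g
  inv := (↑(x p ^ (p.m * p.d))⁻¹ : DAlg p) * gen p.Rel .g ^ (p.m - 1)
  val_inv := by
    have h : Commute (gen p.Rel .g) (↑(x p ^ (p.m * p.d)) : DAlg p) := by
      rw [Units.val_pow_eq_pow_val]
      exact Commute.pow_right (x_g' p).symm _
    rw [← mul_assoc, h.units_inv_right.eq, mul_assoc, ← pow_succ', Nat.sub_add_cancel p.m_pos,
      g_pow', Units.inv_mul]
  inv_val := by
    rw [mul_assoc, ← pow_succ, Nat.sub_add_cancel p.m_pos, g_pow', Units.inv_mul]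

theorem toFun_gen : toFun (x p) (g p) (y p) (u p) = gen p.Rel := by
  funext a; cases a <;> rfl

theorem nice : Nice p (x p) (g p) (y p) (u p) where
  xg := Units.ext (x_g' p)
  xy := by
    have := rel_eq (Rel.x_y (p := p))
    rw [← toFun_gen] at this
    simpa [toFun] using this
  yg := by
    have := rel_eq (Rel.y_g (p := p))
    rw [← toFun_gen] at this
    simpa [toFun] using this
  ypow := by
    have := rel_eq (Rel.y_pow (p := p))
    rw [← toFun_gen] at this
    simpa [toFun] using this
  gpow := Units.ext (by rw [Units.val_pow_eq_pow_val]; exact g_pow' p)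
  xu i := by
    have := rel_eq (Rel.x_u (p := p) i)
    rw [← toFun_gen] at this
    simpa [toFun] using this
  yu i := by
    have := rel_eq (Rel.y_u (p := p) i)
    rw [← toFun_gen] at this
    simp only [map_mul, FreeAlgebra.lift_ι_apply, ← Polynomial.aeval_algHom_apply, toFun] at this
    rwa [aeval_phi, val_int, ← Units.val_pow_eq_pow_val] at this
  uy i := by
    have := rel_eq (Rel.u_y (p := p) i)
    rw [← toFun_gen] at this
    simpa [toFun] using this
  ug i := by
    have := rel_eq (Rel.u_g (p := p) i)
    rw [← toFun_gen] at this
    simp only [map_mul, map_smul, map_pow, FreeAlgebra.lift_ι_apply, toFun, inv_pow_val,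
      chr_pow_val p.hγ] at this
    push_cast at this
    exact this
  uu i j := by
    have := rel_eq (Rel.u_u (p := p) i j)
    rw [← toFun_gen] at this
    simp only [map_mul, map_smul, map_pow, FreeAlgebra.lift_ι_apply,
      ← Polynomial.aeval_algHom_apply, toFun,
      aeval_prod_phi, coef_eq, inv_pow_val] at this
    rw [← Units.val_pow_eq_pow_val] at this
    exact this

/-- The comultiplication on the generators. -/
def comulGen : Gen p.m → DAlg p ⊗[k] DAlg p
  | .x => (x p : DAlg p) ⊗ₜ (x p : DAlg p)
  | .xInv => (↑(x p)⁻¹ : DAlg p) ⊗ₜ (↑(x p)⁻¹ : DAlg p)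
  | .g => (g p : DAlg p) ⊗ₜ (g p : DAlg p)
  | .y => y p ⊗ₜ (g p : DAlg p) + 1 ⊗ₜ y p
  | .u i => ∑ j : ZMod p.m, p.γ ^ ((j.val : ℤ) * (i.val - j.val)) •
      (u p j ⊗ₜ ((↑(x p ^ (-(j.val * p.d) : ℤ)) : DAlg p) * (g p : DAlg p) ^ j.val * u p (i - j)))

/-- The counit on the generators. -/
def counitGen : Gen p.m → k
  | .x => 1
  | .xInv => 1
  | .g => 1
  | .y => 0
  | .u i => if i = 0 then 1 else 0

/-- The antipode on the generators. -/
def antipodeGen : Gen p.m → DAlg p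
  | .x => (↑(x p)⁻¹ : DAlg p)
  | .xInv => x p
  | .g => (↑(g p)⁻¹ : DAlg p)
  | .y => -(y p * (↑(g p)⁻¹ : DAlg p))
  | .u i => ((-1) ^ i.val * p.ξ ^ (-i.val : ℤ) * p.γ ^ (-(i.val * (i.val + 1) / 2) : ℤ)) •
      ((↑(x p ^ (i.val * p.d + 3 * ((1 - p.m) * p.d / 2) : ℤ)) : DAlg p) *
        (g p : DAlg p) ^ (p.m - i.val - 1) * u p i)

theorem comulGen_eq : comulGen p = toFun (tu (x p, x p)) (tu (g p, g p))
    (y p ⊗ₜ (g p : DAlg p) + 1 ⊗ₜ y p) (nice p).Δu := by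
  funext a
  cases a with
  | u i =>
    change _ = (nice p).Δu i
    rw [Nice.Δu, comulGen]
    refine sum_congr rfl fun j _ => ?_
    rw [← p.chr_int]
    push_cast
    rw [ZMod.natCast_zmod_val, ZMod.natCast_zmod_val]
    congr 4
    rw [← Units.val_pow_eq_pow_val (g p), (nice p).g_pow_val, Units.val_mul, ← mul_assoc,
      ← Units.val_mul, ← pow_mul, ← zpow_natCast (x p), ← zpow_add,
      show (-(j.val * p.d : ℤ) + ((p.d * j.val : ℕ) : ℤ)) = 0 by push_cast; ring]
    simp
  | _ => rfl

theorem counitGen_eq : counitGen p = toFun 1 1 0 (fun i => if i = 0 then 1 else 0) := by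
  funext a; cases a <;> simp [counitGen, toFun]

theorem antipodeGen_eq : (fun a => MulOpposite.op (antipodeGen p a)) =
    toFun (ou (x p)⁻¹) (ou (g p)⁻¹) (MulOpposite.op (-(y p * (↑(g p)⁻¹ : DAlg p))))
      (fun i => MulOpposite.op ((nice p).Su i)) := by
  funext a
  cases a with
  | u i =>
    change MulOpposite.op _ = MulOpposite.op _
    congr 1
    rw [Nice.Su, antipodeGen]
    have hc : ((-1) ^ i.val * p.ξ ^ (-i.val : ℤ) * p.γ ^ (-(i.val * (i.val + 1) / 2) : ℤ) : k) =
        (p.ψ i)⁻¹ * p.χ (-i) := by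
      have h1 : (p.γ ^ (-(i.val * (i.val + 1) / 2) : ℤ)) = (p.ξ ^ (i.val * (i.val + 1)))⁻¹ := by
        have e : (-(i.val * (i.val + 1) / 2) : ℤ) = -((i.val * (i.val + 1) / 2 : ℕ) : ℤ) := by
          push_cast; rfl
        rw [e, zpow_neg, zpow_natCast, show p.γ = p.ξ ^ 2 from rfl, ← pow_mul,
          Nat.mul_div_cancel' (Nat.even_mul_succ_self i.val).two_dvd]
      have h2 : p.χ (-i) = (p.ξ ^ (2 * i.val))⁻¹ := by
        rw [AddChar.map_neg_eq_inv, ← chr_pow_val p.hγ, pow_mul]; rfl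
      have h3 : p.ψ i = (-1) ^ i.val * p.ξ ^ (i.val ^ 2) := rfl
      have h4 : ((-1 : k)) ^ i.val = ((-1) ^ i.val)⁻¹ := by rw [← inv_pow]; simp
      rw [h1, h2, h3, zpow_neg, zpow_natCast, mul_inv, ← h4, mul_assoc, mul_assoc, ← mul_inv,
        ← mul_inv, ← pow_add, ← pow_add]
      congr 3; ring
    rw [hc]
    congr 2
    have hi := i.val_lt
    have h2 : (2 * p.c : ℤ) = (1 + p.m) * p.d := by exact_mod_cast p.two_c
    have h3 : ((1 - p.m) * p.d / 2 : ℤ) = p.d - p.c := by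
      rw [show ((1 - p.m) * p.d : ℤ) = 2 * (p.d - p.c) by linear_combination h2]
      simp
    have h4 : (g p) ^ (p.m - i.val - 1) =
        (x p ^ p.d) ^ (p.m - i.val - 1) * (nice p).H (-1 - i) := by
      have := (nice p).g_pow_val ((p.m - i.val - 1 : ℕ) : ZMod p.m)
      rw [ZMod.val_cast_of_lt (by omega)] at this
      rw [this]
      congr 2
      rw [Nat.cast_sub (by omega), Nat.cast_sub (by omega)]; simp; ring
    rw [← Units.val_pow_eq_pow_val (g p), h4, h3, Units.val_mul, ← mul_assoc, ← Units.val_mul,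
      ← pow_mul, ← zpow_natCast, ← zpow_add]
    congr 3
    rw [Nat.cast_mul, Nat.cast_sub (by omega), Nat.cast_sub (by omega)]
    push_cast
    linear_combination -h2
  | _ => rfl

theorem comul_rel ⦃a b : FreeAlgebra k (Gen p.m)⦄ (h : p.Rel a b) :
    FreeAlgebra.lift k (comulGen p) a = FreeAlgebra.lift k (comulGen p) b := by
  rw [comulGen_eq]
  exact (nice p).tensor.lift_rel h

theorem counit_rel ⦃a b : FreeAlgebra k (Gen p.m)⦄ (h : p.Rel a b) :
    FreeAlgebra.lift k (counitGen p) a = FreeAlgebra.lift k (counitGen p) b := by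
  have := (nice_counit p).lift_rel h
  rw [counitGen_eq]
  exact this

theorem antipode_rel ⦃a b : FreeAlgebra k (Gen p.m)⦄ (h : p.Rel a b) :
    FreeAlgebra.lift k (fun c => MulOpposite.op (antipodeGen p c)) a =
      FreeAlgebra.lift k (fun c => MulOpposite.op (antipodeGen p c)) b := by
  rw [antipodeGen_eq]
  exact (nice p).opposite.lift_rel h

end DAlg
end

noncomputable section
namespace DAlg
open DDatum HopfPres Finset QComb
open Algebra.TensorProduct (tmul_mul_tmul)
variable {k : Type*} [Field k] (p : DDatum k)

theorem comul_u (i : ZMod p.m) : comulGen p (.u i) = ∑ j, p.χ (j * (i - j)) •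
    (u p j ⊗ₜ[k] (((nice p).H j : DAlg p) * u p (i - j))) := by
  rw [comulGen_eq]; rfl

theorem antipode_u (i : ZMod p.m) : antipodeGen p (.u i) = (nice p).Su i :=
  congrArg MulOpposite.unop (congrFun (antipodeGen_eq p) (.u i))

theorem map_H {B : Type*} [Ring B] [Algebra k B] (f : DAlg p →ₐ[k] B) (x' g' : Bˣ)
    (hx : f (x p) = x') (hg : f (g p) = g') (j : ZMod p.m) :
    f ((nice p).H j) = (((x' ^ p.d)⁻¹ * g') ^ j.val : Bˣ) := by
  have hx' : Units.map (f : DAlg p →* B) (x p) = x' := Units.ext hx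
  have hg' : Units.map (f : DAlg p →* B) (g p) = g' := Units.ext hg
  rw [← hx', ← hg', ← map_pow, ← map_inv, ← map_mul, ← map_pow]
  rfl

/-- The comultiplication as an algebra map. -/
def Δ : DAlg p →ₐ[k] DAlg p ⊗[k] DAlg p := lift (comulGen p) (comul_rel p)

/-- The counit as an algebra map. -/
def ε : DAlg p →ₐ[k] k := lift (counitGen p) (counit_rel p)

theorem Δ_x : Δ p (x p) = (x p : DAlg p) ⊗ₜ (x p : DAlg p) := lift_gen (comulGen p) (comul_rel p) .x
theorem Δ_xInv : Δ p (↑(x p)⁻¹ : DAlg p) = (↑(x p)⁻¹ : DAlg p) ⊗ₜ (↑(x p)⁻¹ : DAlg p) :=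
  lift_gen (comulGen p) (comul_rel p) .xInv
theorem Δ_g : Δ p (g p) = (g p : DAlg p) ⊗ₜ (g p : DAlg p) := lift_gen (comulGen p) (comul_rel p) .g
theorem Δ_y : Δ p (y p) = y p ⊗ₜ (g p : DAlg p) + 1 ⊗ₜ y p :=
  lift_gen (comulGen p) (comul_rel p) .y
theorem Δ_u (i : ZMod p.m) : Δ p (u p i) = ∑ j, p.χ (j * (i - j)) •
    (u p j ⊗ₜ[k] (((nice p).H j : DAlg p) * u p (i - j))) :=
  (lift_gen (comulGen p) (comul_rel p) (.u i)).trans (comul_u p i)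

theorem Δ_H (j : ZMod p.m) : Δ p ((nice p).H j) =
    ((nice p).H j : DAlg p) ⊗ₜ ((nice p).H j : DAlg p) := by
  rw [map_H p (Δ p) (tu (x p, x p)) (tu (g p, g p)) (Δ_x p) (Δ_g p), tu_pow, tu_inv, ← map_mul,
    tu_pow]
  rfl

theorem ε_x : ε p (x p) = 1 := lift_gen (counitGen p) (counit_rel p) .x
theorem ε_xInv : ε p (↑(x p)⁻¹ : DAlg p) = 1 := lift_gen (counitGen p) (counit_rel p) .xInv
theorem ε_g : ε p (g p) = 1 := lift_gen (counitGen p) (counit_rel p) .g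
theorem ε_y : ε p (y p) = 0 := lift_gen (counitGen p) (counit_rel p) .y
theorem ε_u (i : ZMod p.m) : ε p (u p i) = if i = 0 then 1 else 0 :=
  lift_gen (counitGen p) (counit_rel p) (.u i)
theorem ε_H (j : ZMod p.m) : ε p ((nice p).H j) = 1 := by
  rw [map_H p (ε p) 1 1 (by rw [ε_x]; rfl) (by rw [ε_g]; rfl)]; simp

theorem coassoc (a : Gen p.m) : Algebra.TensorProduct.assoc k k k _ _ _
      (Algebra.TensorProduct.map (Δ p) (.id k _) (comulGen p a)) =
    Algebra.TensorProduct.map (.id k _) (Δ p) (comulGen p a) := by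
  cases a with
  | x => simp [comulGen, Δ_x]
  | xInv => simp [comulGen, Δ_xInv]
  | g => simp [comulGen, Δ_g]
  | y =>
    simp only [comulGen, map_add, Algebra.TensorProduct.map_tmul, Δ_g, Δ_y, map_one, AlgHom.id_apply,
      TensorProduct.add_tmul, TensorProduct.tmul_add, Algebra.TensorProduct.assoc_tmul,
      Algebra.TensorProduct.one_def, add_assoc]
  | u i =>
    rw [comul_u]
    simp only [map_sum, map_smul, Algebra.TensorProduct.map_tmul, Δ_u, AlgHom.id_apply, map_mul,
      Δ_H, TensorProduct.sum_tmul, TensorProduct.tmul_sum, mul_sum, mul_smul_comm, tmul_mul_tmul,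
      ← TensorProduct.smul_tmul', TensorProduct.tmul_smul, Algebra.TensorProduct.assoc_tmul,
      smul_sum, smul_smul]
    rw [sum_comm]
    refine sum_congr rfl fun a _ => ?_
    rw [← Equiv.sum_comp (Equiv.addLeft a)]
    refine sum_congr rfl fun b _ => ?_
    simp only [Equiv.coe_addLeft, add_sub_cancel_left, ← AddChar.map_add_eq_mul]
    rw [show i - (a + b) = i - a - b by ring, (nice p).H_add, Units.val_mul, mul_assoc,
      show (a + b) * (i - a - b) + a * b = a * (i - a) + b * (i - a - b) by ring]

theorem counit_left (a : Gen p.m) :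
    Algebra.TensorProduct.map (ε p) (.id k _) (comulGen p a) = 1 ⊗ₜ gen p.Rel a := by
  cases a with
  | x => simp [comulGen, ε_x]; rfl
  | xInv => simp [comulGen, ε_x]; rfl
  | g => simp [comulGen, ε_g]; rfl
  | y => simp [comulGen, ε_y]; rfl
  | u i =>
    rw [comul_u, map_sum, sum_eq_single 0]
    · simp [ε_u, (nice p).H_zero]; rfl
    · intro j _ hj
      simp [ε_u, hj]
    · simp

theorem counit_right (a : Gen p.m) :
    Algebra.TensorProduct.map (.id k _) (ε p) (comulGen p a) = gen p.Rel a ⊗ₜ 1 := by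
  cases a with
  | x => simp [comulGen, ε_x]; rfl
  | xInv => simp [comulGen, ε_x]; rfl
  | g => simp [comulGen, ε_g]; rfl
  | y => simp [comulGen, ε_y, ε_g]; rfl
  | u i =>
    rw [comul_u, map_sum, sum_eq_single i]
    · simp [ε_u, ε_H]; rfl
    · intro j _ hj
      simp [ε_u, ε_H, sub_eq_zero, hj.symm]
    · simp

/-- The antipode as an algebra map to the opposite algebra. -/
def S : DAlg p →ₐ[k] (DAlg p)ᵐᵒᵖ := lift _ (antipode_rel p)

theorem S_gen (a : Gen p.m) : S p (gen p.Rel a) = MulOpposite.op (antipodeGen p a) :=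
  lift_gen _ (antipode_rel p) a

theorem S_x : S p (x p) = MulOpposite.op (↑(x p)⁻¹ : DAlg p) := S_gen p .x
theorem S_xInv : S p (↑(x p)⁻¹ : DAlg p) = MulOpposite.op (x p : DAlg p) := S_gen p .xInv
theorem S_g : S p (g p) = MulOpposite.op (↑(g p)⁻¹ : DAlg p) := S_gen p .g
theorem S_y : S p (y p) = MulOpposite.op (-(y p * (↑(g p)⁻¹ : DAlg p))) := S_gen p .y
theorem S_u (i : ZMod p.m) : S p (u p i) = MulOpposite.op ((nice p).Su i) := by
  rw [← antipode_u]; exact S_gen p (.u i)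

theorem S_H (j : ZMod p.m) : S p ((nice p).H j) = MulOpposite.op (↑((nice p).H j)⁻¹ : DAlg p) := by
  have e : (ou (x p)⁻¹ ^ p.d)⁻¹ * ou (g p)⁻¹ = ou (((x p ^ p.d)⁻¹ * g p)⁻¹) := by
    refine Units.ext ?_
    rw [ou_pow, ou_inv, Units.val_mul, ou_val, ou_val, ou_val, ← MulOpposite.op_mul, mul_inv_rev,
      inv_inv, Units.val_mul, inv_pow, inv_inv]
  rw [map_H p (S p) (ou (x p)⁻¹) (ou (g p)⁻¹) (S_x p) (S_g p), e, ou_pow, ou_val, Nice.H, Nice.h,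
    inv_pow]

theorem anti_left (a : Gen p.m) : LinearMap.mul' k _ ((antiLin (S p)).rTensor _ (comulGen p a)) =
    algebraMap k (DAlg p) (counitGen p a) := by
  cases a with
  | x => simp [comulGen, counitGen, S_x]
  | xInv => simp [comulGen, counitGen, S_xInv]
  | g => simp [comulGen, counitGen, S_g]
  | y => simp [comulGen, counitGen, S_y]
  | u i =>
    rw [comul_u]
    simp only [map_sum, map_smul, LinearMap.rTensor_tmul, LinearMap.mul'_apply]
    have e : ∀ j, antiLin (S p) (u p j) = (nice p).Su j := fun j =>
      congrArg MulOpposite.unop (S_u p j)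
    simp only [e]
    rw [(nice p).sum_left]
    simp only [counitGen]
    split_ifs <;> simp

theorem anti_right (a : Gen p.m) : LinearMap.mul' k _ ((antiLin (S p)).lTensor _ (comulGen p a)) =
    algebraMap k (DAlg p) (counitGen p a) := by
  cases a with
  | x => simp [comulGen, counitGen, S_x]
  | xInv => simp [comulGen, counitGen, S_xInv]
  | g => simp [comulGen, counitGen, S_g]
  | y => simp [comulGen, counitGen, S_y, S_g]
  | u i =>
    rw [comul_u]
    simp only [map_sum, map_smul, LinearMap.lTensor_tmul, LinearMap.mul'_apply]
    have e : ∀ j, antiLin (S p) ((nice p).H j * u p (i - j)) =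
        (nice p).Su (i - j) * (↑((nice p).H j)⁻¹ : DAlg p) := fun j => by
      have := congrArg MulOpposite.unop (map_mul (S p) ((nice p).H j : DAlg p) (u p (i - j)))
      rw [S_u, S_H] at this
      exact this
    simp only [e]
    rw [(nice p).sum_right]
    simp only [counitGen]
    split_ifs <;> simp

/-- The Hopf algebra `D(m, d, ξ)`. -/
instance : HopfAlgebra k (DAlg p) :=
  HopfPres.hopfAlgebra (comulGen p) (counitGen p) (antipodeGen p) (comul_rel p) (counit_rel p)
    (antipode_rel p) (coassoc p) (counit_left p) (counit_right p) (anti_left p) (anti_right p)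

end DAlg
end

/-! The other Hopf algebras: `k[x]`, infinite dimensional Taft algebras, generalized Liu algebras.
(For `k[x, x⁻¹]` and the group algebra of the infinite dihedral group `DihedralGroup 0`, the Hopf
algebra structures are those of the library.) -/

noncomputable section

namespace PolynomialHopf

open Polynomial

variable (k : Type*) [Field k]

/-- The polynomial algebra `k[x]` as a Hopf algebra with `x` primitive: `Δ(x) = x ⊗ 1 + 1 ⊗ x`,
`ε(x) = 0`. -/
instance : Bialgebra k k[X] :=
  Bialgebra.ofAlgHom (aeval ((X : k[X]) ⊗ₜ[k] 1 + 1 ⊗ₜ X)) (aeval 0)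
    (by
      ext
      simp [TensorProduct.add_tmul, TensorProduct.tmul_add, Algebra.TensorProduct.one_def, add_assoc])
    (by ext; simp)
    (by ext; simp)

/-- The antipode is given by `S(x) = -x`. -/
instance : HopfAlgebra k k[X] :=
  HopfAlgebra.ofAlgHom (aeval (-X)) 
    (by
      refine Polynomial.algHom_ext ?_
      change Algebra.TensorProduct.lift _ _ (fun _ _ => Commute.all _ _) (aeval ((X : k[X]) ⊗ₜ[k] 1 + 1 ⊗ₜ X) X) =
        algebraMap k k[X] (aeval (0 : k) (X : k[X]))
      simp)
    (by
      refine Polynomial.algHom_ext ?_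
      change Algebra.TensorProduct.lift _ _ (fun _ _ => Commute.all _ _) (aeval ((X : k[X]) ⊗ₜ[k] 1 + 1 ⊗ₜ X) X) =
        algebraMap k k[X] (aeval (0 : k) (X : k[X]))
      simp)

end PolynomialHopf

/-- The parameters `(n, t, ξ)` of an infinite dimensional Taft algebra: integers `n > 1` and
`0 ≤ t ≤ n - 1`, and a primitive `n`-th root of unity `ξ`. -/
structure TaftDatum (k : Type*) [Field k] where
  n : ℕ
  t : ℕ
  ξ : k
  one_lt : 1 < n
  t_le : t ≤ n - 1
  prim : IsPrimitiveRoot ξ n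

namespace TaftDatum

open FreeAlgebra (ι)

/-- The generators `g, x`. -/
inductive Gen : Type
  | g : Gen
  | x : Gen

/-- The defining relations of the Taft algebra `H(n, t, ξ)`. -/
inductive Rel {k : Type*} [Field k] (q : TaftDatum k) :
    FreeAlgebra k Gen → FreeAlgebra k Gen → Prop
  | g_pow : Rel q (ι k .g ^ q.n) 1
  | x_g : Rel q (ι k .x * ι k .g) (q.ξ • (ι k .g * ι k .x))

end TaftDatum

/-- The infinite dimensional Taft algebra `H(n, t, ξ)`. -/
abbrev TaftAlg {k : Type*} [Field k] (q : TaftDatum k) := HopfPres.Pres q.Rel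

namespace TaftAlg

open HopfPres TaftDatum
open Algebra.TensorProduct (tmul_mul_tmul)

variable {k : Type*} [Field k] (q : TaftDatum k)

theorem g_pow : (gen q.Rel .g) ^ q.n = 1 := by
  have := rel_eq (Rel.g_pow (q := q))
  simpa only [map_pow, map_one, FreeAlgebra.lift_ι_apply] using this

/-- `g` as a unit, with inverse `g^{n-1}`. -/
def g : (TaftAlg q)ˣ where
  val := gen q.Rel .g
  inv := gen q.Rel .g ^ (q.n - 1)
  val_inv := by rw [← pow_succ', Nat.sub_add_cancel q.one_lt.le, g_pow]
  inv_val := by rw [← pow_succ, Nat.sub_add_cancel q.one_lt.le, g_pow]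

/-- The generator `x`. -/
def x : TaftAlg q := gen q.Rel .x

theorem g_pow_n : (g q) ^ q.n = 1 := Units.ext (by rw [Units.val_pow_eq_pow_val]; exact g_pow q)

theorem x_g : x q * g q = q.ξ • ((g q : TaftAlg q) * x q) := by
  have := rel_eq (Rel.x_g (q := q))
  simp only [map_mul, map_smul, FreeAlgebra.lift_ι_apply] at this
  exact this

theorem ginv_x : (↑(g q)⁻¹ : TaftAlg q) * x q = q.ξ • (x q * (↑(g q)⁻¹ : TaftAlg q)) := by
  rw [Units.inv_mul_eq_iff_eq_mul, mul_smul_comm, ← mul_assoc, ← smul_mul_assoc, ← x_g,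
    Units.mul_inv_cancel_right]

/-- The comultiplication on the generators. -/
def comulGen : Gen → TaftAlg q ⊗[k] TaftAlg q
  | .g => (g q : TaftAlg q) ⊗ₜ (g q : TaftAlg q)
  | .x => x q ⊗ₜ ((g q : TaftAlg q) ^ q.t) + 1 ⊗ₜ x q

/-- The counit on the generators. -/
def counitGen : Gen → k
  | .g => 1
  | .x => 0

/-- The antipode on the generators. -/
def antipodeGen : Gen → TaftAlg q
  | .g => (↑(g q)⁻¹ : TaftAlg q)
  | .x => -(x q * (↑(g q)⁻¹ : TaftAlg q) ^ q.t)

theorem comul_rel ⦃a b : FreeAlgebra k Gen⦄ (h : q.Rel a b) :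
    FreeAlgebra.lift k (comulGen q) a = FreeAlgebra.lift k (comulGen q) b := by
  cases h with
  | g_pow =>
    simp only [map_pow, map_one, FreeAlgebra.lift_ι_apply, comulGen, Algebra.TensorProduct.tmul_pow,
      ← Units.val_pow_eq_pow_val, g_pow_n]
    rfl
  | x_g =>
    simp only [map_mul, map_smul, FreeAlgebra.lift_ι_apply, comulGen, add_mul, mul_add,
      tmul_mul_tmul, x_g, one_mul, mul_one, smul_add, TensorProduct.tmul_smul,
      ← TensorProduct.smul_tmul', ← pow_succ, ← pow_succ']

theorem counit_rel ⦃a b : FreeAlgebra k Gen⦄ (h : q.Rel a b) :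
    FreeAlgebra.lift k (counitGen (k := k)) a = FreeAlgebra.lift k counitGen b := by
  cases h <;> simp [counitGen]

theorem antipode_rel ⦃a b : FreeAlgebra k Gen⦄ (h : q.Rel a b) :
    FreeAlgebra.lift k (fun c => MulOpposite.op (antipodeGen q c)) a =
      FreeAlgebra.lift k (fun c => MulOpposite.op (antipodeGen q c)) b := by
  cases h with
  | g_pow =>
    simp only [map_pow, map_one, FreeAlgebra.lift_ι_apply, antipodeGen, ← MulOpposite.op_pow,
      ← Units.val_pow_eq_pow_val, inv_pow, g_pow_n]
    simp
  | x_g =>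
    simp only [map_mul, map_smul, FreeAlgebra.lift_ι_apply, antipodeGen, ← MulOpposite.op_mul,
      ← MulOpposite.op_smul, mul_neg, neg_mul, ← mul_assoc, ginv_x, smul_mul_assoc, smul_neg]
    simp only [mul_assoc, ← pow_succ, ← pow_succ']

/-- The comultiplication as an algebra map. -/
def Δ : TaftAlg q →ₐ[k] TaftAlg q ⊗[k] TaftAlg q := lift (comulGen q) (comul_rel q)

/-- The counit as an algebra map. -/
def ε : TaftAlg q →ₐ[k] k := lift counitGen (counit_rel q)

/-- The antipode as an algebra map to the opposite algebra. -/
def S : TaftAlg q →ₐ[k] (TaftAlg q)ᵐᵒᵖ := lift _ (antipode_rel q)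

theorem Δ_g : Δ q (g q) = (g q : TaftAlg q) ⊗ₜ (g q : TaftAlg q) :=
  lift_gen (comulGen q) (comul_rel q) .g
theorem Δ_x : Δ q (x q) = x q ⊗ₜ ((g q : TaftAlg q) ^ q.t) + 1 ⊗ₜ x q :=
  lift_gen (comulGen q) (comul_rel q) .x
theorem ε_g : ε q (g q) = 1 := lift_gen counitGen (counit_rel q) .g
theorem ε_x : ε q (x q) = 0 := lift_gen counitGen (counit_rel q) .x
theorem S_g : S q (g q) = MulOpposite.op (↑(g q)⁻¹ : TaftAlg q) := lift_gen _ (antipode_rel q) .g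
theorem S_x : S q (x q) = MulOpposite.op (-(x q * (↑(g q)⁻¹ : TaftAlg q) ^ q.t)) :=
  lift_gen _ (antipode_rel q) .x

theorem coassoc (a : Gen) : Algebra.TensorProduct.assoc k k k _ _ _
      (Algebra.TensorProduct.map (Δ q) (.id k _) (comulGen q a)) =
    Algebra.TensorProduct.map (.id k _) (Δ q) (comulGen q a) := by
  cases a with
  | g => simp [comulGen, Δ_g]
  | x =>
    simp only [comulGen, map_add, Algebra.TensorProduct.map_tmul, map_pow, Δ_g, Δ_x, map_one,
      AlgHom.id_apply, TensorProduct.add_tmul, TensorProduct.tmul_add, Algebra.TensorProduct.tmul_pow,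
      Algebra.TensorProduct.assoc_tmul, Algebra.TensorProduct.one_def, add_assoc]

theorem counit_left (a : Gen) :
    Algebra.TensorProduct.map (ε q) (.id k _) (comulGen q a) = 1 ⊗ₜ gen q.Rel a := by
  cases a with
  | g => simp [comulGen, ε_g]; rfl
  | x => simp [comulGen, ε_x]; rfl

theorem counit_right (a : Gen) :
    Algebra.TensorProduct.map (.id k _) (ε q) (comulGen q a) = gen q.Rel a ⊗ₜ 1 := by
  cases a with
  | g => simp [comulGen, ε_g]; rfl
  | x => simp [comulGen, ε_x, ε_g]; rfl

theorem anti_left (a : Gen) : LinearMap.mul' k _ ((antiLin (S q)).rTensor _ (comulGen q a)) =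
    algebraMap k (TaftAlg q) (counitGen a) := by
  cases a with
  | g => simp [comulGen, counitGen, S_g]
  | x =>
    have e : (↑(g q)⁻¹ : TaftAlg q) ^ q.t * (g q : TaftAlg q) ^ q.t = 1 := by
      rw [← Units.val_pow_eq_pow_val, ← Units.val_pow_eq_pow_val, inv_pow, Units.inv_mul]
    simp only [comulGen, counitGen, map_add, LinearMap.rTensor_tmul, LinearMap.mul'_apply,
      LinearMap.comp_apply, AlgHom.toLinearMap_apply, S_x, map_one, map_zero]
    simp [mul_assoc, e]

theorem anti_right (a : Gen) : LinearMap.mul' k _ ((antiLin (S q)).lTensor _ (comulGen q a)) =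
    algebraMap k (TaftAlg q) (counitGen a) := by
  cases a with
  | g => simp [comulGen, counitGen, S_g]
  | x => simp [comulGen, counitGen, S_x, S_g]

/-- The Hopf algebra `H(n, t, ξ)`. -/
instance : HopfAlgebra k (TaftAlg q) :=
  HopfPres.hopfAlgebra (comulGen q) counitGen (antipodeGen q) (comul_rel q) (counit_rel q)
    (antipode_rel q) (coassoc q) (counit_left q) (counit_right q) (anti_left q) (anti_right q)

end TaftAlg

/-- The parameters `(n, ω, γ)` of a generalized Liu algebra: positive integers `n`, `ω`, and a
primitive `n`-th root of unity `γ`. -/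
structure LiuDatum (k : Type*) [Field k] where
  n : ℕ
  ω : ℕ
  γ : k
  n_pos : 0 < n
  ω_pos : 0 < ω
  prim : IsPrimitiveRoot γ n

namespace LiuDatum

open FreeAlgebra (ι)

/-- The generators `x, x⁻¹, g, y`. -/
inductive Gen : Type
  | x : Gen
  | xInv : Gen
  | g : Gen
  | y : Gen

/-- The defining relations of the generalized Liu algebra `B(n, ω, γ)`. -/
inductive Rel {k : Type*} [Field k] (q : LiuDatum k) :
    FreeAlgebra k Gen → FreeAlgebra k Gen → Prop
  | x_xInv : Rel q (ι k .x * ι k .xInv) 1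
  | xInv_x : Rel q (ι k .xInv * ι k .x) 1
  | x_g : Rel q (ι k .x * ι k .g) (ι k .g * ι k .x)
  | x_y : Rel q (ι k .x * ι k .y) (ι k .y * ι k .x)
  | y_g : Rel q (ι k .y * ι k .g) (q.γ • (ι k .g * ι k .y))
  | y_pow : Rel q (ι k .y ^ q.n) (1 - ι k .x ^ q.ω)
  | g_pow : Rel q (1 - ι k .x ^ q.ω) (1 - ι k .g ^ q.n)

end LiuDatum

/-- The generalized Liu algebra `B(n, ω, γ)`. -/
abbrev LiuAlg {k : Type*} [Field k] (q : LiuDatum k) := HopfPres.Pres q.Rel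

namespace LiuAlg

open HopfPres LiuDatum QComb
open Algebra.TensorProduct (tmul_mul_tmul)

variable {k : Type*} [Field k] (q : LiuDatum k)

/-- `x` as a unit. -/
def x : (LiuAlg q)ˣ where
  val := gen q.Rel .x
  inv := gen q.Rel .xInv
  val_inv := by simpa using rel_eq (Rel.x_xInv (q := q))
  inv_val := by simpa using rel_eq (Rel.xInv_x (q := q))

/-- The generator `y`. -/
def y : LiuAlg q := gen q.Rel .y

theorem g_pow : (gen q.Rel .g) ^ q.n = (↑(x q ^ q.ω) : LiuAlg q) := by
  have := rel_eq (Rel.g_pow (q := q))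
  simp only [map_sub, map_one, map_pow, FreeAlgebra.lift_ι_apply, sub_right_inj] at this
  rw [← this, Units.val_pow_eq_pow_val]
  rfl

theorem x_g' : (x q : LiuAlg q) * gen q.Rel .g = gen q.Rel .g * x q := by
  have := rel_eq (Rel.x_g (q := q))
  simp only [map_mul, FreeAlgebra.lift_ι_apply] at this
  exact this

/-- `g` as a unit, with inverse `x^{-ω} g^{n-1}`. -/
def g : (LiuAlg q)ˣ where
  val := gen q.Rel .g
  inv := (↑(x q ^ q.ω)⁻¹ : LiuAlg q) * gen q.Rel .g ^ (q.n - 1)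
  val_inv := by
    have h : Commute (gen q.Rel .g) (↑(x q ^ q.ω) : LiuAlg q) := by
      rw [Units.val_pow_eq_pow_val]
      exact Commute.pow_right (x_g' q).symm _
    rw [← mul_assoc, h.units_inv_right.eq, mul_assoc, ← pow_succ', Nat.sub_add_cancel q.n_pos,
      g_pow, Units.inv_mul]
  inv_val := by
    rw [mul_assoc, ← pow_succ, Nat.sub_add_cancel q.n_pos, g_pow, Units.inv_mul]

theorem x_g : x q * g q = g q * x q := Units.ext (x_g' q)

theorem g_pow_n : (g q) ^ q.n = x q ^ q.ω :=
  Units.ext (by rw [Units.val_pow_eq_pow_val]; exact g_pow q)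

theorem x_y : (x q : LiuAlg q) * y q = y q * x q := by
  have := rel_eq (Rel.x_y (q := q))
  simp only [map_mul, FreeAlgebra.lift_ι_apply] at this
  exact this

theorem y_g : y q * g q = q.γ • ((g q : LiuAlg q) * y q) := by
  have := rel_eq (Rel.y_g (q := q))
  simp only [map_mul, map_smul, FreeAlgebra.lift_ι_apply] at this
  exact this

theorem y_pow : y q ^ q.n = 1 - (x q : LiuAlg q) ^ q.ω := by
  have := rel_eq (Rel.y_pow (q := q))
  simp only [map_sub, map_one, map_pow, FreeAlgebra.lift_ι_apply] at this
  exact this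

theorem ginv_y : (↑(g q)⁻¹ : LiuAlg q) * y q = q.γ • (y q * (↑(g q)⁻¹ : LiuAlg q)) := by
  rw [Units.inv_mul_eq_iff_eq_mul, mul_smul_comm, ← mul_assoc, ← smul_mul_assoc, ← y_g,
    Units.mul_inv_cancel_right]

theorem xinv_y : (↑(x q)⁻¹ : LiuAlg q) * y q = y q * (↑(x q)⁻¹ : LiuAlg q) :=
  (Commute.units_inv_left (x_y q) :)

/-- The comultiplication on the generators. -/
def comulGen : Gen → LiuAlg q ⊗[k] LiuAlg q
  | .x => (x q : LiuAlg q) ⊗ₜ (x q : LiuAlg q)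
  | .xInv => (↑(x q)⁻¹ : LiuAlg q) ⊗ₜ (↑(x q)⁻¹ : LiuAlg q)
  | .g => (g q : LiuAlg q) ⊗ₜ (g q : LiuAlg q)
  | .y => y q ⊗ₜ (g q : LiuAlg q) + 1 ⊗ₜ y q

/-- The counit on the generators. -/
def counitGen : Gen → k
  | .x => 1
  | .xInv => 1
  | .g => 1
  | .y => 0

/-- The antipode on the generators. -/
def antipodeGen : Gen → LiuAlg q
  | .x => (↑(x q)⁻¹ : LiuAlg q)
  | .xInv => x q
  | .g => (↑(g q)⁻¹ : LiuAlg q)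
  | .y => -(y q * (↑(g q)⁻¹ : LiuAlg q))

theorem xg_val : (x q : LiuAlg q) * g q = g q * x q := congrArg Units.val (x_g q)

theorem comul_rel ⦃a b : FreeAlgebra k Gen⦄ (h : q.Rel a b) :
    FreeAlgebra.lift k (comulGen q) a = FreeAlgebra.lift k (comulGen q) b := by
  cases h with
  | x_xInv => simp [comulGen, Algebra.TensorProduct.one_def]
  | xInv_x => simp [comulGen, Algebra.TensorProduct.one_def]
  | x_g =>
    simp only [map_mul, FreeAlgebra.lift_ι_apply, comulGen, tmul_mul_tmul, xg_val]
  | x_y =>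
    simp only [map_mul, FreeAlgebra.lift_ι_apply, comulGen, tmul_mul_tmul, xg_val, x_y, mul_add,
      add_mul, one_mul, mul_one]
  | y_g =>
    simp only [map_mul, map_smul, FreeAlgebra.lift_ι_apply, comulGen, add_mul, mul_add,
      tmul_mul_tmul, y_g, one_mul, mul_one, smul_add, TensorProduct.tmul_smul,
      ← TensorProduct.smul_tmul']
  | y_pow =>
    simp only [map_sub, map_one, map_pow, FreeAlgebra.lift_ι_apply, comulGen]
    rw [add_pow_root q.prim q.n_pos, Algebra.TensorProduct.tmul_pow, Algebra.TensorProduct.tmul_pow,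
      Algebra.TensorProduct.tmul_pow, y_pow, one_pow, ← Units.val_pow_eq_pow_val,
      ← Units.val_pow_eq_pow_val, g_pow_n,
      TensorProduct.sub_tmul, TensorProduct.tmul_sub, Algebra.TensorProduct.one_def]
    · abel
    · rw [tmul_mul_tmul, tmul_mul_tmul, y_g, one_mul, mul_one, TensorProduct.tmul_smul]
  | g_pow =>
    simp only [map_sub, map_one, map_pow, FreeAlgebra.lift_ι_apply, comulGen,
      Algebra.TensorProduct.tmul_pow, ← Units.val_pow_eq_pow_val, g_pow_n]

theorem counit_rel ⦃a b : FreeAlgebra k Gen⦄ (h : q.Rel a b) :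
    FreeAlgebra.lift k (counitGen (k := k)) a = FreeAlgebra.lift k counitGen b := by
  have := q.n_pos.ne'
  cases h <;> simp [counitGen, this]

theorem ginv_y_pow (j : ℕ) : (↑(g q)⁻¹ : LiuAlg q) ^ j * y q =
    q.γ ^ j • (y q * (↑(g q)⁻¹ : LiuAlg q) ^ j) := by
  induction j with
  | zero => simp
  | succ j ih =>
    rw [pow_succ, mul_assoc, ginv_y, mul_smul_comm, ← mul_assoc, ih, smul_mul_assoc, smul_smul,
      mul_assoc, ← pow_succ, ← pow_succ']

theorem y_ginv_pow (j : ℕ) : (-(y q * (↑(g q)⁻¹ : LiuAlg q))) ^ j =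
    qc q.γ j • (y q ^ j * (↑(g q)⁻¹ : LiuAlg q) ^ j) := by
  induction j with
  | zero => simp [qc]
  | succ j ih =>
    rw [pow_succ, ih, qc_succ, smul_mul_assoc, mul_neg, mul_neg, neg_smul, smul_neg, mul_smul,
      mul_assoc, ← mul_assoc (_ ^ j) (y q), ginv_y_pow, smul_mul_assoc, mul_smul_comm, mul_assoc,
      ← pow_succ, ← mul_assoc, ← pow_succ]

theorem antipode_rel ⦃a b : FreeAlgebra k Gen⦄ (h : q.Rel a b) :
    FreeAlgebra.lift k (fun c => MulOpposite.op (antipodeGen q c)) a =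
      FreeAlgebra.lift k (fun c => MulOpposite.op (antipodeGen q c)) b := by
  have gx : (↑(g q)⁻¹ : LiuAlg q) * (↑(x q)⁻¹ : LiuAlg q) = ↑(x q)⁻¹ * (↑(g q)⁻¹ : LiuAlg q) := by
    rw [← Units.val_mul, ← Units.val_mul, ← mul_inv_rev, ← mul_inv_rev, x_g]
  cases h with
  | x_xInv => simp [antipodeGen, ← MulOpposite.op_mul]
  | xInv_x => simp [antipodeGen, ← MulOpposite.op_mul]
  | x_g =>
    simp only [map_mul, FreeAlgebra.lift_ι_apply, antipodeGen, ← MulOpposite.op_mul, gx]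
  | x_y =>
    simp only [map_mul, FreeAlgebra.lift_ι_apply, antipodeGen, ← MulOpposite.op_mul, neg_mul,
      mul_neg, mul_assoc, gx]
    simp only [← mul_assoc, xinv_y]
  | y_g =>
    simp only [map_mul, map_smul, FreeAlgebra.lift_ι_apply, antipodeGen, ← MulOpposite.op_mul,
      ← MulOpposite.op_smul, mul_neg, neg_mul, ← mul_assoc, ginv_y, smul_mul_assoc, smul_neg]
  | y_pow =>
    simp only [map_sub, map_one, map_pow, FreeAlgebra.lift_ι_apply, antipodeGen,
      ← MulOpposite.op_pow, y_ginv_pow, qc_root q.prim q.n_pos, y_pow, ← Units.val_pow_eq_pow_val,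
      inv_pow, g_pow_n, sub_mul, one_mul, Units.mul_inv, neg_smul, one_smul, neg_sub,
      MulOpposite.op_sub, MulOpposite.op_one]
  | g_pow =>
    simp only [map_sub, map_one, map_pow, FreeAlgebra.lift_ι_apply, antipodeGen,
      ← MulOpposite.op_pow, ← Units.val_pow_eq_pow_val, inv_pow, g_pow_n]

/-- The comultiplication as an algebra map. -/
def Δ : LiuAlg q →ₐ[k] LiuAlg q ⊗[k] LiuAlg q := lift (comulGen q) (comul_rel q)

/-- The counit as an algebra map. -/
def ε : LiuAlg q →ₐ[k] k := lift counitGen (counit_rel q)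

/-- The antipode as an algebra map to the opposite algebra. -/
def S : LiuAlg q →ₐ[k] (LiuAlg q)ᵐᵒᵖ := lift _ (antipode_rel q)

theorem Δ_x : Δ q (x q) = (x q : LiuAlg q) ⊗ₜ (x q : LiuAlg q) :=
  lift_gen (comulGen q) (comul_rel q) .x
theorem Δ_xInv : Δ q (↑(x q)⁻¹ : LiuAlg q) = (↑(x q)⁻¹ : LiuAlg q) ⊗ₜ (↑(x q)⁻¹ : LiuAlg q) :=
  lift_gen (comulGen q) (comul_rel q) .xInv
theorem Δ_g : Δ q (g q) = (g q : LiuAlg q) ⊗ₜ (g q : LiuAlg q) :=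
  lift_gen (comulGen q) (comul_rel q) .g
theorem Δ_y : Δ q (y q) = y q ⊗ₜ (g q : LiuAlg q) + 1 ⊗ₜ y q :=
  lift_gen (comulGen q) (comul_rel q) .y
theorem ε_x : ε q (x q) = 1 := lift_gen counitGen (counit_rel q) .x
theorem ε_g : ε q (g q) = 1 := lift_gen counitGen (counit_rel q) .g
theorem ε_y : ε q (y q) = 0 := lift_gen counitGen (counit_rel q) .y
theorem S_x : S q (x q) = MulOpposite.op (↑(x q)⁻¹ : LiuAlg q) := lift_gen _ (antipode_rel q) .x
theorem S_xInv : S q (↑(x q)⁻¹ : LiuAlg q) = MulOpposite.op (x q : LiuAlg q) :=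
  lift_gen _ (antipode_rel q) .xInv
theorem S_g : S q (g q) = MulOpposite.op (↑(g q)⁻¹ : LiuAlg q) := lift_gen _ (antipode_rel q) .g
theorem S_y : S q (y q) = MulOpposite.op (-(y q * (↑(g q)⁻¹ : LiuAlg q))) :=
  lift_gen _ (antipode_rel q) .y

theorem coassoc (a : Gen) : Algebra.TensorProduct.assoc k k k _ _ _
      (Algebra.TensorProduct.map (Δ q) (.id k _) (comulGen q a)) =
    Algebra.TensorProduct.map (.id k _) (Δ q) (comulGen q a) := by
  cases a with
  | x => simp [comulGen, Δ_x]
  | xInv => simp [comulGen, Δ_xInv]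
  | g => simp [comulGen, Δ_g]
  | y =>
    simp only [comulGen, map_add, Algebra.TensorProduct.map_tmul, Δ_g, Δ_y, map_one,
      AlgHom.id_apply, TensorProduct.add_tmul, TensorProduct.tmul_add,
      Algebra.TensorProduct.assoc_tmul, Algebra.TensorProduct.one_def, add_assoc]

theorem counit_left (a : Gen) :
    Algebra.TensorProduct.map (ε q) (.id k _) (comulGen q a) = 1 ⊗ₜ gen q.Rel a := by
  cases a with
  | x => simp [comulGen, ε_x]; rfl
  | xInv => simp [comulGen, ε_x]; rfl
  | g => simp [comulGen, ε_g]; rfl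
  | y => simp [comulGen, ε_y]; rfl

theorem counit_right (a : Gen) :
    Algebra.TensorProduct.map (.id k _) (ε q) (comulGen q a) = gen q.Rel a ⊗ₜ 1 := by
  cases a with
  | x => simp [comulGen, ε_x]; rfl
  | xInv => simp [comulGen, ε_x]; rfl
  | g => simp [comulGen, ε_g]; rfl
  | y => simp [comulGen, ε_y, ε_g]; rfl

theorem anti_left (a : Gen) : LinearMap.mul' k _ ((antiLin (S q)).rTensor _ (comulGen q a)) =
    algebraMap k (LiuAlg q) (counitGen a) := by
  cases a with
  | x => simp [comulGen, counitGen, S_x]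
  | xInv => simp [comulGen, counitGen, S_xInv]
  | g => simp [comulGen, counitGen, S_g]
  | y => simp [comulGen, counitGen, S_y]

theorem anti_right (a : Gen) : LinearMap.mul' k _ ((antiLin (S q)).lTensor _ (comulGen q a)) =
    algebraMap k (LiuAlg q) (counitGen a) := by
  cases a with
  | x => simp [comulGen, counitGen, S_x]
  | xInv => simp [comulGen, counitGen, S_xInv]
  | g => simp [comulGen, counitGen, S_g]
  | y => simp [comulGen, counitGen, S_y, S_g]

/-- The Hopf algebra `B(n, ω, γ)`. -/
instance : HopfAlgebra k (LiuAlg q) :=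
  HopfPres.hopfAlgebra (comulGen q) counitGen (antipodeGen q) (comul_rel q) (counit_rel q)
    (antipode_rel q) (coassoc q) (counit_left q) (counit_right q) (anti_left q) (anti_right q)

end LiuAlg
end

/-! The obstruction is purely coalgebraic. The dual of a coalgebra $C$ is an algebra under
convolution, and it acts on $C$ by $c\mapsto c_{(1)}v(c_{(2)})$. If $C$ is built from group-like
elements by adjoining skew primitives, the simple pieces of $C$ are one-dimensional, so a commutator
$v=f*g-g*f$ vanishes on them and should act locally nilpotently. If $C$ contains a matrix coalgebra
of size at least two, its dual is a noncommutative matrix algebra, where commutators can be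
invertible. `LocallyNilpotent` separates the two situations and is invariant under coalgebra
isomorphism (`LocallyNilpotent.of_equiv`). Hence $D(m,d,\xi)$ is not isomorphic to the other
algebras even as a coalgebra.

All the comparison algebras are covered by `locallyNilpotent_of_adjoin`. They are generated by
group-likes that commute with one skew primitive element $y$ up to scalars, where
$\Delta(y)=y\otimes g+1\otimes y$. Filter by degree in $y$. By `act_mul`, every functional preserves
the filtration. A functional that vanishes on the group-likes in degree $0$ lowers the degree by one
and kills degree $0$ (`act_mem_filt_pred`). Algebras spanned by group-likes are the case $y=0$.

In $D(m,d,\xi)$ put $h=x^{-d}g$ and $H_j=h^j$ for $j$ modulo $m$. The comultiplication of $H_ju_i$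
shows that, up to scalars, this element is the matrix coordinate in position $(j,j+i)$ of an
$m\times m$ matrix coalgebra. Two functionals give the required commutator. A character of the
algebra is diagonal in this picture, with entries $\gamma^j\xi$. A matrix coefficient of a
two-dimensional representation is a cyclic shift, nonzero only in the positions $(j,j+1)$. Such
matrices commute up to the factor $\gamma$, so their commutator is again an invertible shift,
because $\gamma\ne1$ (`convComm_H_mul_u`). It sends $u_i$ to a nonzero multiple of $u_{i-1}$
(`act_convComm_u`), and its $m$-th power returns $u_0$ to a nonzero multiple of itself. Since
$\epsilon(u_0)=1$, the action is not locally nilpotent (`not_locallyNilpotent`). -/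

noncomputable section

namespace CommutatorAction

/-! ### Convolution commutators acting on a coalgebra. -/

section coalgebra
variable {k C D : Type*} [Field k] [AddCommGroup C] [Module k C] [Coalgebra k C]
  [AddCommGroup D] [Module k D] [Coalgebra k D]

/-- The action `c ↦ c₍₁₎ v(c₍₂₎)` of a functional `v` on a coalgebra. -/
def act (v : C →ₗ[k] k) : C →ₗ[k] C :=
  (TensorProduct.rid k C).toLinearMap ∘ₗ v.lTensor C ∘ₗ Coalgebra.comul

/-- The commutator of two functionals in the convolution algebra. -/
def convComm (f g : C →ₗ[k] k) : C →ₗ[k] k :=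
  LinearMap.mul' k k ∘ₗ (TensorProduct.map f g - TensorProduct.map g f) ∘ₗ Coalgebra.comul

/-- Commutators of functionals act locally nilpotently on the coalgebra. -/
def LocallyNilpotent (k C : Type*) [Field k] [AddCommGroup C] [Module k C] [Coalgebra k C] : Prop :=
  ∀ (f g : C →ₗ[k] k) (c : C), ∃ N, ∀ n ≥ N, (act (convComm f g) ^ n) c = 0

/-- Both convolution products take the value $f(s)g(s)$, as $k$ is commutative. This is the only
property of commutators used to prove nilpotency. -/
theorem convComm_groupLike (f g : C →ₗ[k] k) {s : C} (hs : IsGroupLikeElem k s) : convComm f g s = 0 := by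
  simp [convComm, hs.comul_eq_tmul_self, mul_comm]

theorem act_groupLike (v : C →ₗ[k] k) {s : C} (hs : IsGroupLikeElem k s) : act v s = v s • s := by
  simp [act, hs.comul_eq_tmul_self]

theorem convComm_comp (φ : C ≃ₗc[k] D) (f g : D →ₗ[k] k) (c : C) :
    convComm f g (φ c) = convComm (f ∘ₗ (φ : C →ₗ[k] D)) (g ∘ₗ (φ : C →ₗ[k] D)) c := by
  simp only [convComm, LinearMap.comp_apply, ← CoalgHomClass.map_comp_comul_apply φ c,
    LinearMap.sub_apply, TensorProduct.map_map]
  rfl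

/-- Naturality of the action: since $\Delta\varphi=(\varphi\otimes\varphi)\Delta$, applying $v$ to
the second leg on $D$ amounts to applying $v\circ\varphi$ to the second leg on $C$. -/
theorem act_comp (φ : C ≃ₗc[k] D) (v : D →ₗ[k] k) (c : C) :
    act v (φ c) = φ (act (v ∘ₗ (φ : C →ₗ[k] D)) c) := by
  simp only [act, LinearMap.comp_apply, ← CoalgHomClass.map_comp_comul_apply φ c]
  generalize (Coalgebra.comul c : C ⊗[k] C) = z
  induction z with
  | zero => simp
  | tmul a b => simp
  | add a b ha hb => simp only [map_add, ha, hb]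

/-- Functionals on $C$ are transported to $D$ along $\varphi^{-1}$. The commutator action on $C$ is
then conjugate by $\varphi$ to the one on $D$. -/
theorem LocallyNilpotent.of_equiv (h : LocallyNilpotent k D) (φ : C ≃ₗc[k] D) :
    LocallyNilpotent k C := by
  intro f g c
  set f' : D →ₗ[k] k := f ∘ₗ (φ.symm : D →ₗ[k] C)
  set g' : D →ₗ[k] k := g ∘ₗ (φ.symm : D →ₗ[k] C)
  have hf : f' ∘ₗ (φ : C →ₗ[k] D) = f := by ext c; simp [f']
  have hg : g' ∘ₗ (φ : C →ₗ[k] D) = g := by ext c; simp [g']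
  have hw : convComm f' g' ∘ₗ (φ : C →ₗ[k] D) = convComm f g := by
    ext c
    have := convComm_comp φ f' g' c
    rw [hf, hg] at this
    exact this
  have hn : ∀ n c, (act (convComm f' g') ^ n) (φ c) = φ ((act (convComm f g) ^ n) c) := by
    intro n
    induction n with
    | zero => simp
    | succ n ih =>
      intro c
      rw [pow_succ, pow_succ, Module.End.mul_apply, Module.End.mul_apply, act_comp, ih, hw]
  obtain ⟨N, hN⟩ := h f' g' (φ c)
  refine ⟨N, fun n hnN => ?_⟩
  have := hN n hnN
  rw [hn] at this
  -- The power vanishes after applying $\varphi$, hence already in $C$.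
  exact (EquivLike.injective φ) (this.trans (map_zero φ).symm)

end coalgebra

/-! ### The filtration by degree in a skew primitive element. -/

section bialgebra
variable {k B : Type*} [Field k] [Ring B] [Bialgebra k B]

/-- The group-like elements which commute with `y` up to a scalar. -/
def quasiCommuting (k : Type*) {B : Type*} [Field k] [Ring B] [Bialgebra k B] (y : B) : Set B :=
  {s | IsGroupLikeElem k s ∧ ∃ r : k, s * y = r • (y * s)}

theorem one_mem_quasiCommuting (y : B) : 1 ∈ quasiCommuting k y :=
  ⟨IsGroupLikeElem.one, 1, by simp⟩

theorem mul_mem_quasiCommuting {y s t : B} (hs : s ∈ quasiCommuting k y)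
    (ht : t ∈ quasiCommuting k y) : s * t ∈ quasiCommuting k y := by
  obtain ⟨hs, r, hr⟩ := hs
  obtain ⟨ht, q, hq⟩ := ht
  refine ⟨hs.mul ht, q * r, ?_⟩
  rw [mul_assoc, hq, mul_smul_comm, ← mul_assoc, hr, smul_mul_assoc, smul_smul, mul_assoc]

/-- The filtration by the degree in `y`. -/
def filt (k : Type*) {B : Type*} [Field k] [Ring B] [Bialgebra k B] (y : B) : ℕ → Submodule k B
  | 0 => Submodule.span k (quasiCommuting k y)
  | n + 1 => filt k y n ⊔ (filt k y n).map (LinearMap.mulLeft k y)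

variable {y : B}

theorem filt_mono : Monotone (filt k y) := monotone_nat_of_le_succ fun _ => le_sup_left

/-- The induction principle for the filtration: to control degree $n+1$, it is enough to treat $b$
and $yb$ for $b$ of degree $n$. -/
theorem filt_succ_le {n : ℕ} {P : Submodule k B} (h1 : filt k y n ≤ P)
    (h2 : ∀ b ∈ filt k y n, y * b ∈ P) : filt k y (n + 1) ≤ P :=
  sup_le h1 (Submodule.map_le_iff_le_comap.2 h2)

theorem mul_mem_filt {n : ℕ} {b : B} (hb : b ∈ filt k y n) : y * b ∈ filt k y (n + 1) :=
  Submodule.mem_sup_right ⟨b, hb, rfl⟩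

/-- A group-like $s$ passes a factor $y$ at the cost of a scalar, $s(yb)=r\,y(sb)$, so it travels
down to degree $0$, where the spanning set is closed under multiplication. -/
theorem quasiCommuting_mul_mem_filt {s : B} (hs : s ∈ quasiCommuting k y) (n : ℕ) :
    ∀ b ∈ filt k y n, s * b ∈ filt k y n := by
  induction n with
  | zero =>
    intro b hb
    refine (Submodule.span_le (p := (filt k y 0).comap (LinearMap.mulLeft k s))).2 ?_ hb
    intro t ht
    exact Submodule.subset_span (mul_mem_quasiCommuting hs ht)
  | succ n ih =>
    refine filt_succ_le (P := (filt k y (n + 1)).comap (LinearMap.mulLeft k s))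
      (fun b hb => filt_mono n.le_succ (ih b hb)) fun b hb => ?_
    obtain ⟨-, r, hr⟩ := hs
    change s * (y * b) ∈ filt k y (n + 1)
    rw [← mul_assoc, hr, smul_mul_assoc, mul_assoc]
    exact Submodule.smul_mem _ _ (mul_mem_filt (ih b hb))

/-- The union of the filtration contains $1$ and is stable under left multiplication by the
generators, hence by the whole algebra. -/
theorem exists_mem_filt (h : Algebra.adjoin k (insert y (quasiCommuting k y)) = ⊤) (b : B) :
    ∃ n, b ∈ filt k y n := by
  -- Exhaustion is stated as stability under left multiplication by $b$, because this form passes to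
  -- products in the induction over the adjoined algebra. The case $c=1$ gives the claim.
  suffices ∀ n, ∀ c ∈ filt k y n, ∃ n', b * c ∈ filt k y n' by
    simpa using this 0 1 (Submodule.subset_span (one_mem_quasiCommuting y))
  have hb : b ∈ Algebra.adjoin k (insert y (quasiCommuting k y)) := h ▸ Algebra.mem_top
  induction hb using Algebra.adjoin_induction with
  | mem s hs =>
    rcases hs with rfl | hs
    · exact fun n c hc => ⟨_, mul_mem_filt hc⟩
    · exact fun n c hc => ⟨n, quasiCommuting_mul_mem_filt hs n c hc⟩
  | algebraMap r =>
    intro n c hc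
    refine ⟨n, ?_⟩
    rw [← Algebra.smul_def]
    exact Submodule.smul_mem _ _ hc
  | add a b _ _ ha hb =>
    intro n c hc
    obtain ⟨n1, h1⟩ := ha n c hc
    obtain ⟨n2, h2⟩ := hb n c hc
    refine ⟨max n1 n2, ?_⟩
    rw [add_mul]
    exact add_mem (filt_mono (le_max_left _ _) h1) (filt_mono (le_max_right _ _) h2)
  | mul a b _ _ ha hb =>
    intro n c hc
    obtain ⟨n1, h1⟩ := hb n c hc
    obtain ⟨n2, h2⟩ := ha n1 _ h1
    exact ⟨n2, by rwa [mul_assoc]⟩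

variable {g : B}

/-- This is $\Delta(yb)=yb_{(1)}\otimes gb_{(2)}+b_{(1)}\otimes yb_{(2)}$ with $v$ applied to the
second leg. Only the first term keeps the factor $y$ outside, and there $v$ is replaced by
$v(g\,\cdot)$. -/
theorem act_mul (hy : Coalgebra.comul (R := k) y = y ⊗ₜ g + 1 ⊗ₜ y) (v : B →ₗ[k] k) (b : B) :
    act v (y * b) = y * act (v ∘ₗ LinearMap.mulLeft k g) b + act (v ∘ₗ LinearMap.mulLeft k y) b := by
  simp only [act, LinearMap.comp_apply, Bialgebra.comul_mul, hy]
  generalize (Coalgebra.comul b : B ⊗[k] B) = z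
  induction z with
  | zero => simp
  | tmul a b => simp [add_mul, Algebra.TensorProduct.tmul_mul_tmul]
  | add a b ha hb => simp only [mul_add, map_add, ha, hb]; abel

/-- Group-likes are eigenvectors of every functional, which settles degree $0$. In `act_mul` the
first term gains back one factor $y$ and the second has lower degree. The functional must vary in
the induction, since `act_mul` changes it. -/
theorem act_mem_filt (hy : Coalgebra.comul (R := k) y = y ⊗ₜ g + 1 ⊗ₜ y) (n : ℕ) :
    ∀ (v : B →ₗ[k] k), ∀ b ∈ filt k y n, act v b ∈ filt k y n := by
  induction n with
  | zero =>
    intro v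
    refine (Submodule.span_le (p := (filt k y 0).comap (act v))).2 fun s hs => ?_
    change act v s ∈ filt k y 0
    rw [act_groupLike v hs.1]
    exact Submodule.smul_mem _ _ (Submodule.subset_span hs)
  | succ n ih =>
    intro v
    refine filt_succ_le (P := (filt k y (n + 1)).comap (act v))
      (fun b hb => filt_mono n.le_succ (ih v b hb)) fun b hb => ?_
    change act v (y * b) ∈ filt k y (n + 1)
    rw [act_mul hy]
    exact add_mem (mul_mem_filt (ih _ b hb)) (filt_mono n.le_succ (ih _ b hb))

theorem act_eq_zero {v : B →ₗ[k] k} (hv : ∀ s ∈ quasiCommuting k y, v s = 0) {b : B}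
    (hb : b ∈ filt k y 0) : act v b = 0 := by
  refine (Submodule.span_le (p := LinearMap.ker (act v))).2 (fun s hs => ?_) hb
  change act v s = 0
  rw [act_groupLike v hs.1, hv s hs, zero_smul]

/-- The condition on $v$ is inherited by $v(g\,\cdot)$, because $g$ is itself quasi-commuting. So in
`act_mul` the first term drops in degree by induction. The second term has already lost its factor
$y$, and no condition on $v(y\,\cdot)$ is needed. -/
theorem act_mem_filt_pred (hy : Coalgebra.comul (R := k) y = y ⊗ₜ g + 1 ⊗ₜ y)
    (hg : g ∈ quasiCommuting k y) (n : ℕ) :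
    ∀ v : B →ₗ[k] k, (∀ s ∈ quasiCommuting k y, v s = 0) →
      ∀ b ∈ filt k y (n + 1), act v b ∈ filt k y n := by
  induction n with
  | zero =>
    intro v hv
    refine filt_succ_le (P := (filt k y 0).comap (act v))
      (fun b hb => act_mem_filt hy 0 v b hb) fun b hb => ?_
    change act v (y * b) ∈ filt k y 0
    -- In the lowest case there is no degree below $0$ to drop to. Instead $v(g\,\cdot)$ annihilates
    -- the group-likes in degree $0$, and the term beginning with $y$ disappears.
    rw [act_mul hy, act_eq_zero (v := v ∘ₗ LinearMap.mulLeft k g)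
      (fun s hs => hv (g * s) (mul_mem_quasiCommuting hg hs)) hb, mul_zero,
      zero_add]
    exact act_mem_filt hy 0 _ b hb
  | succ n ih =>
    intro v hv
    refine filt_succ_le (P := (filt k y (n + 1)).comap (act v))
      (fun b hb => filt_mono n.le_succ (ih v hv b hb)) fun b hb => ?_
    change act v (y * b) ∈ filt k y (n + 1)
    rw [act_mul hy]
    exact add_mem (mul_mem_filt (ih (v ∘ₗ LinearMap.mulLeft k g)
      (fun s hs => hv (g * s) (mul_mem_quasiCommuting hg hs)) b hb))
      (act_mem_filt hy (n + 1) _ b hb)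

/-- A bialgebra generated by a skew primitive element `y` and by group-like elements which commute
with `y` up to scalars. -/
theorem locallyNilpotent_of_adjoin (hy : Coalgebra.comul (R := k) y = y ⊗ₜ g + 1 ⊗ₜ y)
    (hg : g ∈ quasiCommuting k y)
    (h : Algebra.adjoin k (insert y (quasiCommuting k y)) = ⊤) : LocallyNilpotent k B := by
  intro f f' b
  have hv : ∀ s ∈ quasiCommuting k y, convComm f f' s = 0 := fun s hs => convComm_groupLike f f' hs.1
  -- From degree $n$, it takes $n$ applications to reach degree $0$ and one more to vanish.
  have key : ∀ n, ∀ b ∈ filt k y n, (act (convComm f f') ^ (n + 1)) b = 0 := by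
    intro n
    induction n with
    | zero =>
      intro b hb
      rw [zero_add, pow_one]
      exact act_eq_zero hv hb
    | succ n ih =>
      intro b hb
      rw [pow_succ, Module.End.mul_apply]
      exact ih _ (act_mem_filt_pred hy hg n _ hv b hb)
  obtain ⟨n, hn⟩ := exists_mem_filt h b
  refine ⟨n + 1, fun l hl => ?_⟩
  obtain ⟨j, rfl⟩ := Nat.exists_eq_add_of_le' hl
  -- The exponent is split so that the power which kills $b$ acts first.
  rw [pow_add, Module.End.mul_apply, key n b hn, map_zero]

/-- The zero element is skew primitive, and every group-like commutes with it. With $y=0$ the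
filtration therefore sits in degree $0$. -/
theorem locallyNilpotent_of_span_groupLike (h : Submodule.span k {b : B | IsGroupLikeElem k b} = ⊤) :
    LocallyNilpotent k B := by
  refine locallyNilpotent_of_adjoin (y := 0) (g := 1) (by simp) (one_mem_quasiCommuting 0) ?_
  refine Algebra.eq_top_iff.2 fun b => Algebra.span_le_adjoin k _ ?_
  have hb : b ∈ Submodule.span k {b : B | IsGroupLikeElem k b} := h ▸ Submodule.mem_top
  exact Submodule.span_mono (fun s hs => Or.inr ⟨hs, 0, by simp⟩) hb

end bialgebra
end CommutatorAction

/-! ### Local nilpotency for the comparison Hopf algebras. -/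

namespace HopfPres

theorem adjoin_eq_top {k G : Type*} [Field k] {rel : FreeAlgebra k G → FreeAlgebra k G → Prop}
    {S : Set (Pres rel)} (h : ∀ a, gen rel a ∈ Algebra.adjoin k S) : Algebra.adjoin k S = ⊤ := by
  refine Algebra.eq_top_iff.2 fun z => ?_
  induction z using HopfPres.induction with
  | hs r => exact Subalgebra.algebraMap_mem _ r
  | hg a => exact h a
  | hm a b ha hb => exact mul_mem ha hb
  | ha a b ha hb => exact add_mem ha hb

end HopfPres

namespace CommutatorAction
open HopfPres
variable {k : Type*} [Field k]

/-- A primitive generator is skew primitive with $g=1$, and no group-like other than $1$ is needed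
to generate. -/
theorem locallyNilpotent_polynomial : LocallyNilpotent k (Polynomial k) := by
  refine locallyNilpotent_of_adjoin (y := Polynomial.X) (g := 1) (Polynomial.aeval_X _)
    (one_mem_quasiCommuting _) (eq_top_iff.2 ?_)
  rw [← Polynomial.adjoin_X]
  exact Algebra.adjoin_mono (by simp)

theorem locallyNilpotent_monoidAlgebra (G : Type*) [Monoid G] :
    LocallyNilpotent k (MonoidAlgebra k G) :=
  locallyNilpotent_of_span_groupLike MonoidAlgebra.span_isGroupLikeElem

/-- Laurent polynomials are the group algebra of $\mathbb Z$, spanned by the group-like powers of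
the variable. -/
theorem locallyNilpotent_laurent : LocallyNilpotent k (LaurentPolynomial k) :=
  locallyNilpotent_of_span_groupLike AddMonoidAlgebra.span_isGroupLikeElem

theorem locallyNilpotent_taft (q : TaftDatum k) : LocallyNilpotent k (TaftAlg q) := by
  have hg : (TaftAlg.g q : TaftAlg q) ∈ quasiCommuting k (TaftAlg.x q) := by
    -- The relation $xg=\xi gx$ must be read as $gx=\xi^{-1}xg$ to match the convention of
    -- `quasiCommuting`.
    refine ⟨⟨TaftAlg.ε_g q, TaftAlg.Δ_g q⟩, q.ξ⁻¹, ?_⟩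
    rw [TaftAlg.x_g, smul_smul, inv_mul_cancel₀ (q.prim.ne_zero (by have := q.one_lt; omega)),
      one_smul]
  -- All powers are needed, since the group-like attached to the skew primitive $x$ is $g^t$ rather
  -- than $g$.
  have hgn : ∀ n, (TaftAlg.g q : TaftAlg q) ^ n ∈ quasiCommuting k (TaftAlg.x q) := by
    intro n
    induction n with
    | zero => simpa using one_mem_quasiCommuting _
    | succ n ih => rw [pow_succ]; exact mul_mem_quasiCommuting ih hg
  refine locallyNilpotent_of_adjoin (TaftAlg.Δ_x q) (hgn q.t) (adjoin_eq_top fun a => ?_)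
  apply Algebra.subset_adjoin
  cases a with
  | g => exact Or.inr hg
  | x => exact Or.inl rfl

/-- Here $y$ is the skew primitive generator. The group-likes $x^{\pm1}$ commute with it, and $g$
commutes with it up to $\gamma^{-1}$. -/
theorem locallyNilpotent_liu (q : LiuDatum k) : LocallyNilpotent k (LiuAlg q) := by
  have hg : (LiuAlg.g q : LiuAlg q) ∈ quasiCommuting k (LiuAlg.y q) := by
    refine ⟨⟨LiuAlg.ε_g q, LiuAlg.Δ_g q⟩, q.γ⁻¹, ?_⟩
    rw [LiuAlg.y_g, smul_smul, inv_mul_cancel₀ (q.prim.ne_zero q.n_pos.ne'), one_smul]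
  have hx : IsGroupLikeElem k (LiuAlg.x q : LiuAlg q) := ⟨LiuAlg.ε_x q, LiuAlg.Δ_x q⟩
  refine locallyNilpotent_of_adjoin (LiuAlg.Δ_y q) hg (adjoin_eq_top fun a => ?_)
  apply Algebra.subset_adjoin
  cases a with
  | x => exact Or.inr ⟨hx, 1, by rw [one_smul]; exact LiuAlg.x_y q⟩
  | xInv =>
    exact Or.inr ⟨isGroupLikeElem_unitsInv.2 hx, 1, by rw [one_smul]; exact LiuAlg.xinv_y q⟩
  | g => exact Or.inr hg
  | y => exact Or.inl rfl

end CommutatorAction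
end

/-! ### A character and a two-dimensional representation of $D(m,d,\xi)$. -/

noncomputable section

namespace DDatum
open Finset Polynomial QComb

variable {k : Type*} [Field k] (p : DDatum k)

/-- Scaling $x^d$ by $\gamma^j$ turns $\phi_l=1-\gamma^{-l-1}x^d$ into $\phi_{l-j}$, so the window
of factors is shifted. -/
theorem aeval_pol_mul (i j : ZMod p.m) (N : ℕ) (a : k) :
    aeval (p.χ j * a) (pol p.hγ i N) = aeval a (pol p.hγ (i - j) N) := by
  rw [pol, pol, map_prod, map_prod]
  refine Finset.prod_congr rfl fun l _ => ?_
  rw [show i - j = i + -j by ring, show -(i + -j) - 1 - (l : ZMod p.m) = -i - 1 - l + j by ring,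
    AddChar.map_add_eq_mul]
  simp [mul_assoc]

/-- The power of $0$ forces $i+j=0$. Then the product has $m-1$ consecutive factors and omits
exactly $\phi_{i-1}$. At $x^d=\gamma^t$ the one vanishing factor is $\phi_{t-1}$, so the value is
nonzero only for $i=t$, where it is $\prod_{a=1}^{m-1}(1-\gamma^{-a})=m$. The proof shifts by $t$ to
reduce to evaluation at $1$. These are the scalars by which $u_iu_j$ acts when $y$ acts as zero. -/
theorem aeval_χ (i j t : ZMod p.m) :
    aeval (p.χ t) (pol p.hγ i (p.m - 1 - (i + j).val)) * 0 ^ (i + j).val =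
      if i = t ∧ j = -t then (p.m : k) else 0 := by
  have h1 := p.aeval_pol_mul i t (p.m - 1 - (i + j).val) (1 : k)
  have h2 := eval_pol_one p.hγ (i - t) (j + t)
  rw [show i - t + (j + t) = i + j by ring] at h2
  rw [mul_one] at h1
  rw [h1, h2]
  simp only [sub_eq_zero, add_eq_zero_iff_eq_neg]

theorem psi_neg_one : p.ψ (-1) = -p.ξ := by
  rw [ψ_neg, ψ, psi_one p.prim]

/-- The images of the generators under the character `x ↦ 1`, `g ↦ γ`, `u_0 ↦ ξ`. -/
theorem nice_character : Nice p (1 : kˣ) (Units.mk0 p.γ p.γ_ne) (0 : k)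
    (fun i => if i = 0 then p.ξ else 0) where
  xg := Commute.one_left _
  xy := by simp
  yg := by simp
  ypow := by rw [zero_pow p.m_pos.ne']; simp
  gpow := by ext; simp [p.hγ.pow_eq_one]
  xu := by simp
  yu i := by
    by_cases hi : i + 1 = 0
    · have : -i - 1 = 0 := by linear_combination -hi
      simp [this]
    · simp [hi]
  uy := by simp
  ug i := by by_cases hi : i = 0 <;> simp [hi, mul_comm]
  uu i j := by
    have := eval_pol_one p.hγ i j
    simp only [one_zpow, Units.val_one, one_mul, one_pow, this, Units.val_mk0]
    have hm := p.m_ne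
    by_cases hi : i = 0 <;> by_cases hj : j = 0 <;> simp [hi, hj, psi_zero, hm]
    -- Only $u_0u_0$ survives. Its relation reads $\xi^2=\gamma$, which is why $g\mapsto\gamma$ is
    -- paired with $u_0\mapsto\xi$.
    rw [γ]; field_simp

/-- Invertible diagonal matrices of size two. -/
def diag₂ : kˣ × kˣ →* (Matrix (Fin 2) (Fin 2) k)ˣ where
  toFun ab := ⟨!![(ab.1 : k), 0; 0, (ab.2 : k)], !![(↑ab.1⁻¹ : k), 0; 0, (↑ab.2⁻¹ : k)],
    by simp [Matrix.one_fin_two], by simp [Matrix.one_fin_two]⟩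
  map_one' := by ext1; simp [Matrix.one_fin_two]
  map_mul' a b := by ext1; simp

theorem diag₂_val (a b : kˣ) :
    (diag₂ (a, b) : Matrix (Fin 2) (Fin 2) k) = !![(a : k), 0; 0, (b : k)] := rfl

theorem diag₂_inv (a b : kˣ) : (diag₂ (a, b))⁻¹ = diag₂ (a⁻¹, b⁻¹) := rfl

theorem diag₂_pow (a b : kˣ) (n : ℕ) : diag₂ (a, b) ^ n = diag₂ (a ^ n, b ^ n) := by
  rw [← map_pow]; rfl

theorem diag₂_zpow (a b : kˣ) (n : ℤ) : diag₂ (a, b) ^ n = diag₂ (a ^ n, b ^ n) := by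
  rw [← map_zpow]; rfl

theorem aeval_diag₂ (a b : k) (P : k[X]) :
    aeval !![a, 0; 0, b] P = !![aeval a P, 0; 0, aeval b P] := by
  induction P using Polynomial.induction_on' with
  | add P Q h1 h2 => simp [h1, h2]
  | monomial n r =>
    have : ∀ n, !![a, 0; 0, b] ^ n = !![a ^ n, 0; 0, b ^ n] := by
      intro n
      induction n with
      | zero => simp [Matrix.one_fin_two]
      | succ n ih => simp [pow_succ, ih]
    simp [aeval_monomial, this, ← Algebra.smul_def]

/-- A two-dimensional representation in which `u_1` and `u_{-1}` do not act as zero. -/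
theorem nice_matrix (l : kˣ) (hl : (l : k) ^ p.d = p.γ) :
    Nice p (diag₂ (l, l⁻¹)) (diag₂ (Units.mk0 p.γ p.γ_ne, 1)) (0 : Matrix (Fin 2) (Fin 2) k)
      (fun i => !![0, if i = 1 then 1 else 0; if i = -1 then -p.ξ * (l : k) ^ p.c else 0, 0]) := by
  have hγ0 := p.γ_ne
  have hl' : l ^ p.d = Units.mk0 p.γ p.γ_ne := Units.ext (by simpa using hl)
  have hlm : l ^ (p.m * p.d) = 1 := by
    ext; rw [mul_comm, pow_mul, hl']; simp [p.hγ.pow_eq_one]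
  -- With $2c=(1+m)d$ one has $l^{2c}=\gamma^{1+m}=\gamma$. This explains the entry $-\xi l^c$ of
  -- $u_{-1}$: the relation for $u_{-1}u_1$ asks for $-\xi l^c$, the one for $u_1u_{-1}$ asks for
  -- $-\xi l^{-c}\gamma$, and the two agree.
  have hc : (l : k) ^ p.c * (l : k) ^ p.c = p.γ := by
    rw [← pow_add, ← two_mul, two_c, mul_comm, pow_mul, hl, pow_add, p.hγ.pow_eq_one, pow_one,
      mul_one]
  -- The eigenvalues of $x^d$ are $\gamma^{\pm1}$, written as character values so that `aeval_χ`
  -- applies at $t=\pm1$.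
  have hx : ((diag₂ (l, l⁻¹)) ^ p.d : Matrix (Fin 2) (Fin 2) k) =
      !![p.χ 1, 0; 0, p.χ (-1)] := by
    rw [← Units.val_pow_eq_pow_val, diag₂_pow, inv_pow, hl', diag₂_val, χ_neg_one, chr_one]
    simp
  constructor
  case xg => ext1; simp [diag₂_val, mul_comm]
  case xy => simp
  case yg => simp
  case ypow =>
    rw [zero_pow p.m_pos.ne', diag₂_pow, inv_pow, hlm]
    simp [diag₂_val, Matrix.one_fin_two]
  case gpow =>
    rw [diag₂_pow, diag₂_pow, inv_pow, hlm]
    congr 1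
    ext <;> simp [p.hγ.pow_eq_one]
  case xu =>
    intro i
    rw [diag₂_inv]
    simp only [diag₂_val, Matrix.mul_fin_two]
    ext a b
    fin_cases a <;> fin_cases b <;> simp [mul_comm]
  case yu =>
    intro i
    rw [Units.val_pow_eq_pow_val, hx]
    ext a b
    fin_cases a <;> fin_cases b <;> simp [Matrix.one_fin_two]
    -- As $y$ acts by zero, $\phi_i$ has to annihilate $u_{i+1}$. For $u_1$ this is $\phi_0$ at the
    -- eigenvalue $\gamma$, and for $u_{-1}$, treated next, it is $\phi_{-2}$ at $\gamma^{-1}$.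
    · intro hi
      subst hi
      rw [neg_zero, zero_sub, χ_neg_one, chr_one, inv_mul_cancel₀ hγ0, sub_self]
    · intro hi
      left
      rw [show -i - 1 = 1 by linear_combination -hi, χ_neg_one, chr_one, mul_inv_cancel₀ hγ0,
        sub_self]
  case uy => simp
  case ug =>
    intro i
    have e : l ^ (2 * p.d : ℤ) = Units.mk0 p.γ p.γ_ne ^ 2 := by
      rw [mul_comm, zpow_mul, zpow_natCast, hl']; rfl
    rw [diag₂_zpow, zpow_neg, zpow_neg, inv_zpow, e]
    simp only [diag₂_val, Matrix.mul_fin_two]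
    ext a b
    fin_cases a <;> fin_cases b <;> simp
    · refine ite_congr rfl (fun hi => ?_) fun _ => rfl
      rw [hi, chr_one]
      field_simp
    · refine ite_congr rfl (fun hi => ?_) fun _ => rfl
      rw [hi, χ_neg_one]
      field_simp
  case uu =>
    intro i j
    -- The power of $y$ is $1$ when $i+j=0$ and $0$ otherwise. Writing it through scalar powers
    -- $0^n$, with $0^0=1$, handles both cases at once.
    have hz : ∀ n, (0 : Matrix (Fin 2) (Fin 2) k) ^ n = !![0 ^ n, 0; 0, 0 ^ n] := by
      intro n; cases n <;> ext a b <;> fin_cases a <;> fin_cases b <;> simp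
    have h1 := p.aeval_χ i j 1
    have h2 := p.aeval_χ i j (-1)
    have hm := p.m_ne
    have hl0 := l.ne_zero
    rw [neg_neg] at h2
    rw [Units.val_pow_eq_pow_val, hx, aeval_diag₂, diag₂_zpow, hz, diag₂_val, diag₂_val]
    simp only [Matrix.mul_fin_two, mul_zero, zero_mul, add_zero, zero_add, mul_assoc, Units.val_mk0,
      Units.val_one, mul_one]
    -- The polynomial value is grouped with the power of $0$, which is the combination evaluated by
    -- `aeval_χ` in each diagonal position.
    rw [← mul_assoc (aeval (p.χ 1) _), h1, h2]
    ext a b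
    fin_cases a <;> fin_cases b <;> simp
    -- Upper diagonal entry: only $u_1u_{-1}$ contributes, with $\psi(-1)=-\xi$, and `hc` converts
    -- $l^{-c}\gamma$ into $l^c$.
    · by_cases hi : i = 1 <;> by_cases hj : j = -1 <;> simp [hi, hj]
      rw [psi_neg_one, ← hc]
      field_simp
    · by_cases hi : i = -1 <;> by_cases hj : j = 1 <;> simp [hi, hj]
      rw [ψ, psi_one p.prim]
      field_simp

end DDatum
end

/-! ### The commutator acting on the $u_i$ by a cyclic shift. -/

noncomputable section

namespace DAlg
open DDatum HopfPres CommutatorAction Finset QComb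

variable {k : Type*} [Field k] (p : DDatum k)

/-- The character `x ↦ 1`, `g ↦ γ`, `u_0 ↦ ξ`. -/
def character : DAlg p →ₐ[k] k := HopfPres.lift _ (nice_character p).lift_rel

theorem character_x : character p (x p) = (1 : kˣ) := lift_gen _ (nice_character p).lift_rel .x

theorem character_g : character p (g p) = Units.mk0 p.γ p.γ_ne :=
  lift_gen _ (nice_character p).lift_rel .g

theorem character_u (i : ZMod p.m) : character p (u p i) = if i = 0 then p.ξ else 0 :=
  lift_gen _ (nice_character p).lift_rel (.u i)

/-- Since $h=x^{-d}g\mapsto\gamma$, the values vary with $j$. The diagonal matrix is therefore not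
scalar when $\gamma\neq1$. The counit, which is $1$ on every $H_j$, would give a zero commutator. -/
theorem character_H_mul_u (j i : ZMod p.m) :
    character p ((nice p).H j * u p i) = if i = 0 then p.χ j * p.ξ else 0 := by
  rw [map_mul, map_H p _ _ _ (character_x p) (character_g p), character_u, ← chr_pow_val p.hγ]
  simp

variable {l : kˣ} (hl : (l : k) ^ p.d = p.γ)

/-- The two-dimensional representation `nice_matrix`. -/
def toMatrix : DAlg p →ₐ[k] Matrix (Fin 2) (Fin 2) k :=
  HopfPres.lift _ (nice_matrix p l hl).lift_rel

theorem toMatrix_x : toMatrix p hl (x p) = diag₂ (l, l⁻¹) :=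
  lift_gen _ (nice_matrix p l hl).lift_rel .x

theorem toMatrix_g : toMatrix p hl (g p) = diag₂ (Units.mk0 p.γ p.γ_ne, 1) :=
  lift_gen _ (nice_matrix p l hl).lift_rel .g

theorem toMatrix_u (i : ZMod p.m) : toMatrix p hl (u p i) =
    !![0, if i = 1 then 1 else 0; if i = -1 then -p.ξ * (l : k) ^ p.c else 0, 0] :=
  lift_gen _ (nice_matrix p l hl).lift_rel (.u i)

/-- A matrix coefficient of `toMatrix`. -/
def coeff : DAlg p →ₗ[k] k :=
  Matrix.entryLinearMap k k 0 1 ∘ₗ (toMatrix p hl).toLinearMap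

/-- The representation sends $h$ to
$\mathrm{diag}(\gamma^{-1}\gamma,\gamma)=\mathrm{diag}(1,\gamma)$. Left multiplication by $H_j$ thus
leaves the first row of a matrix unchanged, and the value does not depend on $j$. -/
theorem coeff_H_mul_u (j i : ZMod p.m) :
    coeff p hl ((nice p).H j * u p i) = if i = 1 then 1 else 0 := by
  have hl' : l ^ p.d = Units.mk0 p.γ p.γ_ne := Units.ext (by simpa using hl)
  change toMatrix p hl ((nice p).H j * u p i) 0 1 = _
  rw [map_mul, map_H p _ _ _ (toMatrix_x p hl) (toMatrix_g p hl), toMatrix_u, diag₂_pow, diag₂_inv,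
    ← map_mul, hl', Prod.mk_mul_mk, inv_mul_cancel, diag₂_pow, diag₂_val]
  simp

/-- A diagonal functional composed with a shift is again a shift, in either order. The two orders
sample the diagonal at the two ends $j$ and $j+1$ of the step, giving $\gamma^j\xi$ and
$\gamma^{j+1}\xi$. Their difference carries the factor $1-\gamma$. -/
theorem convComm_H_mul_u (j i : ZMod p.m) :
    convComm (character p).toLinearMap (coeff p hl) ((nice p).H j * u p i) =
      if i = 1 then p.χ j * p.ξ * (1 - p.γ) else 0 := by
  have h1 : (Coalgebra.comul ((nice p).H j * u p i : DAlg p) : DAlg p ⊗[k] DAlg p) =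
      ∑ s, p.χ (s * (i - s)) • (((nice p).H j * u p s : DAlg p) ⊗ₜ[k]
        ((nice p).H (j + s) * u p (i - s) : DAlg p)) := by
    rw [Bialgebra.comul_mul]
    refine (congrArg₂ _ (Δ_H p j) (Δ_u p i)).trans ?_
    rw [mul_sum]
    refine sum_congr rfl fun s _ => ?_
    rw [mul_smul_comm, Algebra.TensorProduct.tmul_mul_tmul, ← mul_assoc, Nice.HH]
  rw [convComm, LinearMap.comp_apply, LinearMap.comp_apply, h1, map_sum, map_sum]
  simp only [map_smul, LinearMap.sub_apply, TensorProduct.map_tmul, map_sub, LinearMap.mul'_apply,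
    AlgHom.toLinearMap_apply, character_H_mul_u, coeff_H_mul_u, smul_sub, sum_sub_distrib]
  -- With the character on the first leg only $s=0$ survives. With the matrix coefficient on the
  -- first leg only $s=1$ does. In both cases the other leg then forces $i=1$.
  rw [sum_eq_single 0 (fun s _ hs => by simp [hs]) (by simp),
    sum_eq_single 1 (fun s _ hs => by simp [hs]) (by simp)]
  by_cases hi : i = 1
  · simp [hi, AddChar.map_add_eq_mul, chr_one]
    ring
  · simp [hi, sub_eq_zero]

/-- In $\Delta(u_i)$ the second leg is $H_ju_{i-j}$, on which the commutator vanishes unless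
$i-j=1$. One factor $\gamma^{i-1}$ comes from the coefficient of that summand, the other from the
value of the commutator. -/
theorem act_convComm_u (i : ZMod p.m) :
    act (convComm (character p).toLinearMap (coeff p hl)) (u p i) =
      (p.χ (i - 1) * (p.χ (i - 1) * p.ξ * (1 - p.γ))) • u p (i - 1) := by
  have h1 : (Coalgebra.comul (u p i) : DAlg p ⊗[k] DAlg p) = ∑ j, p.χ (j * (i - j)) •
      (u p j ⊗ₜ[k] (((nice p).H j : DAlg p) * u p (i - j))) := Δ_u p i
  rw [act, LinearMap.comp_apply, LinearMap.comp_apply, h1, map_sum, map_sum]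
  rw [sum_eq_single (i - 1)]
  · simp [convComm_H_mul_u, smul_smul]
  · intro j _ hj
    have : i - j ≠ 1 := fun h => hj (by linear_combination -h)
    simp [convComm_H_mul_u, this]
  · simp

/-- Indices live modulo $m$, so a shift with nonzero coefficients never dies: arbitrarily high
powers bring $u_0$ back to a nonzero multiple of itself. -/
theorem not_locallyNilpotent [IsAlgClosed k] (hm : 2 ≤ p.m) : ¬ LocallyNilpotent k (DAlg p) := by
  intro h
  -- The two-dimensional representation requires a $d$-th root of $\gamma$ as an eigenvalue of $x$.
  obtain ⟨l, hl⟩ := IsAlgClosed.exists_pow_nat_eq p.γ p.d_pos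
  have hl0 : l ≠ 0 := by
    rintro rfl
    rw [zero_pow p.d_pos.ne'] at hl
    exact p.γ_ne hl.symm
  have hl' : ((Units.mk0 l hl0 : kˣ) : k) ^ p.d = p.γ := hl
  obtain ⟨N, hN⟩ := h (character p).toLinearMap (coeff p hl') (u p 0)
  -- This is where $m\ge2$ matters: a primitive $m$-th root of unity is then different from $1$, and
  -- the shift coefficients do not vanish.
  have hγ1 : (1 : k) - p.γ ≠ 0 := sub_ne_zero.2 (p.hγ.ne_one (by omega)).symm
  have key : ∀ n : ℕ, ∃ c : k, c ≠ 0 ∧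
      (act (convComm (character p).toLinearMap (coeff p hl')) ^ n) (u p 0) = c • u p (-n) := by
    intro n
    induction n with
    | zero => exact ⟨1, one_ne_zero, by simp⟩
    | succ n ih =>
      obtain ⟨c, hc, e⟩ := ih
      refine ⟨c * (p.χ (-n - 1) * (p.χ (-n - 1) * p.ξ * (1 - p.γ))), ?_, ?_⟩
      · have hχ : p.χ (-n - 1) ≠ 0 := by
          rw [← chr_pow_val p.hγ]; exact pow_ne_zero _ p.γ_ne
        exact mul_ne_zero hc (mul_ne_zero hχ (mul_ne_zero (mul_ne_zero hχ p.ξ_ne) hγ1))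
      · rw [pow_succ', Module.End.mul_apply, e, map_smul, act_convComm_u, smul_smul]
        congr 2
        push_cast
        ring
  -- The exponent is at least $N$, so the power should vanish, and it is a multiple of $m$, so the
  -- index returns to $0$.
  obtain ⟨c, hc, e⟩ := key (N * p.m)
  rw [hN _ (Nat.le_mul_of_pos_right N p.m_pos)] at e
  have hu : u p 0 = 0 := by
    have := (smul_eq_zero.1 e.symm).resolve_left hc
    simpa using this
  -- The counit takes the value $1$ on $u_0$, which shows $u_0\neq0$ without a basis of the algebra.
  have := ε_u p 0
  simp [hu] at this

end DAlg
end

theorem mainTheorem6 {k : Type*} [Field k] [IsAlgClosed k] [CharZero k]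
    (p : DDatum k) (hm : 2 ≤ p.m) :
    IsEmpty (DAlg p ≃ₐc[k] Polynomial k) ∧
    IsEmpty (DAlg p ≃ₐc[k] LaurentPolynomial k) ∧
    IsEmpty (DAlg p ≃ₐc[k] MonoidAlgebra k (DihedralGroup 0)) ∧
    (∀ q : TaftDatum k, IsEmpty (DAlg p ≃ₐc[k] TaftAlg q)) ∧
    (∀ q : LiuDatum k, IsEmpty (DAlg p ≃ₐc[k] LiuAlg q)) := by
  have key := DAlg.not_locallyNilpotent p hm
  open CommutatorAction in
  -- In every case only the underlying coalgebra isomorphism is used, to pull local nilpotency back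
  -- to $D(m,d,\xi)$.
  exact ⟨⟨fun φ => key (locallyNilpotent_polynomial.of_equiv φ.toCoalgEquiv)⟩,
    ⟨fun φ => key (locallyNilpotent_laurent.of_equiv φ.toCoalgEquiv)⟩,
    ⟨fun φ => key ((locallyNilpotent_monoidAlgebra _).of_equiv φ.toCoalgEquiv)⟩,
    fun q => ⟨fun φ => key ((locallyNilpotent_taft q).of_equiv φ.toCoalgEquiv)⟩,
    fun q => ⟨fun φ => key ((locallyNilpotent_liu q).of_equiv φ.toCoalgEquiv)⟩⟩
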